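/- **Theorem (spanning tree model for Khovanov homology).** All modules and complexes are bigraded over $\mathbb Z$; $[m]$ and $\{k\}$ denote the shifts $(M[m]\{k\})^{i,j}=M^{i-m,j-k}$, and isomorphisms preserve the bigrading. Let $\mathcal A$ be the bigraded module with $\mathcal A^{0,1}=\mathcal A^{0,-1}=\mathbb Z$ and $\mathcal A^{i,j}=0$ otherwise. Let $D$ be a connected unoriented link diagram with numbered crossings. *Khovanov complex.* $\mathcal C(D)$ is the (unnormalized) Khovanov complex, with differential of bidegree $(1,0)$: as a module it is $\bigoplus_{S}\mathcal A^{\otimes |S|}[r(D,S)]\{r(D,S)\}$, where $S$ runs over all Kauffman states of $D$, $|S|$ is the number of circles of $S$ and $r(D,S)$ is the number of $1$-smoothings in $S$; its differential is the signed sum, over the changes of a $0$-smoothing into a $1$-smoothing, of the maps induced by the multiplication $v_+v_+=v_+$, $v_+v_-=v_-v_+=v_-$, $v_-v_-=0$ (two circles merge) and the comultiplication $v_+\mapsto v_+\otimes v_-+v_-\otimes v_+$, $v_-\mapsto v_-\otimes v_-$ (a circle splits), where $v_\pm$ generates $\mathcal A^{0,\pm1}$ and the sign is $(-1)^{m}$,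 $m$ being the number of $1$-smoothings at crossings preceding the changed one. *The diagrams $D_S$.* Treat the crossings of $D$ in order; whenever both smoothings of the crossing under consideration in the current (partially smoothened) diagram are connected, branch into these two smoothings; otherwise leave the crossing unsmoothened. Let $\mathcal T(D)$ be the set of diagrams at the leaves of the resulting binary tree. Let $\mathcal K_1(D)$ be the set of Kauffman states of $D$ consisting of exactly one circle. For $S\in\mathcal K_1(D)$, let $D_S$ be the unique element of $\mathcal T(D)$ that has $S$ among its Kauffman states. Choose any orientation of $D_S$ and let $w(D_S)$ be the number of negative crossings minus the number of positive crossings of $D_S$ (that is, $w$ is minus the usual writhe). Then there is a decomposition of complexes $\mathcal C(D)\cong A\oplus B$, where $B$ is contractible (there is an endomorphism $p$ of $B$ of bidegree $(-1,0)$ with $pd+dp=\mathrm{id}_B$) and $A$, as a bigraded module, is $$A\cong\bigoplus_{S\in\mathcal K_1(D)}\mathcal A[w(D_S)]\{2w(D_S)\}[r(D,S)]\{r(D,S)\}.$$ -/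

import Mathlib

open CategoryTheory
open scoped DirectSum

/-! ### Link diagrams -/

/-- The strand ends at the `n` numbered crossings of a diagram. The ends `(c, 0)`, `(c, 1)`,
`(c, 2)`, `(c, 3)` lie around the crossing `c` in counterclockwise order; `(c, 0)` and `(c, 2)`
belong to the under-strand, `(c, 1)` and `(c, 3)` to the over-strand. -/
abbrev StrandEnd (n : ℕ) : Type := Fin n × Fin 4

/-- The rotation system: the next end, counterclockwise, at the same crossing. -/
def nextEnd (n : ℕ) : Equiv.Perm (StrandEnd n) :=
  Equiv.prodCongr (Equiv.refl (Fin n)) (Equiv.addRight 1)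

/-- A planar diagram code (without the condition of planarity): the edges of the diagram join the
strand ends in pairs, and there are `loops` further circles which meet no crossing. -/
structure PDCode (n : ℕ) where
  glue : Equiv.Perm (StrandEnd n)
  glue_glue : ∀ x, glue (glue x) = x
  glue_ne : ∀ x, glue x ≠ x
  loops : ℕ

/-- A choice, at each crossing, of doing nothing (`none`), of the `0`-smoothing (`some false`), or
of the `1`-smoothing (`some true`). Applied to a diagram `D` this is a diagram `D'` obtained from
`D` by smoothening some of the crossings. -/
abbrev PartialSmoothing (n : ℕ) : Type := Fin n → Option Bool

/-- A choice of smoothing at every crossing, `false` for the `0`-smoothing and `true` for the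
`1`-smoothing. -/
abbrev KauffmanState (n : ℕ) : Type := Fin n → Bool

/-- A Kauffman state as a diagram all of whose crossings are smoothened. -/
def KauffmanState.toPartial {n : ℕ} (S : KauffmanState n) : PartialSmoothing n :=
  fun c => some (S c)

namespace PartialSmoothing

variable {n : ℕ}

/-- The end at which a strand that arrives at the end `x` leaves the disk around the crossing.
At an unsmoothened crossing it goes straight on; the `0`-smoothing consists of the arcs `0 - 1` and
`2 - 3` (it joins the two regions swept by the over-strand when turned counterclockwise onto the
under-strand), and the `1`-smoothing consists of the arcs `1 - 2` and `3 - 0`. -/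
def through (P : PartialSmoothing n) (x : StrandEnd n) : StrandEnd n :=
  match P x.1 with
  | none => (x.1, x.2 + 2)
  | some false => (x.1, ![1, 0, 3, 2] x.2)
  | some true => (x.1, ![3, 2, 1, 0] x.2)

/-- The number `r(D, D')` of `1`-smoothings. -/
def numOne (P : PartialSmoothing n) : ℕ :=
  (Finset.univ.filter fun c => P c = some true).card

end PartialSmoothing

namespace PDCode

variable {n : ℕ} (D : PDCode n)

/-- Two strand ends are joined in the smoothened diagram if they are the two ends of an edge, or of
an arc in a smoothened crossing, or if they lie at the same unsmoothened crossing. -/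
def Joined (P : PartialSmoothing n) (x y : StrandEnd n) : Prop :=
  y = D.glue x ∨ y = P.through x ∨ (P x.1 = none ∧ y.1 = x.1)

/-- The connected components (as subsets of the plane) of a smoothened diagram. -/
abbrev Component (P : PartialSmoothing n) : Type := Quot (D.Joined P) ⊕ Fin D.loops

/-- The smoothened diagram is connected (as a subset of the plane). -/
def ConnectedAt (P : PartialSmoothing n) : Prop := Nat.card (D.Component P) = 1

/-- The diagram itself is connected. -/
def IsConnected : Prop := D.ConnectedAt (fun _ => none)

/-- The regions cut out by the part of the diagram with crossings, glued as a closed surface: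
the orbits of the face permutation of the rotation system. -/
abbrev Face : Type := Quotient (Equiv.Perm.SameCycle.setoid (nextEnd n * D.glue))

/-- The circles of a Kauffman state: without unsmoothened crossings the components are circles. -/
abbrev Circle (S : KauffmanState n) : Type := D.Component S.toPartial

/-- The circle through a given strand end, or the given crossingless circle. -/
def circleOf (S : KauffmanState n) : StrandEnd n ⊕ Fin D.loops → D.Circle S
  | .inl x => .inl (Quot.mk _ x)
  | .inr l => .inr l

/-- The set `𝒦₁(D)` of Kauffman states which consist of exactly one circle. -/
abbrev OneCircleState : Type := {S : KauffmanState n // Nat.card (D.Circle S) = 1}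

end PDCode

/-- An unoriented link diagram with `n` numbered crossings, up to isotopy of the sphere: a planar
diagram code all of whose components have genus zero, by Euler's formula `V - E + F = 2 C`,
with `n` vertices and `2 n` edges. -/
structure LinkDiagram (n : ℕ) extends PDCode n where
  planar : (n : ℤ) - 2 * n + Nat.card toPDCode.Face
    = 2 * Nat.card (Quot (toPDCode.Joined fun _ => none))

/-! ### The binary tree and the diagrams `D_S` -/

namespace PDCode

variable {n : ℕ} (D : PDCode n)

/-- Both smoothings of the crossing `c` in the smoothened diagram `P` are connected. -/
def Branches (P : PartialSmoothing n) (c : Fin n) : Prop :=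
  ∀ b : Bool, D.ConnectedAt (Function.update P c (some b))

/-- The nodes of the binary tree after the crossings of a list have been treated in turn: a
crossing is smoothened, in both ways, if and only if both results are connected. -/
def treeNodes : List (Fin n) → PartialSmoothing n → Set (PartialSmoothing n)
  | [], P => {P}
  | c :: cs, P =>
    {Q | (D.Branches P c ∧ ∃ b : Bool, Q ∈ treeNodes cs (Function.update P c (some b))) ∨
      (¬ D.Branches P c ∧ Q ∈ treeNodes cs P)}

/-- The set `𝒯(D)` of the diagrams at the leaves of the binary tree. -/
def treeLeaves : Set (PartialSmoothing n) := D.treeNodes (List.finRange n) (fun _ => none)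

open Classical in
/-- Descend in the binary tree, at each branching towards the smoothing used in `S`. -/
noncomputable def descend (S : KauffmanState n) :
    List (Fin n) → PartialSmoothing n → PartialSmoothing n
  | [], P => P
  | c :: cs, P =>
    if D.Branches P c then descend S cs (Function.update P c (some (S c)))
    else descend S cs P

/-- The diagram `D_S`: the leaf of the binary tree that has `S` among its Kauffman states. -/
noncomputable def leafOf (S : KauffmanState n) : PartialSmoothing n :=
  D.descend S (List.finRange n) (fun _ => none)

/-- `S` is a Kauffman state of the smoothened diagram `P`. -/
def IsStateOf (S : KauffmanState n) (P : PartialSmoothing n) : Prop :=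
  ∀ c b, P c = some b → S c = b

theorem descend_mem (S : KauffmanState n) (cs : List (Fin n)) (P : PartialSmoothing n) :
    D.descend S cs P ∈ D.treeNodes cs P := by
  induction cs generalizing P with
  | nil => simp [descend, treeNodes]
  | cons c cs ih =>
    by_cases h : D.Branches P c
    · simp only [descend, h, if_true]
      exact Or.inl ⟨h, S c, ih _⟩
    · simp only [descend, h, if_false]
      exact Or.inr ⟨h, ih _⟩

theorem isStateOf_descend (S : KauffmanState n) (cs : List (Fin n)) (P : PartialSmoothing n)
    (hP : IsStateOf S P) : IsStateOf S (D.descend S cs P) := by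
  induction cs generalizing P with
  | nil => simpa [descend] using hP
  | cons c cs ih =>
    by_cases h : D.Branches P c
    · simp only [descend, h, if_true]
      refine ih _ ?_
      intro c' b hb
      by_cases hc : c' = c
      · subst hc; simpa using hb
      · exact hP c' b (by simpa [Function.update_of_ne hc] using hb)
    · simp only [descend, h, if_false]
      exact ih _ hP

theorem treeNodes_keep (cs : List (Fin n)) (P Q : PartialSmoothing n) (hQ : Q ∈ D.treeNodes cs P)
    (c : Fin n) (hc : c ∉ cs) : Q c = P c := by
  induction cs generalizing P with
  | nil => simp only [treeNodes, Set.mem_singleton_iff] at hQ; rw [hQ]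
  | cons a cs ih =>
    simp only [List.mem_cons, not_or] at hc
    rcases hQ with ⟨_, b, hb⟩ | ⟨_, hb⟩
    · rw [ih _ hb hc.2, Function.update_of_ne hc.1]
    · exact ih _ hb hc.2

theorem eq_descend (S : KauffmanState n) (cs : List (Fin n)) (hcs : cs.Nodup)
    (P Q : PartialSmoothing n) (hQ : Q ∈ D.treeNodes cs P) (hS : IsStateOf S Q) :
    Q = D.descend S cs P := by
  induction cs generalizing P with
  | nil => simpa [descend, treeNodes] using hQ
  | cons c cs ih =>
    rw [List.nodup_cons] at hcs
    rcases hQ with ⟨h, b, hb⟩ | ⟨h, hb⟩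
    · have hkeep := D.treeNodes_keep cs _ _ hb c hcs.1
      rw [Function.update_self] at hkeep
      simp only [descend, h, if_true]
      rw [hS c b hkeep]
      exact ih hcs.2 _ hb
    · simp only [descend, h, if_false]
      exact ih hcs.2 _ hb

/-- `D_S` is the unique element of `𝒯(D)` which has `S` among its Kauffman states. -/
theorem leafOf_unique (S : KauffmanState n) (Q : PartialSmoothing n) :
    (Q ∈ D.treeLeaves ∧ IsStateOf S Q) ↔ Q = D.leafOf S := by
  constructor
  · rintro ⟨h, hS⟩
    exact D.eq_descend S _ (List.nodup_finRange n) _ _ h hS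
  · rintro rfl
    exact ⟨D.descend_mem S _ _, D.isStateOf_descend S _ _ (fun c b h => by simp at h)⟩

/-! ### Orientations and signs of crossings -/

/-- An orientation of (the components with crossings or smoothings of) the smoothened diagram `P`:
`out x` tells whether the strand at `x` runs away from the crossing. -/
structure Orientation (P : PartialSmoothing n) where
  out : StrandEnd n → Bool
  out_glue : ∀ x, out (D.glue x) = !out x
  out_through : ∀ x, out (P.through x) = !out x

variable {D} in
/-- The number `x(D')` of negative crossings. -/
def Orientation.numNeg {P : PartialSmoothing n} (o : D.Orientation P) : ℕ :=
  (Finset.univ.filter fun c => P c = none ∧ o.out (c, 0) ≠ o.out (c, 3)).card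

variable {D} in
/-- The number `y(D')` of positive crossings: turning the direction of the over-strand
counterclockwise by less than a half turn gives the direction of the under-strand, so that, say,
both `0` and `3` are the incoming ends. -/
def Orientation.numPos {P : PartialSmoothing n} (o : D.Orientation P) : ℕ :=
  (Finset.univ.filter fun c => P c = none ∧ o.out (c, 0) = o.out (c, 3)).card

variable {D} in
/-- `w(D') = x(D') - y(D')`, the negative of the usual writhe. -/
def Orientation.w {P : PartialSmoothing n} (o : D.Orientation P) : ℤ :=
  (o.numNeg : ℤ) - o.numPos

end PDCode

theorem PartialSmoothing.through_through {n : ℕ} (P : PartialSmoothing n) (x : StrandEnd n) :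
    P.through (P.through x) = x := by
  obtain ⟨c, i⟩ := x
  rcases h : P c with _ | _ | _ <;> fin_cases i <;> simp [PartialSmoothing.through, h]

theorem PartialSmoothing.through_ne {n : ℕ} (P : PartialSmoothing n) (x : StrandEnd n) :
    P.through x ≠ x := by
  obtain ⟨c, i⟩ := x
  rcases h : P c with _ | _ | _ <;> fin_cases i <;> simp [PartialSmoothing.through, h]

/-- Every smoothened diagram has an orientation. -/
theorem PDCode.nonempty_orientation {n : ℕ} (D : PDCode n) (P : PartialSmoothing n) :
    Nonempty (D.Orientation P) := by
  classical
  let s : Equiv.Perm (StrandEnd n) := ⟨P.through, P.through, P.through_through, P.through_through⟩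
  let g := D.glue
  have hs : ∀ x, s (s x) = x := P.through_through
  have hg : ∀ x, g (g x) = x := D.glue_glue
  let f : Equiv.Perm (StrandEnd n) := s * g
  have hfi : ∀ x, f⁻¹ x = g (s x) := fun x => by
    rw [Equiv.Perm.inv_eq_iff_eq]; simp [f, hs, hg]
  have key : ∀ k : ℕ, ∀ x, (f ^ k) x ≠ g x ∧ (f ^ k) (s x) ≠ x := by
    intro k
    induction k with
    | zero => exact fun x => ⟨fun h => D.glue_ne x h.symm, fun h => P.through_ne x h⟩
    | succ k ih =>
      intro x
      constructor
      · intro h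
        have h2 : (f ^ k) (s (g x)) = g x := by
          rw [pow_succ, Equiv.Perm.mul_apply] at h
          exact h
        exact (ih (g x)).2 h2
      · intro h
        rw [pow_succ', Equiv.Perm.mul_apply] at h
        have h2 : (f ^ k) (s x) = g (s x) := by
          rw [← hfi, Equiv.Perm.eq_inv_iff_eq]
          exact h
        exact (ih (s x)).1 h2
  let st := Equiv.Perm.SameCycle.setoid f
  have hne : ∀ x, (Quotient.mk st x) ≠ Quotient.mk st (g x) := by
    intro x h
    have h' : f.SameCycle x (g x) := Quotient.exact h
    obtain ⟨k, hk⟩ := h'.exists_nat_pow_eq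
    exact (key k x).1 hk
  have hsg : ∀ x, Quotient.mk st (s x) = Quotient.mk st (g x) := by
    intro x
    refine Quotient.sound (Equiv.Perm.SameCycle.symm ?_)
    exact ⟨1, by simp [f, hg]⟩
  have hgs : ∀ x, Quotient.mk st (g (s x)) = Quotient.mk st x := by
    intro x
    exact Quotient.sound ⟨1, by simp [f, hg, hs]⟩
  let e := Finite.equivFin (Quotient st)
  have hne' : ∀ x, e (Quotient.mk st x) ≠ e (Quotient.mk st (g x)) :=
    fun x h => hne x (e.injective h)
  refine ⟨⟨fun x => decide (e (Quotient.mk st x) < e (Quotient.mk st (g x))), ?_, ?_⟩⟩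
  · intro x
    change decide (e (Quotient.mk st (g x)) < e (Quotient.mk st (g (g x)))) = _
    rw [hg, ← decide_not, decide_eq_decide, not_lt]
    exact ⟨le_of_lt, fun h => lt_of_le_of_ne h (hne' x).symm⟩
  · intro x
    change decide (e (Quotient.mk st (s x)) < e (Quotient.mk st (g (s x)))) = _
    rw [hgs, hsg, ← decide_not, decide_eq_decide, not_lt]
    exact ⟨le_of_lt, fun h => lt_of_le_of_ne h (hne' x).symm⟩

/-! ### The Khovanov complex -/

/-- Structure constants of the multiplication `v₊ v₊ = v₊`, `v₊ v₋ = v₋ v₊ = v₋`, `v₋ v₋ = 0`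
in the basis `v₊` (`true`), `v₋` (`false`) of `𝒜`. -/
def mulCoeff : Bool → Bool → Bool → ℤ
  | true, true, true => 1
  | true, false, false => 1
  | false, true, false => 1
  | _, _, _ => 0

/-- Structure constants of the comultiplication `v₊ ↦ v₊ ⊗ v₋ + v₋ ⊗ v₊`, `v₋ ↦ v₋ ⊗ v₋`. -/
def comulCoeff : Bool → Bool → Bool → ℤ
  | true, true, false => 1
  | true, false, true => 1
  | false, false, false => 1
  | _, _, _ => 0

namespace PDCode

variable {n : ℕ} (D : PDCode n)

/-- A Kauffman state `S` with a label `v₊` (`true`) or `v₋` (`false`) on each circle, that is, an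
element of the standard basis of the tensor power `𝒜 ^ ⊗ k` on the `k` circles of `S`. -/
abbrev EnhancedState : Type := (S : KauffmanState n) × (D.Circle S → Bool)

/-- The primary degree: the number `r(D, S)` of `1`-smoothings. -/
def primaryDegree (E : D.EnhancedState) : ℤ := E.1.toPartial.numOne

/-- The secondary degree: `r(D, S)` plus the degrees `1` of the `v₊` and `-1` of the `v₋`. -/
noncomputable def secondaryDegree (E : D.EnhancedState) : ℤ :=
  E.1.toPartial.numOne + (Nat.card {z // E.2 z = true} : ℤ) - (Nat.card {z // E.2 z = false} : ℤ)

open Classical in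
/-- The matrix entry, from `E` to `E'`, of the map which the change of the crossing `c` from the
`0`-smoothing to the `1`-smoothing induces: multiplication if two circles merge, comultiplication
if a circle splits, and the identity on the circles which do not pass by `c`. -/
noncomputable def edgeCoeff (c : Fin n) (E E' : D.EnhancedState) : ℤ :=
  let a := D.circleOf E.1 (.inl (c, 0))
  let b := D.circleOf E.1 (.inl (c, 2))
  let a' := D.circleOf E'.1 (.inl (c, 0))
  let b' := D.circleOf E'.1 (.inl (c, 2))
  if ∀ z, D.circleOf E.1 z ≠ a → D.circleOf E.1 z ≠ b →
      E'.2 (D.circleOf E'.1 z) = E.2 (D.circleOf E.1 z) then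
    if a ≠ b then mulCoeff (E.2 a) (E.2 b) (E'.2 a')
    else if a' ≠ b' then comulCoeff (E.2 a) (E'.2 a') (E'.2 b')
    else 0
  else 0

/-- The matrix entry of the differential from `E` to `E'`, with the sign `-1` for each
`1`-smoothing at a crossing before the changed one. -/
noncomputable def incidence (E E' : D.EnhancedState) : ℤ :=
  ∑ c : Fin n, if E.1 c = false ∧ E'.1 = Function.update E.1 c true then
    (-1) ^ (Finset.univ.filter fun c' => c' < c ∧ E.1 c' = true).card * D.edgeCoeff c E E'
  else 0

/-- The basis of the homogeneous component of bidegree `(i, j)`. -/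
abbrev BasisAt (i j : ℤ) : Type :=
  {E : D.EnhancedState // D.primaryDegree E = i ∧ D.secondaryDegree E = j}

noncomputable instance (i j : ℤ) : Fintype (D.BasisAt i j) := Fintype.ofFinite _

/-- The homogeneous component of bidegree `(i, j)` of the Khovanov complex. -/
noncomputable abbrev khovanovModule (i j : ℤ) : ModuleCat.{0} ℤ :=
  ModuleCat.of ℤ (D.BasisAt i j →₀ ℤ)

/-- The differential of the Khovanov complex, of bidegree `(1, 0)`. -/
noncomputable def khovanovD (i j : ℤ) : D.khovanovModule i j ⟶ D.khovanovModule (i + 1) j :=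
  ModuleCat.ofHom (Finsupp.linearCombination ℤ fun E : D.BasisAt i j =>
    ∑ E' : D.BasisAt (i + 1) j, Finsupp.single E' (D.incidence E.1 E'.1))

end PDCode

/-! ### Bigraded modules and complexes -/

/-- Bigraded abelian groups; `M (i, j)` is the component of bidegree `(i, j)`, and morphisms
preserve the bidegree. -/
abbrev BigradedModule : Type 1 := GradedObject (ℤ × ℤ) (ModuleCat.{0} ℤ)

/-- Bigraded complexes with a differential of bidegree `(1, 0)`: a cochain complex for each
secondary degree. Morphisms commute with the differentials and preserve the bidegree. -/
abbrev BigradedComplex : Type 1 := GradedObject ℤ (CochainComplex (ModuleCat.{0} ℤ) ℤ)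

/-- The shift `M[m]{k}`, with `(M[m]{k})^{i,j} = M^{i-m,j-k}`. -/
def BigradedModule.shift (M : BigradedModule) (m k : ℤ) : BigradedModule :=
  fun p => M (p.1 - m, p.2 - k)

/-- The direct sum of bigraded modules. -/
noncomputable def BigradedModule.directSum {ι : Type} (M : ι → BigradedModule) : BigradedModule :=
  fun p => ModuleCat.of ℤ (⨁ s : ι, M s p)

open Classical in
/-- The bigraded module `𝒜`, equal to `ℤ` in the bidegrees `(0, 1)` and `(0, -1)` and to `0`
in all others. -/
noncomputable def khovanovA : BigradedModule := fun p =>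
  if p = (0, 1) ∨ p = (0, -1) then ModuleCat.of ℤ ℤ else ModuleCat.of ℤ PUnit

/-- The bigraded module underlying a bigraded complex. -/
def BigradedComplex.toModule (C : BigradedComplex) : BigradedModule := fun p => (C p.2).X p.1

/-- The direct sum of two bigraded complexes. -/
noncomputable def BigradedComplex.sum (A B : BigradedComplex) : BigradedComplex :=
  fun j => A j ⊞ B j

/-- There is an endomorphism `p` of bidegree `(-1, 0)` with `p d + d p = id`. -/
def BigradedComplex.Contractible (B : BigradedComplex) : Prop :=
  ∀ j, Nonempty (Homotopy (𝟙 (B j)) 0)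

/-- The Khovanov complex, given that its differential squares to zero. -/
noncomputable def PDCode.khovanovComplex {n : ℕ} (D : PDCode n)
    (h : ∀ i j, D.khovanovD i j ≫ D.khovanovD (i + 1) j = 0) : BigradedComplex :=
  fun j => CochainComplex.of (fun i => D.khovanovModule i j) (fun i => D.khovanovD i j)
    (fun i => h i j)

/-!
The spanning tree model is obtained by algebraic discrete Morse theory on the standard basis of the
Khovanov complex, the Kauffman states with labels `v₊`, `v₋` on their circles.

In a leaf `P` of the binary tree every crossing that is not smoothened is nugatory: exactly one of
its two smoothings, the disconnecting one, cuts `P` into two parts. After the choice of a base point,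
the circles of a state of `P` form a rooted tree, whose root is the circle through the base point
and whose edges are the crossings with the disconnecting smoothing; each such crossing lies above
exactly one circle (`IsLeaf.not_linked_lowerEnd`, `IsLeaf.exists_linked`). A state is thus given by
its smoothings, the label of the root, and one label for each crossing with the disconnecting
smoothing. At a crossing whose disconnecting smoothing is the `0`-smoothing, a circle below it with
the label `v₊`, the unit, can be merged into the circle above; if it is the `1`-smoothing, a circle
below it with the label `v₋` can be split off. Both happen with the coefficient `±1`
(`IsLeaf.edgeCoeff_eq_one`), and changing the first crossing that allows this matches the states in
pairs. Every other component of the differential leads to a later leaf (`leafKey_lt`), or moves a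
label `v₋` towards the root (`IsLeaf.labels_eq_or_height_lt`). Hence the differential from the
matched sources to the matched targets is triangular with units on the diagonal
(`IsPartner.eq_or_matchingKey_lt`), and Gaussian elimination splits off a contractible complex
(`exists_iso_biprod_of_matching`).

The unmatched states of a leaf have the disconnecting smoothing at every crossing that is not
smoothened in the leaf, with the label `v₋` below if it is the `0`-smoothing and `v₊` if it is the
`1`-smoothing; only the label of the root is arbitrary. Changing all these smoothings gives the
one-circle states of the leaf (`exists_isCritical`, `IsCritical.ext`). The disconnecting smoothing of
a nugatory crossing is the `1`-smoothing if and only if the crossing is negative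
(`IsLeaf.labelDegree_badSmoothing`), and therefore the change of degree is governed by `w`
(`IsCritical.primaryDegree_eq`, `IsCritical.secondaryDegree_eq`).

That the differential squares to zero depends on planarity: the checkerboard colouring of the faces,
which exists by Euler's formula (`LinkDiagram.exists_isAlternating`), excludes that a change of
smoothing turns one circle into one circle (`IsAlternating.not_linked_flip`).
-/

/-! ### Components of smoothened diagrams -/

namespace PDCode

variable {n : ℕ} (D : PDCode n)

/-- The points by which the components of a smoothened diagram are named: strand ends and
crossingless circles. -/
abbrev Point : Type := StrandEnd n ⊕ Fin D.loops

/-- The component of the smoothened diagram `P` through a given point; for a Kauffman state this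
is `PDCode.circleOf`. -/
def comp (P : PartialSmoothing n) : D.Point → D.Component P := Sum.map (Quot.mk _) id

/-- Two points lie on the same component of the smoothened diagram `P`. -/
def Linked (P : PartialSmoothing n) (z w : D.Point) : Prop := D.comp P z = D.comp P w

theorem comp_toPartial (S : KauffmanState n) (z : D.Point) :
    D.comp S.toPartial z = D.circleOf S z := by
  cases z <;> rfl

theorem comp_surjective (P : PartialSmoothing n) : Function.Surjective (D.comp P) := by
  rintro (⟨⟨x⟩⟩ | l)
  · exact ⟨.inl x, rfl⟩
  · exact ⟨.inr l, rfl⟩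

variable {D}

theorem Linked.refl (P : PartialSmoothing n) (z : D.Point) : D.Linked P z z := rfl

theorem Linked.symm {P : PartialSmoothing n} {z w : D.Point} (h : D.Linked P z w) :
    D.Linked P w z := Eq.symm h

theorem Linked.trans {P : PartialSmoothing n} {z w t : D.Point} (h : D.Linked P z w)
    (h' : D.Linked P w t) : D.Linked P z t := Eq.trans h h'

theorem linked_comm {P : PartialSmoothing n} {z w : D.Point} :
    D.Linked P z w ↔ D.Linked P w z := ⟨.symm, .symm⟩

theorem linked_of_joined {P : PartialSmoothing n} {x y : StrandEnd n} (h : D.Joined P x y) :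
    D.Linked P (.inl x) (.inl y) := congrArg Sum.inl (Quot.sound h)

theorem linked_glue (P : PartialSmoothing n) (x : StrandEnd n) :
    D.Linked P (.inl x) (.inl (D.glue x)) := linked_of_joined (.inl rfl)

theorem linked_through (P : PartialSmoothing n) (x : StrandEnd n) :
    D.Linked P (.inl x) (.inl (P.through x)) := linked_of_joined (.inr (.inl rfl))

theorem linked_crossing {P : PartialSmoothing n} {x y : StrandEnd n} (h : P x.1 = none)
    (hy : y.1 = x.1) : D.Linked P (.inl x) (.inl y) :=
  linked_of_joined (.inr (.inr ⟨h, hy⟩))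

/-- Induction along a component: a property that is inherited along edges, along arcs and across
unsmoothened crossings is inherited along the component. -/
theorem Linked.of_closed {P : PartialSmoothing n} {p : D.Point → Prop}
    (hg : ∀ x, p (.inl x) → p (.inl (D.glue x)))
    (ht : ∀ x, p (.inl x) → p (.inl (P.through x)))
    (hn : ∀ x y : StrandEnd n, P x.1 = none → y.1 = x.1 → p (.inl x) → p (.inl y))
    {z w : D.Point} (h : D.Linked P z w) (hz : p z) : p w := by
  have key : ∀ x y, D.Joined P x y → p (.inl x) = p (.inl y) := by
    rintro x y (rfl | rfl | ⟨hx, hy⟩)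
    · exact propext ⟨hg x, fun h => by simpa [D.glue_glue] using hg _ h⟩
    · exact propext ⟨ht x, fun h => by simpa [P.through_through] using ht _ h⟩
    · exact propext ⟨hn x y hx hy, hn y x (hy ▸ hx) hy.symm⟩
  rcases z with x | l <;> rcases w with y | m
  · have h' : Quot.mk (D.Joined P) x = Quot.mk _ y := Sum.inl.inj h
    have := congrArg (Quot.lift (fun x => p (.inl x)) key) h'
    exact this.mp hz
  · exact absurd h (by simp [Linked, comp])
  · exact absurd h (by simp [Linked, comp])
  · have : l = m := Sum.inr.inj h
    exact this ▸ hz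

theorem through_fst (P : PartialSmoothing n) (x : StrandEnd n) : (P.through x).1 = x.1 := by
  unfold PartialSmoothing.through
  split <;> rfl

theorem through_congr {P P' : PartialSmoothing n} {x : StrandEnd n} (h : P x.1 = P' x.1) :
    P.through x = P'.through x := by
  unfold PartialSmoothing.through
  rw [h]

/-- Smoothening further crossings can only break components. -/
theorem Linked.of_refines {P P' : PartialSmoothing n} (hP : ∀ c, P c = none ∨ P' c = P c)
    {z w : D.Point} (h : D.Linked P' z w) : D.Linked P z w := by
  refine h.of_closed (p := D.Linked P z) (fun x hx => hx.trans (linked_glue P x)) ?_ ?_ rfl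
  · intro x hx
    rcases hP x.1 with h0 | h0
    · exact hx.trans (linked_crossing h0 (through_fst _ _))
    · rw [through_congr h0]
      exact hx.trans (linked_through P x)
  · intro x y hx hy h
    rcases hP x.1 with h0 | h0
    · exact h.trans (linked_crossing h0 hy)
    · exact h.trans (linked_crossing (h0 ▸ hx) hy)

theorem connectedAt_iff {P : PartialSmoothing n} :
    D.ConnectedAt P ↔ (∀ z w, D.Linked P z w) ∧ Nonempty D.Point := by
  unfold ConnectedAt
  rw [Nat.card_eq_one_iff_unique]
  constructor
  · rintro ⟨h1, ⟨h2⟩⟩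
    exact ⟨fun z w => Subsingleton.elim _ _, ⟨(D.comp_surjective P h2).choose⟩⟩
  · rintro ⟨h1, ⟨z⟩⟩
    refine ⟨⟨fun a b => ?_⟩, ⟨D.comp P z⟩⟩
    obtain ⟨z, rfl⟩ := D.comp_surjective P a
    obtain ⟨w, rfl⟩ := D.comp_surjective P b
    exact h1 z w

/-- Flow conservation: if a sign changes along edges and along the arcs away from the crossing
`c`, then a union of edges and arcs has as many positive as negative ends at `c`. -/
theorem sum_ends_eq_zero (P : PartialSmoothing n) (c : Fin n) (g : StrandEnd n → ℤ)
    (hg : ∀ x, g (D.glue x) = -g x) (ht : ∀ x, x.1 ≠ c → g (P.through x) = -g x)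
    (X : StrandEnd n → Prop) [DecidablePred X] (hXg : ∀ x, X x → X (D.glue x))
    (hXt : ∀ x, X x → x.1 ≠ c → X (P.through x)) :
    ∑ i : Fin 4, (if X (c, i) then g (c, i) else 0) = 0 := by
  have h1 : ∑ x ∈ Finset.univ.filter X, g x = 0 := by
    refine Finset.sum_involution (fun x _ => D.glue x) (fun x _ => by rw [hg]; ring)
      (fun x _ _ => D.glue_ne x) (fun x hx => ?_) (fun x _ => D.glue_glue x)
    simp only [Finset.mem_filter, Finset.mem_univ, true_and] at hx ⊢
    exact hXg x hx
  have h2 : ∑ x ∈ Finset.univ.filter (fun x => X x ∧ x.1 ≠ c), g x = 0 := by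
    refine Finset.sum_involution (fun x _ => P.through x) (fun x hx => ?_)
      (fun x _ _ => P.through_ne x) (fun x hx => ?_) (fun x _ => P.through_through x)
    · simp only [Finset.mem_filter, Finset.mem_univ, true_and] at hx
      rw [ht x hx.2]; ring
    · simp only [Finset.mem_filter, Finset.mem_univ, true_and] at hx ⊢
      exact ⟨hXt x hx.1 hx.2, by rw [through_fst]; exact hx.2⟩
  rw [Finset.sum_filter] at h1 h2
  have h3 : ∀ x : StrandEnd n, (if X x then g x else 0)
      = (if x.1 = c then (if X x then g x else 0) else 0) + if X x ∧ x.1 ≠ c then g x else 0 := by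
    intro x
    by_cases hx : X x <;> by_cases hc : x.1 = c <;> simp [hx, hc]
  rw [Finset.sum_congr rfl (fun x _ => h3 x), Finset.sum_add_distrib, h2, add_zero,
    Fintype.sum_prod_type] at h1
  refine Eq.trans (Eq.symm ?_) h1
  rw [Finset.sum_eq_single_of_mem c (Finset.mem_univ c)]
  · simp
  · intro b _ hb
    simp [hb]

/-! ### Changing the smoothing of one crossing -/

theorem through_update_of_ne {P : PartialSmoothing n} {c : Fin n} {o : Option Bool}
    {x : StrandEnd n} (h : x.1 ≠ c) : PartialSmoothing.through (Function.update P c o) x =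
        P.through x :=
  through_congr (Function.update_of_ne h _ _)

theorem linked_update_arc (P : PartialSmoothing n) (c : Fin n) (b : Bool) :
    D.Linked (Function.update P c (some b)) (.inl (c, 0)) (.inl (c, if b then 3 else 1)) ∧
    D.Linked (Function.update P c (some b)) (.inl (c, 2)) (.inl (c, if b then 1 else 3)) := by
  have h0 := linked_through (D := D) (Function.update P c (some b)) (c, 0)
  have h2 := linked_through (D := D) (Function.update P c (some b)) (c, 2)
  cases b <;> simp [PartialSmoothing.through] at h0 h2 ⊢ <;> exact ⟨h0, h2⟩

/-- If the two arcs of one smoothing of a crossing lie on different components, then the other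
smoothing joins them. -/
theorem linked_flip {P : PartialSmoothing n} {c : Fin n} {b : Bool}
    (h : ¬ D.Linked (Function.update P c (some b)) (.inl (c, 0)) (.inl (c, 2))) :
    D.Linked (Function.update P c (some !b)) (.inl (c, 0)) (.inl (c, 2)) := by
  classical
  by_contra h'
  obtain ⟨o⟩ := D.nonempty_orientation (Function.update P c (some b))
  -- The intersection of the components through `(c, 0)` for the two smoothings has no further
  -- end at `c`.
  have key := sum_ends_eq_zero (D := D) (Function.update P c (some b)) c
    (fun x => if o.out x then 1 else -1)
    (fun x => by simp only [o.out_glue]; cases o.out x <;> simp)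
    (fun x _ => by simp only [o.out_through]; cases o.out x <;> simp)
    (fun x => D.Linked (Function.update P c (some b)) (.inl (c, 0)) (.inl x) ∧
      D.Linked (Function.update P c (some !b)) (.inl (c, 0)) (.inl x))
    (fun x hx => ⟨hx.1.trans (linked_glue _ _), hx.2.trans (linked_glue _ _)⟩)
    (fun x hx hc => ⟨hx.1.trans (linked_through _ _), by
      rw [through_update_of_ne hc, ← through_update_of_ne (o := some !b) hc]
      exact hx.2.trans (linked_through _ _)⟩)
  have a1 := (linked_update_arc (D := D) P c b).2
  have a2 := (linked_update_arc (D := D) P c !b).2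
  have n1 : ¬ D.Linked (Function.update P c (some b)) (.inl (c, 0))
      (.inl (c, if b then 1 else 3)) := fun h0 => h (h0.trans a1.symm)
  have n2 : ¬ D.Linked (Function.update P c (some !b)) (.inl (c, 0))
      (.inl (c, if !b then 1 else 3)) := fun h0 => h' (h0.trans a2.symm)
  have hX : ∀ i : Fin 4, i ≠ 0 →
      ¬ (D.Linked (Function.update P c (some b)) (.inl (c, 0)) (.inl (c, i)) ∧
        D.Linked (Function.update P c (some !b)) (.inl (c, 0)) (.inl (c, i))) := by
    rintro i hi ⟨h1, h2⟩
    cases b <;> fin_cases i <;> first | exact hi rfl | exact h h1 | exact n1 h1 | exact n2 h2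
  rw [Finset.sum_eq_single_of_mem 0 (Finset.mem_univ _) (fun i _ hi => if_neg (hX i hi)),
    if_pos ⟨rfl, rfl⟩] at key
  split_ifs at key
  omega

theorem linked_update_all {P : PartialSmoothing n} {c : Fin n} {b : Bool}
    (h : D.Linked (Function.update P c (some b)) (.inl (c, 0)) (.inl (c, 2))) (i : Fin 4) :
    D.Linked (Function.update P c (some b)) (.inl (c, 0)) (.inl (c, i)) := by
  obtain ⟨a1, a2⟩ := linked_update_arc (D := D) P c b
  have a3 := h.trans a2
  cases b <;> fin_cases i <;> first | rfl | assumption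

theorem linked_update_end (P : PartialSmoothing n) (c : Fin n) (b : Bool) (i : Fin 4) :
    D.Linked (Function.update P c (some b)) (.inl (c, 0)) (.inl (c, i)) ∨
    D.Linked (Function.update P c (some b)) (.inl (c, 2)) (.inl (c, i)) := by
  obtain ⟨a1, a2⟩ := linked_update_arc (D := D) P c b
  cases b <;> fin_cases i <;>
    first | exact .inl rfl | exact .inr rfl | exact .inl a1 | exact .inr a2

/-- If the two arcs of one smoothing lie on different components, then the components for the other
smoothing are obtained by merging these two. -/
theorem linked_flip_iff {P : PartialSmoothing n} {c : Fin n} {b : Bool}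
    (h : ¬ D.Linked (Function.update P c (some b)) (.inl (c, 0)) (.inl (c, 2))) (z w : D.Point) :
    D.Linked (Function.update P c (some !b)) z w ↔
      D.Linked (Function.update P c (some b)) z w ∨
      (D.Linked (Function.update P c (some b)) z (.inl (c, 0)) ∧
        D.Linked (Function.update P c (some b)) w (.inl (c, 2))) ∨
      (D.Linked (Function.update P c (some b)) z (.inl (c, 2)) ∧
        D.Linked (Function.update P c (some b)) w (.inl (c, 0))) := by
  have h' := linked_flip h
  have hne : ∀ x : StrandEnd n, ∀ b, Function.update P c (some b) x.1 = none → x.1 ≠ c := by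
    rintro x b hx rfl
    simp at hx
  have mono : ∀ z w, D.Linked (Function.update P c (some b)) z w →
      D.Linked (Function.update P c (some !b)) z w := by
    intro z w hzw
    refine hzw.of_closed (p := D.Linked (Function.update P c (some !b)) z)
      (fun x hx => hx.trans (linked_glue _ x)) (fun x hx => ?_) (fun x y h0 hy hx => ?_) rfl
    · by_cases hc : x.1 = c
      · obtain ⟨c', i⟩ := x
        subst hc
        rw [show PartialSmoothing.through (Function.update P c' (some b)) (c', i)
          = (c', (PartialSmoothing.through (Function.update P c' (some b)) (c', i)).2) from
          Prod.ext (through_fst _ _) rfl]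
        exact hx.trans ((linked_update_all h' i).symm.trans (linked_update_all h' _))
      · rw [through_update_of_ne hc, ← through_update_of_ne (o := some !b) hc]
        exact hx.trans (linked_through _ _)
    · have hc := hne _ _ h0
      rw [Function.update_of_ne hc] at h0
      exact hx.trans (linked_crossing (by rw [Function.update_of_ne hc, h0]) hy)
  constructor
  · intro hzw
    refine hzw.of_closed (p := fun w =>
      D.Linked (Function.update P c (some b)) z w ∨
      (D.Linked (Function.update P c (some b)) z (.inl (c, 0)) ∧
        D.Linked (Function.update P c (some b)) w (.inl (c, 2))) ∨
      (D.Linked (Function.update P c (some b)) z (.inl (c, 2)) ∧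
        D.Linked (Function.update P c (some b)) w (.inl (c, 0)))) ?_ ?_ ?_ (.inl rfl)
    · intro x hx
      have := linked_glue (D := D) (Function.update P c (some b)) x
      rcases hx with hx | hx | hx
      · exact .inl (hx.trans this)
      · exact .inr (.inl ⟨hx.1, this.symm.trans hx.2⟩)
      · exact .inr (.inr ⟨hx.1, this.symm.trans hx.2⟩)
    · intro x hx
      by_cases hc : x.1 = c
      · obtain ⟨c', i⟩ := x
        subst hc
        rw [show PartialSmoothing.through (Function.update P c' (some !b)) (c', i)
          = (c', (PartialSmoothing.through (Function.update P c' (some !b)) (c', i)).2) from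
          Prod.ext (through_fst _ _) rfl]
        generalize (PartialSmoothing.through (Function.update P c' (some !b)) (c', i)).2 = j
        have hi : D.Linked (Function.update P c' (some b)) z (.inl (c', 0)) ∨
            D.Linked (Function.update P c' (some b)) z (.inl (c', 2)) := by
          rcases hx with hx | hx | hx
          · rcases linked_update_end (D := D) P c' b i with hi | hi
            · exact .inl (hx.trans hi.symm)
            · exact .inr (hx.trans hi.symm)
          · exact .inl hx.1
          · exact .inr hx.1
        rcases hi with hi | hi <;> rcases linked_update_end (D := D) P c' b j with hj | hj
        · exact .inl (hi.trans hj)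
        · exact .inr (.inl ⟨hi, hj.symm⟩)
        · exact .inr (.inr ⟨hi, hj.symm⟩)
        · exact .inl (hi.trans hj)
      · have := linked_through (D := D) (Function.update P c (some b)) x
        rw [through_update_of_ne hc] at this ⊢
        rcases hx with hx | hx | hx
        · exact .inl (hx.trans this)
        · exact .inr (.inl ⟨hx.1, this.symm.trans hx.2⟩)
        · exact .inr (.inr ⟨hx.1, this.symm.trans hx.2⟩)
    · intro x y h0 hy hx
      have hc := hne _ _ h0
      rw [Function.update_of_ne hc] at h0
      have := linked_crossing (D := D) (P := Function.update P c (some b)) (x := x) (y := y)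
        (by rw [Function.update_of_ne hc, h0]) hy
      rcases hx with hx | hx | hx
      · exact .inl (hx.trans this)
      · exact .inr (.inl ⟨hx.1, this.symm.trans hx.2⟩)
      · exact .inr (.inr ⟨hx.1, this.symm.trans hx.2⟩)
  · rintro (h0 | h0 | h0)
    · exact mono _ _ h0
    · exact (mono _ _ h0.1).trans (h'.trans (mono _ _ h0.2).symm)
    · exact (mono _ _ h0.1).trans (h'.symm.trans (mono _ _ h0.2).symm)

/-- After smoothening a crossing of a connected diagram, every component passes by that
crossing. -/
theorem linked_or_linked_of_connected {P : PartialSmoothing n} {c : Fin n}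
    (hP : ∀ z w, D.Linked P z w) (b : Bool) (z : D.Point) :
    D.Linked (Function.update P c (some b)) (.inl (c, 0)) z ∨
      D.Linked (Function.update P c (some b)) (.inl (c, 2)) z := by
  refine (hP (.inl (c, 0)) z).of_closed (p := fun z =>
      D.Linked (Function.update P c (some b)) (.inl (c, 0)) z ∨
      D.Linked (Function.update P c (some b)) (.inl (c, 2)) z) ?_ ?_ ?_ (.inl rfl)
  · exact fun x hx => hx.imp (·.trans (linked_glue _ _)) (·.trans (linked_glue _ _))
  · intro x hx
    by_cases hc : x.1 = c
    · subst hc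
      rw [show P.through x = (x.1, (P.through x).2) from Prod.ext (through_fst _ _) rfl]
      exact linked_update_end P x.1 b _
    · have := linked_through (D := D) (Function.update P c (some b)) x
      rw [through_update_of_ne hc] at this
      exact hx.imp (·.trans this) (·.trans this)
  · intro x y h0 hy hx
    by_cases hc : x.1 = c
    · obtain ⟨d, j⟩ := y
      obtain rfl : d = c := hy.trans hc
      exact linked_update_end P d b _
    · have := linked_crossing (D := D) (P := Function.update P c (some b)) (x := x) (y := y)
        (by rw [Function.update_of_ne hc, h0]) hy
      exact hx.imp (·.trans this) (·.trans this)

/-- A source-sink structure: a sign on the strand ends which alternates along edges and around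
crossings. -/
def IsAlternating (D : PDCode n) (s : StrandEnd n → Bool) : Prop :=
  (∀ x, s (D.glue x) = !s x) ∧ ∀ c i, s (c, i + 1) = !s (c, i)

theorem IsAlternating.through {s : StrandEnd n → Bool} (hs : D.IsAlternating s)
    (S : KauffmanState n) (x : StrandEnd n) : s (S.toPartial.through x) = !s x := by
  obtain ⟨c, i⟩ := x
  have h1 : s (c, 1) = !s (c, 0) := hs.2 c 0
  have h2 : s (c, 2) = !s (c, 1) := hs.2 c 1
  have h3 : s (c, 3) = !s (c, 2) := hs.2 c 2
  cases h : S c <;> fin_cases i <;>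
    simp [PartialSmoothing.through, KauffmanState.toPartial, h, h1, h2, h3]

/-- With a source-sink structure, the change of a crossing at which a circle meets itself splits
that circle: the part of the circle between the two passages closes up. -/
theorem IsAlternating.not_linked_flip {s : StrandEnd n → Bool} (hs : D.IsAlternating s)
    {S S' : KauffmanState n} {c : Fin n} (hc : S' c = !S c) (hS : ∀ c', c' ≠ c → S' c' = S c')
    (h : D.Linked S.toPartial (.inl (c, 0)) (.inl (c, 2))) :
    ¬ D.Linked S'.toPartial (.inl (c, 0)) (.inl (c, 2)) := by
  classical
  set u : StrandEnd n := (c, 0)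
  set v : StrandEnd n := (c, 2)
  set t := S.toPartial.through
  set t' := S'.toPartial.through
  have hsuv : s v = s u := by
    have h1 : s (c, 1) = !s (c, 0) := hs.2 c 0
    have h2 : s (c, 2) = !s (c, 1) := hs.2 c 1
    simp [u, v, h1, h2]
  have htt : ∀ x, t (t x) = x := S.toPartial.through_through
  have htt' : ∀ x, t' (t' x) = x := S'.toPartial.through_through
  have hst : ∀ x, s (t x) = !s x := hs.through S
  have hne : ∀ x : StrandEnd n, x.1 ≠ c → t' x = t x := fun x hx =>
    through_congr (congrArg some (hS x.1 hx))
  have hu : t' u = t v := by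
    cases h0 : S c <;>
      simp [t, t', u, v, PartialSmoothing.through, KauffmanState.toPartial, h0, hc]
  have hv : t' v = t u := by
    cases h0 : S c <;>
      simp [t, t', u, v, PartialSmoothing.through, KauffmanState.toPartial, h0, hc]
  -- The ends at `c` with the sign of `u` are `u` and `v`.
  have hat : ∀ x : StrandEnd n, x.1 = c → s x = s u → x = u ∨ x = v := by
    rintro ⟨d, i⟩ rfl hx
    have h1 : s (d, 1) = !s (d, 0) := hs.2 d 0
    have h2 : s (d, 2) = !s (d, 1) := hs.2 d 1
    have h3 : s (d, 3) = !s (d, 2) := hs.2 d 2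
    fin_cases i <;> simp [u, v, h1, h2, h3] at hx ⊢
  -- One step along a circle: across an edge, and then along the arc in the next crossing. It keeps
  -- the sign, so that a circle is never traversed in both directions.
  let f : StrandEnd n → StrandEnd n := fun x => t (D.glue x)
  have hfs : ∀ k x, s (f^[k] x) = s x := by
    intro k x
    induction k with
    | zero => rfl
    | succ k ih => rw [Function.iterate_succ_apply']; simp only [f]; rw [hst, hs.1, ih]; simp
  have hinj : Function.Injective f := fun x y hxy => by
    apply D.glue.injective
    rw [← htt (D.glue x), ← htt (D.glue y)]
    exact congrArg t hxy
  obtain ⟨m, hm, hper⟩ := hinj.mem_periodicPts u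
  -- The circle through `u` consists of the `f^[k] u` and their partners along edges.
  have hreach : ∃ k, f^[k] u = v := by
    have := h.of_closed (p := fun z => ∃ k, z = .inl (f^[k] u) ∨ z = .inl (D.glue (f^[k] u)))
      ?_ ?_ (by simp [KauffmanState.toPartial]) ⟨0, .inl rfl⟩
    · obtain ⟨k, hk | hk⟩ := this
      · exact ⟨k, (Sum.inl.inj hk).symm⟩
      · have := congrArg s (Sum.inl.inj hk)
        rw [hs.1, hfs, hsuv] at this
        simp at this
    · rintro x ⟨k, hk | hk⟩
      · exact ⟨k, .inr (by rw [Sum.inl.inj hk])⟩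
      · exact ⟨k, .inl (by rw [Sum.inl.inj hk, D.glue_glue])⟩
    · rintro x ⟨k, hk | hk⟩
      · have hk' := Sum.inl.inj hk
        have : ∃ l, f^[l + 1] u = x := by
          rcases k with _ | k
          · obtain ⟨m, rfl⟩ : ∃ m', m = m' + 1 := ⟨m - 1, by omega⟩
            exact ⟨m, by rw [hk']; exact hper⟩
          · exact ⟨k, hk'.symm⟩
        obtain ⟨l, hl⟩ := this
        refine ⟨l, .inr ?_⟩
        rw [← hl, Function.iterate_succ_apply']
        exact congrArg Sum.inl (htt _)
      · refine ⟨k + 1, .inl ?_⟩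
        rw [Function.iterate_succ_apply', Sum.inl.inj hk]
  let k := Nat.find hreach
  have hk : f^[k] u = v := Nat.find_spec hreach
  have hmin : ∀ i, i < k → f^[i] u ≠ v := fun i hi => Nat.find_min hreach hi
  have hminu : ∀ i, 0 < i → i < k → f^[i] u ≠ u := by
    intro i hi hik h0
    refine hmin (k - i) (by omega) ?_
    rw [← hk]
    conv_rhs => rw [show k = (k - i) + i by omega, Function.iterate_add_apply, h0]
  have huv : u ≠ v := by simp [u, v]
  have hk0 : 0 < k := by
    rcases Nat.eq_zero_or_pos k with h0 | h0
    · rw [h0] at hk; exact absurd hk huv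
    · exact h0
  have haway : ∀ i, 0 < i → i < k → (f^[i] u).1 ≠ c := by
    intro i hi hik h0
    rcases hat _ h0 (hfs i u) with h1 | h1
    · exact hminu i hi hik h1
    · exact hmin i hik h1
  intro h'
  -- After the change, the part of the circle from `u` to `v` is closed under edges and arcs. It
  -- contains `u`, and by the signs it does not contain `v`.
  have := h'.of_closed
    (p := fun z => ∃ i, i < k ∧ (z = .inl (f^[i] u) ∨ z = .inl (D.glue (f^[i] u))))
    ?_ ?_ (by simp [KauffmanState.toPartial]) ⟨0, hk0, .inl rfl⟩
  · obtain ⟨i, hi, h1 | h1⟩ := this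
    · exact hmin i hi (Sum.inl.inj h1).symm
    · have := congrArg s (Sum.inl.inj h1)
      rw [hs.1, hfs, hsuv] at this
      simp at this
  · rintro x ⟨i, hi, h1 | h1⟩
    · exact ⟨i, hi, .inr (by rw [Sum.inl.inj h1])⟩
    · exact ⟨i, hi, .inl (by rw [Sum.inl.inj h1, D.glue_glue])⟩
  · rintro x ⟨i, hi, h1 | h1⟩
    · have hx := Sum.inl.inj h1
      rcases i with _ | i
      · refine ⟨k - 1, by omega, .inr ?_⟩
        rw [hx]
        change Sum.inl (t' u) = _
        have : f (f^[k - 1] u) = v := by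
          rw [← Function.iterate_succ_apply' f, show (k - 1).succ = k by omega, hk]
        rw [hu, ← this]
        exact congrArg Sum.inl (htt _)
      · refine ⟨i, by omega, .inr ?_⟩
        change Sum.inl (t' x) = _
        rw [hx, hne _ (haway _ (by omega) hi), Function.iterate_succ_apply']
        exact congrArg Sum.inl (htt _)
    · have hx := Sum.inl.inj h1
      have h2 : t x = f^[i + 1] u := by rw [hx, Function.iterate_succ_apply']
      change ∃ j, j < k ∧ (Sum.inl (t' x) = _ ∨ Sum.inl (t' x) = _)
      have hx1 : x.1 = (t x).1 := (through_fst _ _).symm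
      by_cases hik : i + 1 < k
      · refine ⟨i + 1, hik, .inl ?_⟩
        rw [hne _ (by rw [hx1, h2]; exact haway _ (by omega) hik), h2]
      · refine ⟨0, hk0, .inl ?_⟩
        rw [show i + 1 = k by omega, hk] at h2
        have : x = t v := by rw [← h2, htt]
        rw [this, ← hu, htt']
        rfl

end PDCode

/-! ### Checkerboard colouring of planar diagrams -/

namespace PDCode

variable {n : ℕ} (D : PDCode n)

/-- The functions on edges, with values in `ℤ/2`. -/
def edgeChains : Submodule (ZMod 2) (StrandEnd n → ZMod 2) where
  carrier := {g | ∀ x, g (D.glue x) = g x}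
  add_mem' h h' x := by simp only [Pi.add_apply, h x, h' x]
  zero_mem' _ := rfl
  smul_mem' r g h x := by simp only [Pi.smul_apply, h x]

/-- The sum of a function on strand ends with its mirror image along the edges. -/
def symmetrize : (StrandEnd n → ZMod 2) →ₗ[ZMod 2] D.edgeChains :=
  LinearMap.codRestrict D.edgeChains
    (LinearMap.id + LinearMap.funLeft (ZMod 2) (ZMod 2) D.glue) fun g x => by
      simp [LinearMap.funLeft_apply, D.glue_glue, add_comm]

/-- The boundary map from edges to crossings. -/
def edgeBoundary : D.edgeChains →ₗ[ZMod 2] (Fin n → ZMod 2) where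
  toFun g c := ∑ i : Fin 4, g.1 (c, i)
  map_add' g h := by ext c; simp [Finset.sum_add_distrib]
  map_smul' r g := by ext c; simp [Finset.mul_sum]

/-- The boundary map from faces to edges: the two sides of an edge are the faces which follow its
two ends. -/
def faceBoundary : (D.Face → ZMod 2) →ₗ[ZMod 2] D.edgeChains :=
  D.symmetrize ∘ₗ LinearMap.funLeft (ZMod 2) (ZMod 2) (Quotient.mk _)

theorem symmetrize_apply (g : StrandEnd n → ZMod 2) (x : StrandEnd n) :
    (D.symmetrize g).1 x = g x + g (D.glue x) := rfl

theorem face_next (y : StrandEnd n) :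
    (Quotient.mk _ (nextEnd n y) : D.Face) = Quotient.mk _ (D.glue y) := by
  refine Quotient.sound (Equiv.Perm.SameCycle.symm ⟨1, ?_⟩)
  simp [D.glue_glue]

/-- An orientation picks one of the two ends of each edge, which makes `symmetrize` surjective; its
kernel consists of the edge chains again. -/
theorem finrank_edgeChains : Module.finrank (ZMod 2) D.edgeChains = 2 * n := by
  have h1 := D.symmetrize.finrank_range_add_finrank_ker
  have hker : LinearMap.ker D.symmetrize = D.edgeChains := by
    ext g
    rw [LinearMap.mem_ker]
    constructor
    · intro h x
      have := congrFun (congrArg Subtype.val h) x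
      rw [symmetrize_apply] at this
      exact (CharTwo.add_eq_zero.mp this).symm
    · intro h
      ext x
      rw [symmetrize_apply, h x]
      exact CharTwo.add_self_eq_zero _
  have hrange : LinearMap.range D.symmetrize = ⊤ := by
    rw [LinearMap.range_eq_top]
    intro g
    obtain ⟨o⟩ := D.nonempty_orientation fun _ => none
    refine ⟨fun x => if o.out x then g.1 x else 0, ?_⟩
    ext x
    rw [symmetrize_apply, o.out_glue, g.2 x]
    cases o.out x <;> simp
  rw [hrange, hker, finrank_top, Module.finrank_fintype_fun_eq_card] at h1
  simp at h1
  omega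

theorem edgeBoundary_faceBoundary (g : D.Face → ZMod 2) :
    D.edgeBoundary (D.faceBoundary g) = 0 := by
  ext c
  change ∑ i : Fin 4, (g (Quotient.mk _ (c, i)) + g (Quotient.mk _ (D.glue (c, i)))) = 0
  have h : ∀ i : Fin 4, g (Quotient.mk _ (D.glue (c, i))) = g (Quotient.mk _ (c, i + 1)) :=
    fun i => congrArg g (D.face_next (c, i)).symm
  rw [Finset.sum_add_distrib, Finset.sum_congr rfl fun i _ => h i,
    show ∑ i : Fin 4, g (Quotient.mk _ (c, i + 1)) = ∑ i : Fin 4, g (Quotient.mk _ (c, i)) from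
      Equiv.sum_comp (Equiv.addRight (1 : Fin 4)) fun i => g (Quotient.mk _ (c, i))]
  exact CharTwo.add_self_eq_zero _

variable {D}

/-- In a connected diagram, a set of faces without boundary is empty or contains all faces. -/
theorem finrank_ker_faceBoundary_le (hD : ∀ z w, D.Linked (fun _ => none) z w) :
    Module.finrank (ZMod 2) (LinearMap.ker D.faceBoundary) ≤ 1 := by
  have hle : LinearMap.ker D.faceBoundary ≤ Submodule.span (ZMod 2) {fun _ => 1} := by
    intro g hg
    have hglue : ∀ x, g (Quotient.mk _ (D.glue x)) = g (Quotient.mk _ x) := fun x => by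
      have := congrFun (congrArg Subtype.val (LinearMap.mem_ker.mp hg)) x
      exact (CharTwo.add_eq_zero.mp this).symm
    have hnext : ∀ c i, g (Quotient.mk _ (c, i + 1)) = g (Quotient.mk _ (c, i)) := fun c i =>
      (congrArg g (D.face_next (c, i))).trans (hglue _)
    have hall : ∀ c (i : Fin 4), g (Quotient.mk _ (c, i)) = g (Quotient.mk _ (c, 0)) := by
      intro c i
      have h1 := hnext c 0
      have h2 := hnext c 1
      have h3 := hnext c 2
      fin_cases i
      · rfl
      · exact h1
      · exact h2.trans h1
      · exact h3.trans (h2.trans h1)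
    have hsame : ∀ x y : StrandEnd n, y.1 = x.1 →
        g (Quotient.mk _ y) = g (Quotient.mk _ x) := by
      rintro ⟨c, i⟩ ⟨d, j⟩ rfl
      exact (hall _ _).trans (hall _ _).symm
    have hconst : ∀ x y, g (Quotient.mk _ y) = g (Quotient.mk _ x) := by
      intro x y
      obtain ⟨y', hy, h⟩ := (hD (.inl x) (.inl y)).of_closed
        (p := fun z => ∃ y, z = .inl y ∧ g (Quotient.mk _ y) = g (Quotient.mk _ x))
        (fun z ⟨y, hy, h⟩ => ⟨_, rfl, by rw [hglue, Sum.inl.inj hy, h]⟩)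
        (fun z ⟨y, hy, h⟩ => ⟨_, rfl, by
          rw [hsame z _ (through_fst _ _), Sum.inl.inj hy, h]⟩)
        (fun z t _ ht ⟨y, hy, h⟩ => ⟨_, rfl, by rw [hsame z t ht, Sum.inl.inj hy, h]⟩)
        ⟨x, rfl, rfl⟩
      rw [Sum.inl.inj hy, h]
    rw [Submodule.mem_span_singleton]
    by_cases hX : Nonempty (StrandEnd n)
    · obtain ⟨x⟩ := hX
      refine ⟨g (Quotient.mk _ x), ?_⟩
      ext q
      induction q using Quotient.inductionOn with
      | h y => simp [hconst x y]
    · refine ⟨0, ?_⟩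
      ext q
      induction q using Quotient.inductionOn with
      | h y => exact absurd ⟨y⟩ hX
  exact (Submodule.finrank_mono hle).trans ((finrank_span_le_card _).trans (by simp))

/-- In a connected diagram, the sum of any two crossings is the boundary of a path of edges. -/
theorem le_finrank_range_edgeBoundary (hD : ∀ z w, D.Linked (fun _ => none) z w) (c₀ : Fin n) :
    n ≤ Module.finrank (ZMod 2) (LinearMap.range D.edgeBoundary) + 1 := by
  classical
  have two : ∀ v : Fin n → ZMod 2, v + v = 0 := fun v => funext fun _ =>
    CharTwo.add_self_eq_zero _
  have hstep : ∀ x : StrandEnd n, (Pi.single x.1 1 + Pi.single (D.glue x).1 1 : Fin n → ZMod 2) ∈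
      LinearMap.range D.edgeBoundary := by
    intro x
    refine ⟨D.symmetrize (Pi.single x 1), ?_⟩
    ext c
    change ∑ i : Fin 4, ((Pi.single x 1 : StrandEnd n → ZMod 2) (c, i)
      + (Pi.single x 1 : StrandEnd n → ZMod 2) (D.glue (c, i))) = _
    have hsum : ∀ y : StrandEnd n, ∑ i : Fin 4, (if (c, i) = y then (1 : ZMod 2) else 0)
        = if c = y.1 then 1 else 0 := by
      rintro ⟨d, j⟩
      by_cases h : c = d <;> simp [h]
    have hg : ∀ y : StrandEnd n, D.glue y = x ↔ y = D.glue x := fun y =>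
      ⟨fun h => by rw [← h, D.glue_glue], fun h => by rw [h, D.glue_glue]⟩
    simp only [Pi.single_apply, Pi.add_apply, Finset.sum_add_distrib, hg, hsum]
  have hpath : ∀ c, (Pi.single c 1 + Pi.single c₀ 1 : Fin n → ZMod 2) ∈
      LinearMap.range D.edgeBoundary := by
    intro c
    obtain ⟨y, hy, h⟩ := (hD (.inl (c₀, 0)) (.inl (c, 0))).of_closed
      (p := fun z => ∃ y : StrandEnd n, z = .inl y ∧
        (Pi.single y.1 1 + Pi.single c₀ 1 : Fin n → ZMod 2) ∈ LinearMap.range D.edgeBoundary)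
      (fun x ⟨y, hy, h⟩ => ⟨_, rfl, by
        obtain rfl := Sum.inl.inj hy
        have := Submodule.add_mem _ (hstep x) h
        have e : (Pi.single x.1 1 + Pi.single (D.glue x).1 1
            + (Pi.single x.1 1 + Pi.single c₀ 1) : Fin n → ZMod 2)
            = (Pi.single x.1 1 + Pi.single x.1 1)
              + (Pi.single (D.glue x).1 1 + Pi.single c₀ 1) := by abel
        rwa [e, two, zero_add] at this⟩)
      (fun x ⟨y, hy, h⟩ => ⟨_, rfl, by rwa [through_fst, Sum.inl.inj hy]⟩)
      (fun x t _ ht ⟨y, hy, h⟩ => ⟨_, rfl, by rwa [ht, Sum.inl.inj hy]⟩)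
      ⟨_, rfl, by
        rw [two]; exact Submodule.zero_mem _⟩
    rw [← Sum.inl.inj hy] at h
    exact h
  have htop : LinearMap.range D.edgeBoundary ⊔
      Submodule.span (ZMod 2) {(Pi.single c₀ 1 : Fin n → ZMod 2)} = ⊤ := by
    rw [eq_top_iff, ← (Pi.basisFun (ZMod 2) (Fin n)).span_eq, Submodule.span_le]
    rintro _ ⟨c, rfl⟩
    rw [Pi.basisFun_apply]
    have e : (Pi.single c 1 : Fin n → ZMod 2)
        = (Pi.single c 1 + Pi.single c₀ 1) + Pi.single c₀ 1 := by
      rw [add_assoc, two, add_zero]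
    rw [e]
    exact Submodule.add_mem_sup (hpath c) (Submodule.mem_span_singleton_self _)
  have h1 := Submodule.finrank_add_le_finrank_add_finrank (LinearMap.range D.edgeBoundary)
    (Submodule.span (ZMod 2) {(Pi.single c₀ 1 : Fin n → ZMod 2)})
  rw [htop, finrank_top, Module.finrank_fintype_fun_eq_card, Fintype.card_fin] at h1
  exact h1.trans (Nat.add_le_add_left ((finrank_span_le_card _).trans (by simp)) _)

end PDCode

open PDCode in
/-- The checkerboard colouring: in genus zero the face boundaries span all cycles mod `2`, by
Euler's formula, so the cycle of all edges is the boundary of a set of faces. The sign of an end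
is then the colour of the face which follows it. -/
theorem LinkDiagram.exists_isAlternating {n : ℕ} (D : LinkDiagram n) (hD : D.IsConnected) :
    ∃ s, D.IsAlternating s := by
  rcases n with _ | n
  · exact ⟨fun x => x.1.elim0, fun x => x.1.elim0, fun c => c.elim0⟩
  have hconn : ∀ z w, D.Linked (fun _ => none) z w := (connectedAt_iff.mp hD).1
  have hcomp : Nat.card (Quot (D.Joined fun _ => none)) = 1 := by
    rw [Nat.card_eq_one_iff_unique]
    refine ⟨⟨fun a b => ?_⟩, ⟨Quot.mk _ (0, 0)⟩⟩
    induction a using Quot.inductionOn with | h x => ?_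
    induction b using Quot.inductionOn with | h y => ?_
    exact Sum.inl.inj (hconn (.inl x) (.inl y))
  have hplanar := D.planar
  rw [hcomp] at hplanar
  have hface : Nat.card D.Face = n + 1 + 2 := by push_cast at hplanar; omega
  have : Fintype D.Face := Fintype.ofFinite _
  have h1 := D.faceBoundary.finrank_range_add_finrank_ker
  rw [Module.finrank_fintype_fun_eq_card, ← Nat.card_eq_fintype_card, hface] at h1
  have h2 := finrank_ker_faceBoundary_le hconn
  have h3 := D.edgeBoundary.finrank_range_add_finrank_ker
  rw [finrank_edgeChains] at h3
  have h4 := le_finrank_range_edgeBoundary hconn 0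
  have hle : LinearMap.range D.faceBoundary ≤ LinearMap.ker D.edgeBoundary := by
    rintro _ ⟨g, rfl⟩
    exact D.edgeBoundary_faceBoundary g
  -- With `n + 1` crossings there are `n + 3` faces: the boundaries of faces have dimension at
  -- least `n + 2`, and the cycles have dimension at most `2 (n + 1) - n`.
  have heq := Submodule.eq_of_le_of_finrank_le hle (by omega)
  have hone : (⟨fun _ => 1, fun _ => rfl⟩ : D.edgeChains) ∈ LinearMap.ker D.edgeBoundary := by
    rw [LinearMap.mem_ker]
    ext c
    change ∑ i : Fin 4, (1 : ZMod 2) = 0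
    decide
  rw [← heq] at hone
  obtain ⟨g, hg⟩ := hone
  have hg' : ∀ x, g (Quotient.mk _ x) + g (Quotient.mk _ (D.glue x)) = 1 := fun x =>
    congrFun (congrArg Subtype.val hg) x
  have key : ∀ a b : ZMod 2, a + b = 1 → decide (b = 0) = !decide (a = 0) := by decide
  refine ⟨fun x => decide (g (Quotient.mk _ x) = 0), fun x => key _ _ (hg' x), fun c i => ?_⟩
  have h := D.face_next (c, i)
  change decide (g (Quotient.mk _ (nextEnd _ (c, i))) = 0) = _
  rw [h]
  exact key _ _ (hg' _)

/-! ### Merging and splitting of circles -/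

theorem KauffmanState.toPartial_update {n : ℕ} (S : KauffmanState n) (c : Fin n) (b : Bool) :
    KauffmanState.toPartial (Function.update S c b) = Function.update S.toPartial c (some b) := by
  funext c'
  by_cases h : c' = c
  · subst h; simp [toPartial]
  · simp [toPartial, h]

namespace PDCode

variable {n : ℕ} {D : PDCode n}

variable (D) in
/-- The circles of `S'` arise from those of `S` by merging the two different circles which pass by
the crossing `c`. -/
def Merges (S S' : KauffmanState n) (c : Fin n) : Prop :=
  ¬ D.Linked S.toPartial (.inl (c, 0)) (.inl (c, 2)) ∧
  ∀ z w, D.Linked S'.toPartial z w ↔ D.Linked S.toPartial z w ∨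
    (D.Linked S.toPartial z (.inl (c, 0)) ∧ D.Linked S.toPartial w (.inl (c, 2))) ∨
    (D.Linked S.toPartial z (.inl (c, 2)) ∧ D.Linked S.toPartial w (.inl (c, 0)))

theorem merges_of_not_linked {S S' : KauffmanState n} {c : Fin n} (hc : S' c = !S c)
    (hS : ∀ c', c' ≠ c → S' c' = S c')
    (h : ¬ D.Linked S.toPartial (.inl (c, 0)) (.inl (c, 2))) : D.Merges S S' c := by
  have e1 : S.toPartial = Function.update S.toPartial c (some (S c)) := by
    rw [← KauffmanState.toPartial_update, Function.update_eq_self]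
  have e2 : S'.toPartial = Function.update S.toPartial c (some !S c) := by
    rw [← KauffmanState.toPartial_update]
    congr 1
    funext c'
    by_cases h0 : c' = c
    · subst h0; simp [hc]
    · simp [h0, hS c' h0]
  refine ⟨h, fun z w => ?_⟩
  rw [e1] at h
  have := linked_flip_iff h z w
  rwa [← e1, ← e2] at this

/-- With a source-sink structure, every change of a smoothing merges two circles or splits one. -/
theorem IsAlternating.merges_or_merges {s : StrandEnd n → Bool} (hs : D.IsAlternating s)
    {S S' : KauffmanState n} {c : Fin n} (hc : S' c = !S c) (hS : ∀ c', c' ≠ c → S' c' = S c') :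
    D.Merges S S' c ∨ D.Merges S' S c := by
  by_cases h : D.Linked S.toPartial (.inl (c, 0)) (.inl (c, 2))
  · exact .inr (merges_of_not_linked (by simp [hc]) (fun c' h' => (hS c' h').symm)
      (hs.not_linked_flip hc hS h))
  · exact .inl (merges_of_not_linked hc hS h)

namespace Merges

variable {S S' : KauffmanState n} {c : Fin n}

theorem linked (h : D.Merges S S' c) : D.Linked S'.toPartial (.inl (c, 0)) (.inl (c, 2)) :=
  (h.2 _ _).mpr (.inr (.inl ⟨rfl, rfl⟩))

theorem mono (h : D.Merges S S' c) {z w : D.Point} (hzw : D.Linked S.toPartial z w) :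
    D.Linked S'.toPartial z w := (h.2 _ _).mpr (.inl hzw)

theorem linked_left_iff (h : D.Merges S S' c) (z : D.Point) :
    D.Linked S'.toPartial z (.inl (c, 0)) ↔
      D.Linked S.toPartial z (.inl (c, 0)) ∨ D.Linked S.toPartial z (.inl (c, 2)) := by
  rw [h.2]
  constructor
  · rintro (h0 | h0 | h0)
    · exact .inl h0
    · exact .inl h0.1
    · exact .inr h0.1
  · rintro (h0 | h0)
    · exact .inl h0
    · exact .inr (.inr ⟨h0, rfl⟩)

theorem linked_iff_of_not (h : D.Merges S S' c) {z : D.Point}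
    (h0 : ¬ D.Linked S.toPartial z (.inl (c, 0))) (h2 : ¬ D.Linked S.toPartial z (.inl (c, 2)))
    (w : D.Point) : D.Linked S'.toPartial w z ↔ D.Linked S.toPartial w z := by
  rw [h.2]
  constructor
  · rintro (h' | h' | h')
    · exact h'
    · exact absurd h'.2 h2
    · exact absurd h'.2 h0
  · exact .inl

end Merges

/-- The label of the circle through a point. -/
def label {S : KauffmanState n} (f : D.Circle S → Bool) (z : D.Point) : Bool :=
  f (D.comp S.toPartial z)

theorem label_congr {S : KauffmanState n} (f : D.Circle S → Bool) {z w : D.Point}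
    (h : D.Linked S.toPartial z w) : label f z = label f w := congrArg f h

theorem label_ext {S : KauffmanState n} {f g : D.Circle S → Bool}
    (h : ∀ z, label f z = label g z) : f = g := by
  funext x
  obtain ⟨z, rfl⟩ := D.comp_surjective _ x
  exact h z

open Classical in
/-- Change the label of the circle through a point. -/
noncomputable def relabel {S : KauffmanState n} (f : D.Circle S → Bool) (z : D.Point) (b : Bool) :
    D.Circle S → Bool := Function.update f (D.comp S.toPartial z) b

open Classical in
theorem label_relabel {S : KauffmanState n} (f : D.Circle S → Bool) (z w : D.Point) (b : Bool) :
    label (relabel f z b) w = if D.Linked S.toPartial w z then b else label f w := by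
  unfold label relabel
  by_cases h : D.Linked S.toPartial w z
  · rw [if_pos h, show D.comp S.toPartial w = D.comp S.toPartial z from h, Function.update_self]
  · rw [if_neg h, Function.update_of_ne h]

theorem label_relabel_of_linked {S : KauffmanState n} (f : D.Circle S → Bool) {z w : D.Point}
    (b : Bool) (h : D.Linked S.toPartial w z) : label (relabel f z b) w = b := by
  rw [label_relabel, if_pos h]

theorem label_relabel_of_not {S : KauffmanState n} (f : D.Circle S → Bool) {z w : D.Point}
    (b : Bool) (h : ¬ D.Linked S.toPartial w z) : label (relabel f z b) w = label f w := by
  rw [label_relabel, if_neg h]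

open Classical in
theorem edgeCoeff_of_merges {S S' : KauffmanState n} {c : Fin n} (h : D.Merges S S' c)
    (f : D.Circle S → Bool) (f' : D.Circle S' → Bool) :
    D.edgeCoeff c ⟨S, f⟩ ⟨S', f'⟩ =
      if ∀ z, ¬ D.Linked S.toPartial z (.inl (c, 0)) → ¬ D.Linked S.toPartial z (.inl (c, 2)) →
        label f' z = label f z then
        mulCoeff (label f (.inl (c, 0))) (label f (.inl (c, 2))) (label f' (.inl (c, 0)))
      else 0 := by
  have h1 := h.1
  unfold Linked at h1
  simp only [edgeCoeff, ← comp_toPartial]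
  rw [if_pos h1]
  exact if_congr Iff.rfl rfl rfl

open Classical in
theorem edgeCoeff_of_splits {S S' : KauffmanState n} {c : Fin n} (h : D.Merges S' S c)
    (f : D.Circle S → Bool) (f' : D.Circle S' → Bool) :
    D.edgeCoeff c ⟨S, f⟩ ⟨S', f'⟩ =
      if ∀ z, ¬ D.Linked S.toPartial z (.inl (c, 0)) → label f' z = label f z then
        comulCoeff (label f (.inl (c, 0))) (label f' (.inl (c, 0))) (label f' (.inl (c, 2)))
      else 0 := by
  have h1 := h.1
  have h2 := h.linked
  unfold Linked at h1 h2
  simp only [edgeCoeff, ← comp_toPartial]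
  rw [if_neg (not_not.mpr h2), if_pos h1]
  refine if_congr ?_ rfl rfl
  exact forall_congr' fun z => ⟨fun h3 h4 => h3 h4 (by rw [← h2]; exact h4), fun h3 h4 _ => h3 h4⟩

/-! ### The differential squares to zero

The tensor powers of `𝒜 = ℤ[x]/(x²)` are cyclic modules over the polynomial ring with one variable
for each point, which acts by turning labels `v₊` into `v₋`. The maps which change one smoothing
are linear for this action, so that it suffices to compare compositions on the state all of whose
labels are `v₊`. -/

open Classical in
/-- Linearity of a matrix between tensor powers of `𝒜`: it commutes with the operators that turn
the label `v₊` of the circle through a point into `v₋`. -/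
def IsLinear {S S' : KauffmanState n} (F : (D.Circle S → Bool) → (D.Circle S' → Bool) → ℤ) : Prop :=
  ∀ z f f', (if label f z = true then F (relabel f z false) f' else 0) =
    if label f' z = false then F f (relabel f' z true) else 0

theorem isLinear_of_merges {S S' : KauffmanState n} {c : Fin n} (h : D.Merges S S' c) :
    IsLinear fun f f' => D.edgeCoeff c ⟨S, f⟩ ⟨S', f'⟩ := by
  classical
  intro z f f'
  simp only [edgeCoeff_of_merges h]
  by_cases hz : D.Linked S.toPartial z (.inl (c, 0)) ∨ D.Linked S.toPartial z (.inl (c, 2))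
  · have hz' : D.Linked S'.toPartial (.inl (c, 0)) z := ((h.linked_left_iff z).mpr hz).symm
    have e1 : (∀ w, ¬ D.Linked S.toPartial w (.inl (c, 0)) →
        ¬ D.Linked S.toPartial w (.inl (c, 2)) → label f' w = label (relabel f z false) w) ↔
        ∀ w, ¬ D.Linked S.toPartial w (.inl (c, 0)) → ¬ D.Linked S.toPartial w (.inl (c, 2)) →
          label f' w = label f w := by
      refine forall_congr' fun w => imp_congr_right fun h0 => imp_congr_right fun h2 => ?_
      rw [label_relabel_of_not]
      rintro hw
      rcases hz with hz | hz
      · exact h0 (hw.trans hz)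
      · exact h2 (hw.trans hz)
    have e2 : (∀ w, ¬ D.Linked S.toPartial w (.inl (c, 0)) →
        ¬ D.Linked S.toPartial w (.inl (c, 2)) → label (relabel f' z true) w = label f w) ↔
        ∀ w, ¬ D.Linked S.toPartial w (.inl (c, 0)) → ¬ D.Linked S.toPartial w (.inl (c, 2)) →
          label f' w = label f w := by
      refine forall_congr' fun w => imp_congr_right fun h0 => imp_congr_right fun h2 => ?_
      rw [label_relabel_of_not]
      intro hw
      rcases (h.linked_left_iff w).mp (hw.trans hz'.symm) with h' | h'
      · exact h0 h'
      · exact h2 h'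
    rw [if_congr e1 rfl rfl, if_congr e2 rfl rfl, label_relabel_of_linked f' true hz',
      label_congr f' hz'.symm]
    by_cases hc : ∀ w, ¬ D.Linked S.toPartial w (.inl (c, 0)) →
      ¬ D.Linked S.toPartial w (.inl (c, 2)) → label f' w = label f w
    · simp only [if_pos hc]
      rcases hz with hz | hz
      · rw [label_congr f hz, label_relabel_of_linked f false hz.symm,
          label_relabel_of_not f false (fun h0 => h.1 (h0.trans hz).symm)]
        cases label f (.inl (c, 0)) <;> cases label f (.inl (c, 2)) <;>
          cases label f' (.inl (c, 0)) <;> simp [mulCoeff]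
      · rw [label_congr f hz, label_relabel_of_linked f false hz.symm,
          label_relabel_of_not f false (fun h0 => h.1 (h0.trans hz))]
        cases label f (.inl (c, 0)) <;> cases label f (.inl (c, 2)) <;>
          cases label f' (.inl (c, 0)) <;> simp [mulCoeff]
    · simp only [if_neg hc, ite_self]
  · rw [not_or] at hz
    have hz' : ¬ D.Linked S'.toPartial (.inl (c, 0)) z := fun h0 => by
      rcases (h.linked_left_iff z).mp h0.symm with h' | h'
      · exact hz.1 h'
      · exact hz.2 h'
    rw [label_relabel_of_not f false (fun h0 => hz.1 h0.symm),
      label_relabel_of_not f false (fun h0 => hz.2 h0.symm), label_relabel_of_not f' true hz']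
    simp only [label_relabel, h.linked_iff_of_not hz.1 hz.2]
    rcases hf : label f z with _ | _ <;> rcases hf' : label f' z with _ | _
    · simp only [Bool.false_eq_true, if_false, if_true]
      rw [if_neg]
      intro h0
      have := h0 z hz.1 hz.2
      rw [if_pos (Linked.refl _ z), hf] at this
      exact absurd this (by simp)
    · simp
    · simp only [if_true]
      refine if_congr ?_ rfl rfl
      refine forall_congr' fun w => imp_congr_right fun h0 => imp_congr_right fun h2 => ?_
      by_cases hw : D.Linked S.toPartial w z
      · have hw' : D.Linked S'.toPartial w z := h.mono hw
        rw [if_pos hw, if_pos hw, label_congr f hw, label_congr f' hw', hf, hf']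
        simp
      · rw [if_neg hw, if_neg hw]
    · simp only [Bool.true_eq_false, if_false, if_true]
      rw [if_neg]
      intro h0
      have := h0 z hz.1 hz.2
      rw [if_pos (Linked.refl _ z), hf'] at this
      exact absurd this (by simp)

theorem isLinear_of_splits {S S' : KauffmanState n} {c : Fin n} (h : D.Merges S' S c) :
    IsLinear fun f f' => D.edgeCoeff c ⟨S, f⟩ ⟨S', f'⟩ := by
  classical
  intro z f f'
  simp only [edgeCoeff_of_splits h]
  by_cases hz : D.Linked S.toPartial z (.inl (c, 0))
  · have hz' := (h.linked_left_iff z).mp hz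
    have e1 : (∀ w, ¬ D.Linked S.toPartial w (.inl (c, 0)) →
        label f' w = label (relabel f z false) w) ↔
        ∀ w, ¬ D.Linked S.toPartial w (.inl (c, 0)) → label f' w = label f w := by
      refine forall_congr' fun w => imp_congr_right fun h0 => ?_
      rw [label_relabel_of_not]
      exact fun hw => h0 (hw.trans hz)
    have e2 : (∀ w, ¬ D.Linked S.toPartial w (.inl (c, 0)) →
        label (relabel f' z true) w = label f w) ↔
        ∀ w, ¬ D.Linked S.toPartial w (.inl (c, 0)) → label f' w = label f w := by
      refine forall_congr' fun w => imp_congr_right fun h0 => ?_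
      rw [label_relabel_of_not]
      exact fun hw => h0 ((h.mono hw).trans hz)
    rw [if_congr e1 rfl rfl, if_congr e2 rfl rfl, label_relabel_of_linked f false hz.symm,
      label_congr f hz]
    by_cases hc : ∀ w, ¬ D.Linked S.toPartial w (.inl (c, 0)) → label f' w = label f w
    · simp only [if_pos hc]
      rcases hz' with hz' | hz'
      · rw [label_congr f' hz', label_relabel_of_linked f' true hz'.symm,
          label_relabel_of_not f' true (fun h0 => h.1 (h0.trans hz').symm)]
        cases label f (.inl (c, 0)) <;> cases label f' (.inl (c, 2)) <;>
          cases label f' (.inl (c, 0)) <;> simp [comulCoeff]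
      · rw [label_congr f' hz', label_relabel_of_linked f' true hz'.symm,
          label_relabel_of_not f' true (fun h0 => h.1 (h0.trans hz'))]
        cases label f (.inl (c, 0)) <;> cases label f' (.inl (c, 2)) <;>
          cases label f' (.inl (c, 0)) <;> simp [comulCoeff]
    · simp only [if_neg hc, ite_self]
  · have h0 : ¬ D.Linked S'.toPartial z (.inl (c, 0)) := fun h' => hz (h.mono h')
    have h2 : ¬ D.Linked S'.toPartial z (.inl (c, 2)) := fun h' =>
      hz ((h.mono h').trans h.linked.symm)
    rw [label_relabel_of_not f false (fun h' => hz h'.symm),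
      label_relabel_of_not f' true (fun h' => h0 h'.symm),
      label_relabel_of_not f' true (fun h' => h2 h'.symm)]
    simp only [label_relabel, h.linked_iff_of_not h0 h2]
    rcases hf : label f z with _ | _ <;> rcases hf' : label f' z with _ | _
    · simp only [Bool.false_eq_true, if_false, if_true]
      rw [if_neg]
      intro h'
      have := h' z hz
      rw [if_pos (Linked.refl _ z), hf] at this
      exact absurd this (by simp)
    · simp
    · simp only [if_true]
      refine if_congr ?_ rfl rfl
      refine forall_congr' fun w => imp_congr_right fun h0 => ?_
      by_cases hw : D.Linked S'.toPartial w z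
      · rw [if_pos hw, if_pos hw, label_congr f (h.mono hw), label_congr f' hw, hf, hf']
        simp
      · rw [if_neg hw, if_neg hw]
    · simp only [Bool.true_eq_false, if_false, if_true]
      rw [if_neg]
      intro h'
      have := h' z hz
      rw [if_pos (Linked.refl _ z), hf'] at this
      exact absurd this (by simp)

noncomputable instance (S : KauffmanState n) : Fintype (D.Circle S) := Fintype.ofFinite _

noncomputable instance (S : KauffmanState n) : Fintype (D.Circle S → Bool) := Fintype.ofFinite _

theorem relabel_relabel {S : KauffmanState n} (f : D.Circle S → Bool) (z : D.Point) (b b' : Bool) :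
    relabel (relabel f z b) z b' = relabel f z b' := by
  refine label_ext fun w => ?_
  simp only [label_relabel]
  split_ifs <;> rfl

theorem relabel_self {S : KauffmanState n} (f : D.Circle S → Bool) (z : D.Point) {b : Bool}
    (h : label f z = b) : relabel f z b = f := by
  refine label_ext fun w => ?_
  rw [label_relabel]
  split_ifs with hw
  · rw [label_congr f hw, h]
  · rfl

/-- Reindexing along the bijection, given by `relabel`, between the labellings with `v₋` and those
with `v₊` on the circle through `z`. -/
theorem sum_relabel {S : KauffmanState n} (z : D.Point)
    (H : (D.Circle S → Bool) → (D.Circle S → Bool) → ℤ) :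
    ∑ f : D.Circle S → Bool, (if label f z = false then H (relabel f z true) f else 0) =
      ∑ f : D.Circle S → Bool, if label f z = true then H f (relabel f z false) else 0 := by
  classical
  rw [← Finset.sum_filter, ← Finset.sum_filter]
  refine Finset.sum_bij' (fun f _ => relabel f z true) (fun f _ => relabel f z false)
    ?_ ?_ ?_ ?_ ?_
  · intro f _
    simp [label_relabel_of_linked f true (Linked.refl _ z)]
  · intro f _
    simp [label_relabel_of_linked f false (Linked.refl _ z)]
  · intro f hf
    simp only [Finset.mem_filter, Finset.mem_univ, true_and] at hf
    rw [relabel_relabel, relabel_self f z hf]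
  · intro f hf
    simp only [Finset.mem_filter, Finset.mem_univ, true_and] at hf
    rw [relabel_relabel, relabel_self f z hf]
  · intro f hf
    simp only [Finset.mem_filter, Finset.mem_univ, true_and] at hf
    rw [relabel_relabel, relabel_self f z hf]

theorem IsLinear.comp {S S' S'' : KauffmanState n}
    {F : (D.Circle S → Bool) → (D.Circle S' → Bool) → ℤ}
    {G : (D.Circle S' → Bool) → (D.Circle S'' → Bool) → ℤ} (hF : IsLinear F) (hG : IsLinear G) :
    IsLinear fun f f'' => ∑ f', F f f' * G f' f'' := by
  intro z f f''
  have h1 : (if label f z = true then ∑ f', F (relabel f z false) f' * G f' f'' else 0) =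
      ∑ f', (if label f' z = false then F f (relabel f' z true) * G f' f'' else 0) := by
    rw [show (if label f z = true then ∑ f', F (relabel f z false) f' * G f' f'' else 0) =
      ∑ f', (if label f z = true then F (relabel f z false) f' else 0) * G f' f'' by
      split_ifs <;> simp]
    refine Finset.sum_congr rfl fun f' _ => ?_
    rw [hF z f f']
    split_ifs <;> simp
  rw [h1, sum_relabel z fun f' g' => F f f' * G g' f'']
  rw [show (if label f'' z = false then ∑ f', F f f' * G f' (relabel f'' z true) else 0) =
    ∑ f', F f f' * (if label f'' z = false then G f' (relabel f'' z true) else 0) by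
    split_ifs <;> simp]
  refine Finset.sum_congr rfl fun f' _ => ?_
  rw [← hG z f' f'']
  split_ifs <;> simp

/-- The state all of whose labels are `v₊` generates the module. -/
theorem IsLinear.ext {S S' : KauffmanState n}
    {F G : (D.Circle S → Bool) → (D.Circle S' → Bool) → ℤ} (hF : IsLinear F) (hG : IsLinear G)
    (h : ∀ f', F (fun _ => true) f' = G (fun _ => true) f') (f : D.Circle S → Bool)
    (f' : D.Circle S' → Bool) : F f f' = G f f' := by
  classical
  obtain ⟨k, hk⟩ : ∃ k, (Finset.univ.filter fun x => f x = false).card = k := ⟨_, rfl⟩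
  induction k generalizing f f' with
  | zero =>
    have : f = fun _ => true := by
      funext x
      by_contra hx
      rw [Finset.card_eq_zero] at hk
      have : x ∈ Finset.univ.filter fun x => f x = false := by simpa using hx
      rw [hk] at this
      simp at this
    rw [this]
    exact h f'
  | succ k ih =>
    obtain ⟨x, hx⟩ := Finset.card_pos.mp (by rw [hk]; exact Nat.succ_pos k)
    obtain ⟨z, rfl⟩ := D.comp_surjective _ x
    have hz : label f z = false := (Finset.mem_filter.mp hx).2
    have e : relabel (relabel f z true) z false = f := by
      rw [relabel_relabel, relabel_self f z hz]
    have hcard : (Finset.univ.filter fun x => relabel f z true x = false).card = k := by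
      have : (Finset.univ.filter fun x => relabel f z true x = false)
          = (Finset.univ.filter fun x => f x = false).erase (D.comp S.toPartial z) := by
        ext y
        simp only [relabel, Function.update_apply, Finset.mem_filter, Finset.mem_univ, true_and,
          Finset.mem_erase]
        by_cases hy : y = D.comp S.toPartial z <;> simp [hy]
      rw [this, Finset.card_erase_of_mem hx, hk]
      rfl
    have h1 := hF z (relabel f z true) f'
    have h2 := hG z (relabel f z true) f'
    rw [if_pos (label_relabel_of_linked f true (Linked.refl _ z)), e] at h1 h2
    rw [h1, h2, ih _ _ hcard]

open Classical in
/-- The coefficient of the state with one label `v₋`, on the circle through `z`. -/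
noncomputable def unitAt {S : KauffmanState n} (z : D.Point) (f : D.Circle S → Bool) : ℤ :=
  if f = relabel (fun _ => true) z false then 1 else 0

theorem unitAt_congr {S : KauffmanState n} {z w : D.Point} (h : D.Linked S.toPartial z w)
    (f : D.Circle S → Bool) : unitAt z f = unitAt w f := by
  have : relabel (fun _ => true) z false = relabel (S := S) (D := D) (fun _ => true) w false := by
    unfold relabel
    rw [show D.comp S.toPartial z = D.comp S.toPartial w from h]
  unfold unitAt
  rw [this]

open Classical in
theorem edgeCoeff_one_of_merges {S S' : KauffmanState n} {c : Fin n} (h : D.Merges S S' c)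
    (f' : D.Circle S' → Bool) :
    D.edgeCoeff c ⟨S, fun _ => true⟩ ⟨S', f'⟩ = if f' = fun _ => true then 1 else 0 := by
  rw [edgeCoeff_of_merges h]
  by_cases hf : f' = fun _ => true
  · subst hf
    rw [if_pos (rfl : (fun _ => true : D.Circle S' → Bool) = fun _ => true)]
    exact if_pos fun _ _ _ => rfl
  · rw [if_neg hf]
    split_ifs with hc
    · have : label f' (.inl (c, 0)) = false := by
        by_contra h0
        rw [Bool.not_eq_false] at h0
        refine hf (label_ext fun z => ?_)
        by_cases hz : D.Linked S'.toPartial z (.inl (c, 0))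
        · rw [label_congr f' hz, h0]
          rfl
        · rw [h.linked_left_iff, not_or] at hz
          exact hc z hz.1 hz.2
      rw [this]
      rfl
    · rfl

theorem edgeCoeff_one_of_splits {S S' : KauffmanState n} {c : Fin n} (h : D.Merges S' S c)
    (f' : D.Circle S' → Bool) :
    D.edgeCoeff c ⟨S, fun _ => true⟩ ⟨S', f'⟩ =
      unitAt (.inl (c, 0)) f' + unitAt (.inl (c, 2)) f' := by
  classical
  rw [edgeCoeff_of_splits h]
  by_cases hc : ∀ z, ¬ D.Linked S.toPartial z (.inl (c, 0)) →
    label f' z = label (fun _ => true : D.Circle S → Bool) z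
  · rw [if_pos hc]
    have e : ∀ x y, x ≠ y → (∀ z, D.Linked S.toPartial z (.inl (c, 0)) →
        D.Linked S'.toPartial z x ∨ D.Linked S'.toPartial z y) → ¬ D.Linked S'.toPartial y x →
        (∀ z, D.Linked S'.toPartial z x → D.Linked S.toPartial z (.inl (c, 0))) →
        unitAt x f' = if label f' x = false ∧ label f' y = true then 1 else 0 := by
      intro x y hxy hcov hyx hS
      unfold unitAt
      refine if_congr ?_ rfl rfl
      constructor
      · rintro rfl
        rw [label_relabel_of_linked _ _ (Linked.refl _ _), label_relabel_of_not _ _ hyx]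
        exact ⟨rfl, rfl⟩
      · rintro ⟨h1, h2⟩
        refine label_ext fun z => ?_
        rw [label_relabel]
        split_ifs with hz
        · rw [label_congr f' hz, h1]
        · by_cases hz' : D.Linked S'.toPartial z y
          · rw [label_congr f' hz', h2]
            rfl
          · refine hc z fun h0 => ?_
            rcases hcov z h0 with h' | h'
            · exact hz h'
            · exact hz' h'
    rw [e (.inl (c, 0)) (.inl (c, 2)) (by simp) (fun z hz => (h.linked_left_iff z).mp hz)
        (fun h0 => h.1 h0.symm) (fun z hz => h.mono hz),
      e (.inl (c, 2)) (.inl (c, 0)) (by simp) (fun z hz => ((h.linked_left_iff z).mp hz).symm)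
        h.1 (fun z hz => (h.mono hz).trans h.linked.symm)]
    change comulCoeff true _ _ = _
    cases label f' (.inl (c, 0)) <;> cases label f' (.inl (c, 2)) <;> simp [comulCoeff]
  · rw [if_neg hc]
    have e : ∀ x, D.Linked S.toPartial x (.inl (c, 0)) → unitAt x f' = 0 := by
      intro x hx
      unfold unitAt
      rw [if_neg]
      rintro rfl
      refine hc fun z hz => ?_
      rw [label_relabel_of_not]
      · rfl
      · exact fun h0 => hz ((h.mono h0).trans hx)
    rw [e _ rfl, e _ h.linked.symm, add_zero]

/-- The matrix of the composition of the changes at `c` and then at `c'`. -/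
noncomputable def faceCoeff (D : PDCode n) (c c' : Fin n) (S S' S'' : KauffmanState n)
    (f : D.Circle S → Bool) (f'' : D.Circle S'' → Bool) : ℤ :=
  ∑ f' : D.Circle S' → Bool, D.edgeCoeff c ⟨S, f⟩ ⟨S', f'⟩ * D.edgeCoeff c' ⟨S', f'⟩ ⟨S'', f''⟩

section

variable {S S' S'' : KauffmanState n} {c c' : Fin n}

theorem sum_unitAt_mul (z : D.Point) (G : (D.Circle S → Bool) → ℤ) :
    ∑ f, unitAt z f * G f = G (relabel (fun _ => true) z false) := by
  classical
  simp [unitAt]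

theorem faceCoeff_one_of_merges (h : D.Merges S S' c) (f'' : D.Circle S'' → Bool) :
    D.faceCoeff c c' S S' S'' (fun _ => true) f'' =
      D.edgeCoeff c' ⟨S', fun _ => true⟩ ⟨S'', f''⟩ := by
  classical
  unfold faceCoeff
  simp [edgeCoeff_one_of_merges h]

/-- The state `1` splits into the sum of two states with one label `v₋`, which linearity moves to
the target. -/
theorem faceCoeff_one_of_splits (h : D.Merges S' S c)
    (hG : IsLinear fun f f' => D.edgeCoeff c' ⟨S', f⟩ ⟨S'', f'⟩) (f'' : D.Circle S'' → Bool) :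
    D.faceCoeff c c' S S' S'' (fun _ => true) f'' =
      (if label f'' (.inl (c, 0)) = false then
        D.edgeCoeff c' ⟨S', fun _ => true⟩ ⟨S'', relabel f'' (.inl (c, 0)) true⟩ else 0) +
      (if label f'' (.inl (c, 2)) = false then
        D.edgeCoeff c' ⟨S', fun _ => true⟩ ⟨S'', relabel f'' (.inl (c, 2)) true⟩ else 0) := by
  have h1 := hG (.inl (c, 0)) (fun _ => true) f''
  have h2 := hG (.inl (c, 2)) (fun _ => true) f''
  replace h1 := (if_pos rfl).symm.trans h1
  replace h2 := (if_pos rfl).symm.trans h2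
  rw [← h1, ← h2]
  unfold faceCoeff
  simp only [edgeCoeff_one_of_splits h, add_mul, Finset.sum_add_distrib]
  rw [sum_unitAt_mul (.inl (c, 0)) fun f' => D.edgeCoeff c' ⟨S', f'⟩ ⟨S'', f''⟩,
    sum_unitAt_mul (.inl (c, 2)) fun f' => D.edgeCoeff c' ⟨S', f'⟩ ⟨S'', f''⟩]

open Classical in
theorem ite_label_relabel_eq_one (f : D.Circle S → Bool) (z : D.Point) :
    (if label f z = false then (if relabel f z true = fun _ => true then (1 : ℤ) else 0) else 0) =
      unitAt z f := by
  unfold unitAt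
  by_cases h : f = relabel (fun _ => true) z false
  · have h1 : label f z = false := by rw [h, label_relabel_of_linked _ _ (Linked.refl _ _)]
    have h2 : relabel f z true = fun _ => true := by
      rw [h, relabel_relabel]
      exact relabel_self _ _ rfl
    rw [if_pos h, if_pos h1, if_pos h2]
  · rw [if_neg h]
    split_ifs with h1 h2
    · exact absurd (by rw [← h2, relabel_relabel, relabel_self f z h1]) h
    · rfl
    · rfl

open Classical in
/-- Turning the labels of the circles through `w` and `z` into `v₋`, one after the other,
    gives `0` if
these circles agree. -/
theorem ite_label_unitAt (f : D.Circle S → Bool) (z w : D.Point) :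
    (if label f z = false then unitAt w (relabel f z true) else 0) =
      if ¬ D.Linked S.toPartial z w ∧ f = relabel (relabel (fun _ => true) w false) z false
      then 1 else 0 := by
  unfold unitAt
  by_cases hzw : D.Linked S.toPartial z w
  · rw [if_neg (fun h : ¬ D.Linked S.toPartial z w ∧ _ => h.1 hzw)]
    split_ifs with h1 h2
    · have := congrArg (label · z) h2
      simp only [label_relabel_of_linked _ _ (Linked.refl _ z),
        label_relabel_of_linked _ _ hzw] at this
      exact absurd this (by simp)
    · rfl
    · rfl
  · by_cases h : f = relabel (relabel (fun _ => true) w false) z false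
    · have h1 : label f z = false := by rw [h, label_relabel_of_linked _ _ (Linked.refl _ _)]
      have h2 : relabel f z true = relabel (fun _ => true) w false := by
        rw [h, relabel_relabel]
        refine relabel_self _ _ ?_
        rw [label_relabel_of_not _ _ hzw]
        rfl
      have h3 : ¬ D.Linked S.toPartial z w ∧
        f = relabel (relabel (fun _ => true) w false) z false := ⟨hzw, h⟩
      rw [if_pos h1, if_pos h2, if_pos h3]
    · rw [if_neg (fun h' : ¬ D.Linked S.toPartial z w ∧ _ => h h'.2)]
      split_ifs with h1 h2
      · exact absurd (by rw [← h2, relabel_relabel, relabel_self f z h1]) h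
      · rfl
      · rfl

theorem ite_label_unitAt_comm (f : D.Circle S → Bool) (z w : D.Point) :
    (if label f z = false then unitAt w (relabel f z true) else 0) =
      if label f w = false then unitAt z (relabel f w true) else 0 := by
  classical
  rw [ite_label_unitAt, ite_label_unitAt]
  refine if_congr ?_ rfl rfl
  rw [linked_comm (z := z)]
  refine and_congr_right fun h => ?_
  have : relabel (relabel (fun _ => true) w false) z false =
      relabel (S := S) (relabel (fun _ => true) z false) w false := by
    unfold relabel
    exact Function.update_comm (fun h0 => h h0) _ _ _
  rw [this]

end

/-- The two ways around a face of the cube of smoothings agree. -/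
theorem faceCoeff_comm {S T T' S'' : KauffmanState n} {c c' : Fin n}
    (h1 : D.Merges S T c ∨ D.Merges T S c) (h2 : D.Merges T S'' c' ∨ D.Merges S'' T c')
    (h1' : D.Merges S T' c' ∨ D.Merges T' S c') (h2' : D.Merges T' S'' c ∨ D.Merges S'' T' c)
    (f : D.Circle S → Bool) (f'' : D.Circle S'' → Bool) :
    D.faceCoeff c c' S T S'' f f'' = D.faceCoeff c' c S T' S'' f f'' := by
  classical
  have lin : ∀ {S S' : KauffmanState n} {c : Fin n}, D.Merges S S' c ∨ D.Merges S' S c →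
      IsLinear fun f f' => D.edgeCoeff c ⟨S, f⟩ ⟨S', f'⟩ := fun h =>
    h.elim isLinear_of_merges isLinear_of_splits
  refine ((lin h1).comp (lin h2)).ext ((lin h1').comp (lin h2')) (fun g => ?_) f f''
  change D.faceCoeff c c' S T S'' _ g = D.faceCoeff c' c S T' S'' _ g
  -- By linearity both sides need to be compared only on the state `1` with all labels `v₊`. A merge
  -- maps `1` to `1`, and a split maps it to the sum of the two states with one label `v₋`.
  have l2 := lin h2
  have l2' := lin h2'
  have ms : ∀ {S T S'' : KauffmanState n} {c c' : Fin n}, D.Merges S T c → D.Merges S'' T c' →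
      ∀ g, D.faceCoeff c c' S T S'' (fun _ => true) g =
        unitAt (.inl (c', 0)) g + unitAt (.inl (c', 2)) g := fun h1 h2 g => by
    rw [faceCoeff_one_of_merges h1, edgeCoeff_one_of_splits h2]
  have sm : ∀ {S T S'' : KauffmanState n} {c c' : Fin n}, D.Merges T S c → D.Merges T S'' c' →
      ∀ g, D.faceCoeff c c' S T S'' (fun _ => true) g =
        unitAt (.inl (c, 0)) g + unitAt (.inl (c, 2)) g := fun h1 h2 g => by
    rw [faceCoeff_one_of_splits h1 (isLinear_of_merges h2), edgeCoeff_one_of_merges h2,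
      edgeCoeff_one_of_merges h2, ite_label_relabel_eq_one, ite_label_relabel_eq_one]
  rcases h1 with h1 | h1 <;> rcases h2 with h2 | h2
  · rcases h1' with h1' | h1'
    · rcases h2' with h2' | h2'
      · rw [faceCoeff_one_of_merges h1, faceCoeff_one_of_merges h1', edgeCoeff_one_of_merges h2,
          edgeCoeff_one_of_merges h2']
      · exact absurd (h2.mono h1.linked) h2'.1
    · exact absurd (h1.mono h1'.linked) h2.1
  · rcases h1' with h1' | h1' <;> rcases h2' with h2' | h2'
    · exact absurd (h2'.mono h1'.linked) h2.1
    · rw [ms h1 h2, ms h1' h2']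
      -- In `S''` the two circles at `c` are the two circles at `c'`.
      have hr := ((h1.2 _ _).mp h2.linked).resolve_left h1'.1
      have hu : D.Linked T.toPartial (.inl (c, 0)) (.inl (c', 0)) := by
        rcases hr with hr | hr
        · exact (h1.mono hr.1).symm
        · exact h1.linked.trans (h1.mono hr.1).symm
      have hv : D.Linked T.toPartial (.inl (c, 2)) (.inl (c', 0)) := h1.linked.symm.trans hu
      rw [h2.linked_left_iff] at hu hv
      rcases hu with hu | hu <;> rcases hv with hv | hv
      · exact absurd (hu.trans hv.symm) h2'.1
      · rw [unitAt_congr hu, unitAt_congr hv]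
      · rw [unitAt_congr hu, unitAt_congr hv, add_comm]
      · exact absurd (hu.trans hv.symm) h2'.1
    · rw [ms h1 h2, sm h1' h2']
    · exact absurd (h1'.mono h2'.linked) h1.1
  · rcases h1' with h1' | h1' <;> rcases h2' with h2' | h2'
    · exact absurd (h1'.mono h1.linked) h2'.1
    · rw [sm h1 h2, ms h1' h2']
    · rw [sm h1 h2, sm h1' h2']
      -- In `S''` there is only one circle which passes by `c` or `c'`.
      have hr := ((h1.2 _ _).mp h1'.linked).resolve_left h2.1
      have e0 : D.Linked S''.toPartial (.inl (c, 0)) (.inl (c', 0)) := by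
        rcases hr with hr | hr
        · exact (h2.mono hr.1).symm
        · exact h2'.linked.trans (h2.mono hr.1).symm
      rw [unitAt_congr e0, unitAt_congr (h2'.linked.symm.trans (e0.trans h2.linked))]
    · exact absurd (h2'.mono h2.linked) h1'.1
  · rcases h1' with h1' | h1'
    · exact absurd (h1.mono h2.linked) h1'.1
    · rcases h2' with h2' | h2'
      · exact absurd (h2.mono h2'.linked) h1.1
      · rw [faceCoeff_one_of_splits h1 l2, faceCoeff_one_of_splits h1' l2']
        simp only [edgeCoeff_one_of_splits h2, edgeCoeff_one_of_splits h2']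
        have hd : ∀ (p : Prop) [Decidable p] (a b : ℤ), (if p then a + b else 0) =
            (if p then a else 0) + if p then b else 0 := fun p _ a b => by split_ifs <;> simp
        simp only [hd]
        rw [ite_label_unitAt_comm g (.inl (c, 0)) (.inl (c', 0)),
          ite_label_unitAt_comm g (.inl (c, 0)) (.inl (c', 2)),
          ite_label_unitAt_comm g (.inl (c, 2)) (.inl (c', 0)),
          ite_label_unitAt_comm g (.inl (c, 2)) (.inl (c', 2))]
        ring

end PDCode

namespace PDCode

variable {n : ℕ} {D : PDCode n}

/-- The sign of the change at the crossing `c`. -/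
def signBefore (S : KauffmanState n) (c : Fin n) : ℤ :=
  (-1) ^ (Finset.univ.filter fun c' => c' < c ∧ S c' = true).card

theorem signBefore_update_of_lt {S : KauffmanState n} {c c' : Fin n} (h : c < c')
    (hc : S c = false) : signBefore (Function.update S c true) c' = -signBefore S c' := by
  unfold signBefore
  have : (Finset.univ.filter fun d => d < c' ∧ Function.update S c true d = true) =
      insert c (Finset.univ.filter fun d => d < c' ∧ S d = true) := by
    ext d
    by_cases hd : d = c
    · subst hd; simp [h]
    · simp [hd]
  rw [this, Finset.card_insert_of_notMem (by simp [hc]), pow_succ]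
  ring

theorem signBefore_update_of_not_lt {S : KauffmanState n} {c c' : Fin n} (h : ¬ c < c') :
    signBefore (Function.update S c true) c' = signBefore S c' := by
  unfold signBefore
  congr 2
  ext d
  by_cases hd : d = c
  · subst hd; simp [h]
  · simp [hd]

theorem incidence_eq (E E' : D.EnhancedState) : D.incidence E E' =
    ∑ c : Fin n, if E.1 c = false ∧ E'.1 = Function.update E.1 c true then
      signBefore E.1 c * D.edgeCoeff c E E' else 0 := rfl

/-- The only intermediate state between the changes at `c` and at `c'` is the one with `c` changed,
which leaves the sum over its labels. -/
theorem sum_change_mul_change (E E'' : D.EnhancedState) (c c' : Fin n) :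
    ∑ E' : D.EnhancedState,
      (if E.1 c = false ∧ E'.1 = Function.update E.1 c true then
        signBefore E.1 c * D.edgeCoeff c E E' else 0) *
      (if E'.1 c' = false ∧ E''.1 = Function.update E'.1 c' true then
        signBefore E'.1 c' * D.edgeCoeff c' E' E'' else 0) =
    if E.1 c = false ∧ Function.update E.1 c true c' = false ∧
        E''.1 = Function.update (Function.update E.1 c true) c' true then
      signBefore E.1 c * signBefore (Function.update E.1 c true) c' *
        D.faceCoeff c c' E.1 (Function.update E.1 c true) E''.1 E.2 E''.2 else 0 := by
  classical
  rw [Fintype.sum_sigma, Finset.sum_eq_single_of_mem (Function.update E.1 c true)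
    (Finset.mem_univ _)]
  · by_cases h1 : E.1 c = false
    · by_cases h2 : Function.update E.1 c true c' = false ∧
          E''.1 = Function.update (Function.update E.1 c true) c' true
      · simp only [h1, h2, and_self, if_true]
        unfold faceCoeff
        rw [Finset.mul_sum]
        refine Finset.sum_congr rfl fun f' _ => ?_
        change _ * D.edgeCoeff c E _ * (_ * D.edgeCoeff c' _ E'') =
          _ * (D.edgeCoeff c E _ * D.edgeCoeff c' _ E'')
        ring
      · rw [if_neg (fun h => h2 h.2)]
        exact Finset.sum_eq_zero fun f' _ => by rw [if_neg h2, mul_zero]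
    · rw [if_neg (fun h => h1 h.1)]
      exact Finset.sum_eq_zero fun f' _ => by rw [if_neg (fun h => h1 h.1), zero_mul]
  · intro S' _ hS'
    exact Finset.sum_eq_zero fun f' _ => by rw [if_neg (fun h => hS' h.2), zero_mul]

/-- The matrix of the differential has square zero: the two ways around a face of the cube cancel
because of the signs. -/
theorem IsAlternating.sum_incidence_mul {s : StrandEnd n → Bool} (hs : D.IsAlternating s)
    (E E'' : D.EnhancedState) : ∑ E', D.incidence E E' * D.incidence E' E'' = 0 := by
  classical
  simp only [incidence_eq, Finset.sum_mul_sum]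
  rw [Finset.sum_comm]
  have hcomm : ∀ c, ∑ E' : D.EnhancedState, ∑ c',
      (if E.1 c = false ∧ E'.1 = Function.update E.1 c true then
        signBefore E.1 c * D.edgeCoeff c E E' else 0) *
      (if E'.1 c' = false ∧ E''.1 = Function.update E'.1 c' true then
        signBefore E'.1 c' * D.edgeCoeff c' E' E'' else 0) = ∑ c', _ := fun c =>
    Finset.sum_comm.trans (Finset.sum_congr rfl fun c' _ => sum_change_mul_change E E'' c c')
  simp only [hcomm]
  set G : Fin n → Fin n → ℤ := fun c c' =>
    if E.1 c = false ∧ Function.update E.1 c true c' = false ∧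
        E''.1 = Function.update (Function.update E.1 c true) c' true then
      signBefore E.1 c * signBefore (Function.update E.1 c true) c' *
        D.faceCoeff c c' E.1 (Function.update E.1 c true) E''.1 E.2 E''.2 else 0
  change ∑ c, ∑ c', G c c' = 0
  -- The two orders of changes have opposite signs, since the earlier crossing counts in the sign of
  -- the later one.
  have hG : ∀ c c', G c c' + G c' c = 0 := by
    intro c c'
    by_cases hcc : c = c'
    · subst hcc
      simp [G]
    · have hiff : (E.1 c = false ∧ Function.update E.1 c true c' = false ∧
          E''.1 = Function.update (Function.update E.1 c true) c' true) ↔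
          (E.1 c' = false ∧ Function.update E.1 c' true c = false ∧
          E''.1 = Function.update (Function.update E.1 c' true) c true) := by
        rw [Function.update_of_ne hcc, Function.update_of_ne (Ne.symm hcc),
          Function.update_comm hcc]
        tauto
      by_cases h : E.1 c = false ∧ Function.update E.1 c true c' = false ∧
          E''.1 = Function.update (Function.update E.1 c true) c' true
      · have h' := hiff.mp h
        simp only [G]
        rw [if_pos h, if_pos h']
        have flip : ∀ {S : KauffmanState n} {c : Fin n}, S c = false →
            D.Merges S (Function.update S c true) c ∨ D.Merges (Function.update S c true) S c :=
          fun {S c} hS => hs.merges_or_merges (by simp [hS])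
            fun d hd => Function.update_of_ne hd _ _
        rw [faceCoeff_comm (T' := Function.update E.1 c' true) (flip h.1)
          (by rw [h.2.2]; exact flip h.2.1) (flip h'.1) (by rw [h'.2.2]; exact flip h'.2.1)]
        rcases lt_or_gt_of_ne hcc with hlt | hlt
        · rw [signBefore_update_of_lt hlt h.1, signBefore_update_of_not_lt (not_lt_of_gt hlt)]
          ring
        · rw [signBefore_update_of_lt hlt h'.1, signBefore_update_of_not_lt (not_lt_of_gt hlt)]
          ring
      · simp only [G]
        rw [if_neg h, if_neg (fun h' => h (hiff.mpr h')), add_zero]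
  have h1 : ∑ c, ∑ c', G c c' = ∑ c, ∑ c', G c' c := Finset.sum_comm
  have h2 : ∑ c, ∑ c', (G c c' + G c' c) = 0 :=
    Finset.sum_eq_zero fun c _ => Finset.sum_eq_zero fun c' _ => hG c c'
  simp only [Finset.sum_add_distrib] at h2
  omega

/-! ### The differential has bidegree `(1, 0)` -/

/-- The secondary degree of a basis element of `𝒜`. -/
def labelDegree (b : Bool) : ℤ := if b then 1 else -1

theorem secondaryDegree_eq (E : D.EnhancedState) :
    D.secondaryDegree E = E.1.toPartial.numOne + ∑ x, labelDegree (E.2 x) := by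
  classical
  have h : ∑ x, labelDegree (E.2 x) =
      (Nat.card {x // E.2 x = true} : ℤ) - Nat.card {x // E.2 x = false} := by
    simp only [labelDegree, Nat.card_eq_fintype_card, Fintype.card_subtype]
    rw [Finset.sum_ite, Finset.sum_const, Finset.sum_const]
    simp
    ring
  rw [h, secondaryDegree]
  ring

theorem numOne_update {S : KauffmanState n} {c : Fin n} (hc : S c = false) :
    (KauffmanState.toPartial (Function.update S c true)).numOne = S.toPartial.numOne + 1 := by
  unfold PartialSmoothing.numOne
  have : (Finset.univ.filter fun d =>
      KauffmanState.toPartial (Function.update S c true) d = some true) =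
      insert c (Finset.univ.filter fun d => S.toPartial d = some true) := by
    ext d
    by_cases hd : d = c
    · subst hd; simp [KauffmanState.toPartial]
    · simp [KauffmanState.toPartial, hd]
  rw [this, Finset.card_insert_of_notMem]
  simp [KauffmanState.toPartial, hc]

/-- The circles which do not pass by `c` correspond to each other and have the same labels; the sums
differ only in the labels of the two merging circles and of the resulting one. -/
theorem Merges.sum_labelDegree {S S' : KauffmanState n} {c : Fin n} (h : D.Merges S S' c)
    {f : D.Circle S → Bool} {f' : D.Circle S' → Bool}
    (hf : ∀ z, ¬ D.Linked S.toPartial z (.inl (c, 0)) → ¬ D.Linked S.toPartial z (.inl (c, 2)) →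
      label f' z = label f z) :
    (∑ x, labelDegree (f x)) + labelDegree (label f' (.inl (c, 0))) =
      (∑ x, labelDegree (f' x)) + labelDegree (label f (.inl (c, 0))) +
        labelDegree (label f (.inl (c, 2))) := by
  classical
  set a := D.comp S.toPartial (.inl (c, 0))
  set b := D.comp S.toPartial (.inl (c, 2))
  set a' := D.comp S'.toPartial (.inl (c, 0))
  have hab : a ≠ b := h.1
  have hrest : ∑ x ∈ (Finset.univ.erase a).erase b, labelDegree (f x) =
      ∑ x ∈ Finset.univ.erase a', labelDegree (f' x) := by
    have hsec := fun x => (D.comp_surjective S.toPartial x).choose_spec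
    set sec : D.Circle S → D.Point := fun x => (D.comp_surjective S.toPartial x).choose
    have hne : ∀ x ∈ (Finset.univ.erase a).erase b,
        ¬ D.Linked S.toPartial (sec x) (.inl (c, 0)) ∧
        ¬ D.Linked S.toPartial (sec x) (.inl (c, 2)) := by
      intro x hx
      simp only [Finset.mem_erase, Finset.mem_univ, and_true] at hx
      exact ⟨fun h0 => hx.2 ((hsec x).symm.trans h0), fun h0 => hx.1 ((hsec x).symm.trans h0)⟩
    refine Finset.sum_bij (fun x _ => D.comp S'.toPartial (sec x)) ?_ ?_ ?_ ?_
    · intro x hx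
      simp only [Finset.mem_erase, Finset.mem_univ, and_true]
      intro h0
      rcases (h.linked_left_iff _).mp h0 with h1 | h1
      · exact (hne x hx).1 h1
      · exact (hne x hx).2 h1
    · intro x hx y hy hxy
      have := (h.linked_iff_of_not (hne y hy).1 (hne y hy).2 (sec x)).mp hxy
      rw [← hsec x, ← hsec y]
      exact this
    · intro y hy
      obtain ⟨z, rfl⟩ := D.comp_surjective _ y
      simp only [Finset.mem_erase, Finset.mem_univ, and_true] at hy
      have hz : ¬ (D.Linked S.toPartial z (.inl (c, 0)) ∨
        D.Linked S.toPartial z (.inl (c, 2))) := fun h0 => hy ((h.linked_left_iff z).mpr h0)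
      rw [not_or] at hz
      refine ⟨D.comp S.toPartial z, ?_, h.mono (hsec _)⟩
      simp only [Finset.mem_erase, Finset.mem_univ, and_true]
      exact ⟨hz.2, hz.1⟩
    · intro x hx
      have := hf (sec x) (hne x hx).1 (hne x hx).2
      unfold label at this
      rw [this, hsec x]
  have h1 := Finset.add_sum_erase Finset.univ (fun x => labelDegree (f x)) (Finset.mem_univ a)
  have h2 := Finset.add_sum_erase (Finset.univ.erase a) (fun x => labelDegree (f x))
    (Finset.mem_erase.mpr ⟨hab.symm, Finset.mem_univ b⟩)
  have h3 := Finset.add_sum_erase Finset.univ (fun x => labelDegree (f' x)) (Finset.mem_univ a')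
  rw [← h1, ← h2, ← h3, hrest]
  change _ + labelDegree (f' a') = _ + labelDegree (f a) + labelDegree (f b)
  ring

theorem labelDegree_mul {a b x : Bool} (h : mulCoeff a b x ≠ 0) :
    labelDegree x = labelDegree a + labelDegree b - 1 := by
  cases a <;> cases b <;> cases x <;> simp [mulCoeff, labelDegree] at h ⊢

theorem labelDegree_comul {x a b : Bool} (h : comulCoeff x a b ≠ 0) :
    labelDegree a + labelDegree b = labelDegree x - 1 := by
  cases a <;> cases b <;> cases x <;> simp [comulCoeff, labelDegree] at h ⊢

theorem exists_of_incidence_ne_zero {E E' : D.EnhancedState} (h : D.incidence E E' ≠ 0) :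
    ∃ c, E.1 c = false ∧ E'.1 = Function.update E.1 c true ∧ D.edgeCoeff c E E' ≠ 0 := by
  obtain ⟨c, _, hc⟩ := Finset.exists_ne_zero_of_sum_ne_zero h
  split_ifs at hc with h'
  · exact ⟨c, h'.1, h'.2, right_ne_zero_of_mul hc⟩
  · exact absurd rfl hc

theorem incidence_eq_of_update {E E' : D.EnhancedState} {c : Fin n} (hc : E.1 c = false)
    (h : E'.1 = Function.update E.1 c true) :
    D.incidence E E' = signBefore E.1 c * D.edgeCoeff c E E' := by
  rw [incidence_eq, Finset.sum_eq_single_of_mem c (Finset.mem_univ c), if_pos ⟨hc, h⟩]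
  intro d _ hd
  refine if_neg fun h' => ?_
  have := congrFun (h.symm.trans h'.2) c
  rw [Function.update_self, Function.update_of_ne hd.symm, hc] at this
  exact absurd this (by simp)

theorem primaryDegree_of_update {E E' : D.EnhancedState} {c : Fin n} (hc : E.1 c = false)
    (h : E'.1 = Function.update E.1 c true) :
    D.primaryDegree E' = D.primaryDegree E + 1 := by
  rw [primaryDegree, primaryDegree, h, numOne_update hc]
  simp

theorem IsAlternating.degree_of_incidence_ne_zero {s : StrandEnd n → Bool}
    (hs : D.IsAlternating s) {E E' : D.EnhancedState} (h : D.incidence E E' ≠ 0) :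
    D.primaryDegree E' = D.primaryDegree E + 1 ∧ D.secondaryDegree E' = D.secondaryDegree E := by
  classical
  obtain ⟨c, hc, hE', hne⟩ := exists_of_incidence_ne_zero h
  refine ⟨primaryDegree_of_update hc hE', ?_⟩
  obtain ⟨S, f⟩ := E
  obtain ⟨S', f'⟩ := E'
  obtain rfl : S' = Function.update S c true := hE'
  rw [secondaryDegree_eq, secondaryDegree_eq, numOne_update hc]
  rcases hs.merges_or_merges (S := S) (S' := Function.update S c true) (c := c)
    (by simp [show S c = false from hc]) (fun d hd => Function.update_of_ne hd _ _) with hm | hm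
  · rw [edgeCoeff_of_merges hm] at hne
    split_ifs at hne with hf
    · have h1 := hm.sum_labelDegree hf
      have h2 := labelDegree_mul hne
      push_cast
      linarith
    · exact absurd rfl hne
  · rw [edgeCoeff_of_splits hm] at hne
    split_ifs at hne with hf
    · have h1 := hm.sum_labelDegree (f := f') (f' := f) fun z h0 h2 =>
        (hf z fun hz => ((hm.linked_left_iff z).mp hz).elim h0 h2).symm
      have h2 := labelDegree_comul hne
      push_cast
      linarith
    · exact absurd rfl hne

theorem khovanovD_apply (D : PDCode n) (i j : ℤ) (x : D.BasisAt i j →₀ ℤ)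
    (E' : D.BasisAt (i + 1) j) :
    ((D.khovanovD i j).hom x : D.BasisAt (i + 1) j →₀ ℤ) E' =
      ∑ E : D.BasisAt i j, x E * D.incidence E.1 E'.1 := by
  classical
  change (Finsupp.linearCombination ℤ (fun E : D.BasisAt i j =>
    ∑ E' : D.BasisAt (i + 1) j, Finsupp.single E' (D.incidence E.1 E'.1)) x) E' = _
  rw [Finsupp.linearCombination_apply, Finsupp.sum_fintype _ _ (by simp), Finsupp.finsetSum_apply]
  refine Finset.sum_congr rfl fun E _ => ?_
  rw [Finsupp.smul_apply, Finsupp.finsetSum_apply]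
  simp [Finsupp.single_apply]

/-- The sum over the states of the intermediate bidegree is the sum over all states, since the other
states have incidence `0`. -/
theorem IsAlternating.khovanovD_comp {s : StrandEnd n → Bool} (hs : D.IsAlternating s) (i j : ℤ) :
    D.khovanovD i j ≫ D.khovanovD (i + 1) j = 0 := by
  classical
  refine ModuleCat.hom_ext (LinearMap.ext fun x => Finsupp.ext fun E'' => ?_)
  change ((D.khovanovD (i + 1) j).hom ((D.khovanovD i j).hom x) :
    D.BasisAt (i + 1 + 1) j →₀ ℤ) E'' = 0
  rw [khovanovD_apply]
  refine (Finset.sum_congr rfl fun E' _ =>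
    congrArg (· * D.incidence E'.1 E''.1) (khovanovD_apply D i j x E')).trans ?_
  simp only [Finset.sum_mul]
  rw [Finset.sum_comm]
  refine Finset.sum_eq_zero fun E _ => ?_
  have h : ∑ E' : D.BasisAt (i + 1) j, D.incidence E.1 E'.1 * D.incidence E'.1 E''.1 =
      ∑ E', D.incidence E.1 E' * D.incidence E' E''.1 := by
    rw [← Finset.sum_filter_of_ne
      (p := fun E' => D.primaryDegree E' = i + 1 ∧ D.secondaryDegree E' = j)]
    · exact (Finset.sum_subtype _ (by simp) fun E' =>
        D.incidence E.1 E' * D.incidence E' E''.1).symm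
    · intro E' _ h0
      obtain ⟨h1, h2⟩ := hs.degree_of_incidence_ne_zero (left_ne_zero_of_mul h0)
      rw [E.2.1] at h1
      rw [E.2.2] at h2
      exact ⟨h1, h2⟩
  simp only [mul_assoc]
  rw [← Finset.mul_sum, h, hs.sum_incidence_mul, mul_zero]

end PDCode

/-! ### The leaves of the binary tree -/

namespace PDCode

variable {n : ℕ} {D : PDCode n}

theorem ConnectedAt.of_refines {P P' : PartialSmoothing n} (hP : ∀ c, P c = none ∨ P' c = P c)
    (h : D.ConnectedAt P') : D.ConnectedAt P := by
  rw [connectedAt_iff] at h ⊢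
  exact ⟨fun z w => (h.1 z w).of_refines hP, h.2⟩

variable (D) in
/-- A connected smoothened diagram all of whose crossings are nugatory: one of the two smoothings
of each of them is not connected. -/
def IsLeaf (P : PartialSmoothing n) : Prop :=
  D.ConnectedAt P ∧ ∀ c, P c = none → ∃ b, ¬ D.ConnectedAt (Function.update P c (some b))

theorem descend_refines (S : KauffmanState n) {cs : List (Fin n)}
    {P : PartialSmoothing n} (hP : ∀ c ∈ cs, P c = none) (c : Fin n) :
    P c = none ∨ D.descend S cs P c = P c := by
  by_cases hc : c ∈ cs
  · exact .inl (hP c hc)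
  · exact .inr (D.treeNodes_keep cs P _ (D.descend_mem S cs P) c hc)

theorem connectedAt_descend (S : KauffmanState n) (cs : List (Fin n)) {P : PartialSmoothing n}
    (hP : D.ConnectedAt P) : D.ConnectedAt (D.descend S cs P) := by
  induction cs generalizing P with
  | nil => exact hP
  | cons c cs ih =>
    by_cases h : D.Branches P c
    · simp only [descend, h, if_true]
      exact ih (h _)
    · simp only [descend, h, if_false]
      exact ih hP

/-- A crossing is left unsmoothened because one of its smoothings was not connected at that stage;
further smoothings do not reconnect it. -/
theorem exists_not_connectedAt_descend (S : KauffmanState n) {cs : List (Fin n)} (hcs : cs.Nodup)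
    {P : PartialSmoothing n} (hP : ∀ c ∈ cs, P c = none) {c : Fin n} (hc : c ∈ cs)
    (hnone : D.descend S cs P c = none) :
    ∃ b, ¬ D.ConnectedAt (Function.update (D.descend S cs P) c (some b)) := by
  induction cs generalizing P with
  | nil => simp at hc
  | cons a cs ih =>
    rw [List.nodup_cons] at hcs
    have hP' : ∀ d ∈ cs, P d = none := fun d hd => hP d (List.mem_cons_of_mem _ hd)
    by_cases h : D.Branches P a
    · simp only [descend, h, if_true] at hnone ⊢
      have hca : c ≠ a := by
        rintro rfl
        rw [D.treeNodes_keep cs _ _ (D.descend_mem S cs _) c hcs.1, Function.update_self] at hnone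
        exact absurd hnone (by simp)
      refine ih hcs.2 (fun d hd => ?_) ((List.mem_cons.mp hc).resolve_left hca) hnone
      rw [Function.update_of_ne (fun h0 : d = a => hcs.1 (h0 ▸ hd))]
      exact hP' d hd
    · simp only [descend, h, if_false] at hnone ⊢
      rcases List.mem_cons.mp hc with rfl | hc'
      · simp only [Branches, not_forall] at h
        obtain ⟨b, hb⟩ := h
        refine ⟨b, fun hcon => hb (hcon.of_refines fun d => ?_)⟩
        by_cases hd : d = c
        · subst hd; simp
        · rw [Function.update_of_ne hd, Function.update_of_ne hd]
          exact descend_refines S hP' d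
      · exact ih hcs.2 hP' hc' hnone

theorem isLeaf_leafOf (hD : D.IsConnected) (S : KauffmanState n) : D.IsLeaf (D.leafOf S) :=
  ⟨connectedAt_descend S _ hD, fun c hc => exists_not_connectedAt_descend S
    (List.nodup_finRange n) (fun _ _ => rfl) (List.mem_finRange c) hc⟩

theorem isStateOf_leafOf (S : KauffmanState n) : IsStateOf S (D.leafOf S) :=
  ((D.leafOf_unique S _).mpr rfl).2

theorem leafOf_eq_of_isStateOf {S S' : KauffmanState n} (h : IsStateOf S' (D.leafOf S)) :
    D.leafOf S' = D.leafOf S :=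
  ((D.leafOf_unique S' _).mp ⟨((D.leafOf_unique S _).mpr rfl).1, h⟩).symm

theorem isStateOf_update {S : KauffmanState n} {P : PartialSmoothing n} (h : IsStateOf S P)
    {c : Fin n} (hc : P c = none) (b : Bool) : IsStateOf (Function.update S c b) P := by
  intro d b' hd
  have : d ≠ c := by
    rintro rfl
    rw [hc] at hd
    exact absurd hd (by simp)
  rw [Function.update_of_ne this]
  exact h d b' hd

theorem descend_append (S : KauffmanState n) (l₁ l₂ : List (Fin n)) (P : PartialSmoothing n) :
    D.descend S (l₁ ++ l₂) P = D.descend S l₂ (D.descend S l₁ P) := by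
  induction l₁ generalizing P with
  | nil => rfl
  | cons c cs ih =>
    by_cases h : D.Branches P c <;> simp only [List.cons_append, descend, h, if_true, if_false, ih]

theorem descend_congr {S S' : KauffmanState n} {cs : List (Fin n)} (h : ∀ c ∈ cs, S c = S' c)
    (P : PartialSmoothing n) : D.descend S cs P = D.descend S' cs P := by
  induction cs generalizing P with
  | nil => rfl
  | cons c cs ih =>
    simp only [descend, h c List.mem_cons_self,
      ih fun d hd => h d (List.mem_cons_of_mem _ hd)]

/-- The position of a leaf: the `1`-smoothings among the decisions that lead to it, ordered
lexicographically. -/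
def leafKey (P : PartialSmoothing n) : Lex (Fin n → Bool) := toLex fun c => decide (P c = some true)

/-- The differential does not go back to an earlier leaf: the paths to the two leaves agree before
`c`, and branch at `c`. -/
theorem leafKey_lt {S : KauffmanState n} {c : Fin n} (hc : S c = false)
    (h : D.leafOf (Function.update S c true) ≠ D.leafOf S) :
    leafKey (D.leafOf S) < leafKey (D.leafOf (Function.update S c true)) := by
  have hnone : D.leafOf S c ≠ none := fun h0 => h
    (leafOf_eq_of_isStateOf (isStateOf_update (isStateOf_leafOf S) h0 true))
  obtain ⟨l₁, l₂, hl⟩ := List.append_of_mem (List.mem_finRange c)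
  have hnodup := List.nodup_finRange n
  have hsorted := List.pairwise_lt_finRange n
  rw [hl] at hnodup hsorted
  have hc₁ : c ∉ l₁ := fun h0 => (List.nodup_append.mp hnodup).2.2 c h0 c List.mem_cons_self rfl
  have hc₂ : ∀ d ∈ l₂, c < d := fun d hd =>
    (List.pairwise_cons.mp (List.pairwise_append.mp hsorted).2.1).1 d hd
  have hQ : D.descend (Function.update S c true) l₁ (fun _ => none) =
      D.descend S l₁ (fun _ => none) := descend_congr (fun d hd =>
    Function.update_of_ne (fun h0 : d = c => hc₁ (h0 ▸ hd)) _ _) _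
  unfold leafOf at hnone ⊢
  rw [hl, descend_append] at hnone
  rw [hl, descend_append, descend_append, hQ]
  have hQc := D.treeNodes_keep l₁ _ _ (D.descend_mem S l₁ fun _ => none) c hc₁
  set Q := D.descend S l₁ fun _ => none
  have hkeep : ∀ (S' : KauffmanState n) (P : PartialSmoothing n) (d : Fin n), ¬ c < d →
      D.descend S' l₂ P d = P d := fun S' P d hd =>
    D.treeNodes_keep l₂ _ _ (D.descend_mem S' l₂ P) d fun h0 => hd (hc₂ d h0)
  by_cases hB : D.Branches Q c
  · simp only [descend, hB, if_true]
    refine ⟨c, fun d hd => ?_, ?_⟩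
    · change decide (D.descend _ _ _ d = _) = decide (D.descend _ _ _ d = _)
      rw [hkeep _ _ d (not_lt_of_gt hd), hkeep _ _ d (not_lt_of_gt hd),
        Function.update_of_ne hd.ne, Function.update_of_ne hd.ne]
    · change decide (D.descend _ _ _ c = _) < decide (D.descend _ _ _ c = _)
      rw [hkeep _ _ c (lt_irrefl c), hkeep _ _ c (lt_irrefl c), Function.update_self,
        Function.update_self, Function.update_self, hc]
      decide
  · simp only [descend, hB, if_false] at hnone
    rw [hkeep _ _ c (lt_irrefl c)] at hnone
    exact absurd hQc hnone

/-! ### The states of a leaf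

The circles of a state of a leaf form a tree: the root is the circle through a base point `z₀`, and
each crossing at which the state uses the disconnecting smoothing is an edge of the tree. -/

variable (D) in
open Classical in
/-- The disconnecting smoothing of a crossing of a leaf. -/
noncomputable def badSmoothing (P : PartialSmoothing n) (c : Fin n) : Bool :=
  decide (¬ D.ConnectedAt (Function.update P c (some true)))

variable (D) in
/-- The leaf `P` with the disconnecting smoothing at `c`. -/
noncomputable def cut (P : PartialSmoothing n) (c : Fin n) : PartialSmoothing n :=
  Function.update P c (some (D.badSmoothing P c))

variable {P : PartialSmoothing n}

theorem cut_of_ne (P : PartialSmoothing n) {c d : Fin n} (h : d ≠ c) : D.cut P c d = P d :=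
  Function.update_of_ne h _ _

theorem through_cut_of_ne (P : PartialSmoothing n) {c : Fin n} {x : StrandEnd n} (h : x.1 ≠ c) :
    (D.cut P c).through x = P.through x := through_update_of_ne h

theorem IsLeaf.linked (hP : D.IsLeaf P) (z w : D.Point) : D.Linked P z w :=
  (connectedAt_iff.mp hP.1).1 z w

theorem IsLeaf.not_linked_cut (hP : D.IsLeaf P) {c : Fin n} (hc : P c = none) :
    ¬ D.Linked (D.cut P c) (.inl (c, 0)) (.inl (c, 2)) := by
  have hbad : ¬ D.ConnectedAt (D.cut P c) := by
    unfold cut badSmoothing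
    by_cases h : D.ConnectedAt (Function.update P c (some true))
    · obtain ⟨b, hb⟩ := hP.2 c hc
      have : b = false := by
        by_contra h0
        rw [Bool.not_eq_false] at h0
        exact hb (h0 ▸ h)
      simpa [h, this] using hb
    · simp [h]
  intro h
  refine hbad (connectedAt_iff.mpr ⟨fun z w => ?_, ⟨.inl (c, 0)⟩⟩)
  have hall : ∀ z, D.Linked (D.cut P c) (.inl (c, 0)) z := fun z =>
    (linked_or_linked_of_connected hP.linked _ z).elim id h.trans
  exact (hall z).symm.trans (hall w)

variable (D) in
open Classical in
/-- Which of the ends `(c, 0)` and `(c, 2)` lies on the side of the base point. -/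
noncomputable def upperEnd (P : PartialSmoothing n) (z₀ : D.Point) (c : Fin n) : D.Point :=
  if D.Linked (D.cut P c) z₀ (.inl (c, 0)) then .inl (c, 0) else .inl (c, 2)

variable (D) in
open Classical in
/-- Which of the ends `(c, 0)` and `(c, 2)` is cut off from the base point. -/
noncomputable def lowerEnd (P : PartialSmoothing n) (z₀ : D.Point) (c : Fin n) : D.Point :=
  if D.Linked (D.cut P c) z₀ (.inl (c, 0)) then .inl (c, 2) else .inl (c, 0)

variable {z₀ : D.Point}

theorem ends_cases (P : PartialSmoothing n) (z₀ : D.Point) (c : Fin n) :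
    (D.lowerEnd P z₀ c = .inl (c, 0) ∧ D.upperEnd P z₀ c = .inl (c, 2)) ∨
    (D.lowerEnd P z₀ c = .inl (c, 2) ∧ D.upperEnd P z₀ c = .inl (c, 0)) := by
  unfold lowerEnd upperEnd
  split_ifs
  · exact .inr ⟨rfl, rfl⟩
  · exact .inl ⟨rfl, rfl⟩

theorem IsLeaf.linked_cut_upperEnd (hP : D.IsLeaf P) (z₀ : D.Point) (c : Fin n) :
    D.Linked (D.cut P c) z₀ (D.upperEnd P z₀ c) := by
  unfold upperEnd
  split_ifs with h
  · exact h
  · exact ((linked_or_linked_of_connected hP.linked _ z₀).resolve_left fun h0 => h h0.symm).symm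

theorem IsLeaf.not_linked_cut_lowerEnd (hP : D.IsLeaf P) (z₀ : D.Point) {c : Fin n}
    (hc : P c = none) : ¬ D.Linked (D.cut P c) z₀ (D.lowerEnd P z₀ c) := by
  unfold lowerEnd
  split_ifs with h
  · exact fun h0 => hP.not_linked_cut hc (h.symm.trans h0)
  · exact h

theorem linked_ends_of_ne {c c' : Fin n} (hc : P c = none) (hcc : c ≠ c') :
    D.Linked (D.cut P c') (D.lowerEnd P z₀ c) (D.upperEnd P z₀ c) := by
  have h0 : D.cut P c' c = none := by rw [cut_of_ne P hcc, hc]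
  rcases ends_cases P z₀ c with h | h <;> rw [h.1, h.2] <;> exact linked_crossing h0 rfl

/-- If the crossing `c` lies below `c'`, then the part above `c'` is contained in the part above
`c`. -/
theorem linked_cut_of_linked_cut {c c' : Fin n} (hc : P c = none) (hc' : P c' = none) (hcc : c ≠ c')
    (h : ¬ D.Linked (D.cut P c') z₀ (D.lowerEnd P z₀ c)) {z : D.Point}
    (hz : D.Linked (D.cut P c') z₀ z) : D.Linked (D.cut P c) z₀ z := by
  have hne : ∀ x : StrandEnd n, D.Linked (D.cut P c') z₀ (.inl x) → x.1 ≠ c := by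
    rintro x hx rfl
    refine h (hx.trans ?_)
    have h0 : D.cut P c' x.1 = none := by rw [cut_of_ne P hcc, hc]
    rcases ends_cases P z₀ x.1 with h | h <;> rw [h.1] <;> exact linked_crossing h0 rfl
  refine (hz.of_closed (p := fun z => D.Linked (D.cut P c') z₀ z ∧ D.Linked (D.cut P c) z₀ z)
    ?_ ?_ ?_ ⟨rfl, rfl⟩).2
  · exact fun x hx => ⟨hx.1.trans (linked_glue _ _), hx.2.trans (linked_glue _ _)⟩
  · intro x hx
    refine ⟨hx.1.trans (linked_through _ _), hx.2.trans ?_⟩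
    by_cases hxc : x.1 = c'
    · exact linked_crossing (by rw [hxc, cut_of_ne P hcc.symm, hc'])
        (through_fst _ _)
    · have h1 := linked_through (D := D) (D.cut P c) x
      rw [through_cut_of_ne P (hne x hx.1)] at h1
      rw [through_cut_of_ne P hxc]
      exact h1
  · intro x y h0 hy hx
    refine ⟨hx.1.trans (linked_crossing h0 hy), hx.2.trans (linked_crossing ?_ hy)⟩
    have hxc : x.1 ≠ c' := fun h1 => by
      rw [h1, cut, Function.update_self] at h0
      exact absurd h0 (by simp)
    rw [cut_of_ne P hxc] at h0
    rw [cut_of_ne P (hne x hx.1), h0]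

theorem isStateOf_refines {S : KauffmanState n} (hS : IsStateOf S P) (c : Fin n) :
    P c = none ∨ S.toPartial c = P c := by
  rcases h : P c with _ | b
  · exact .inl rfl
  · exact .inr (by rw [KauffmanState.toPartial, hS c b h])

section

variable {S : KauffmanState n}

theorem linked_cut_of_linked (hS : IsStateOf S P) {c : Fin n} (hSc : S c = D.badSmoothing P c)
    {z w : D.Point} (h : D.Linked S.toPartial z w) : D.Linked (D.cut P c) z w := by
  refine h.of_refines fun d => ?_
  by_cases hd : d = c
  · subst hd
    exact .inr (by rw [KauffmanState.toPartial, hSc, cut, Function.update_self])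
  · rw [cut_of_ne P hd]
    exact isStateOf_refines hS d

theorem IsLeaf.not_linked_ends (hP : D.IsLeaf P) (hS : IsStateOf S P)
    {c : Fin n} (hc : P c = none) (hSc : S c = D.badSmoothing P c) :
    ¬ D.Linked S.toPartial (.inl (c, 0)) (.inl (c, 2)) :=
  fun h => hP.not_linked_cut hc (linked_cut_of_linked hS hSc h)

theorem IsLeaf.not_linked_base (hP : D.IsLeaf P) (hS : IsStateOf S P)
    (z₀ : D.Point) {c : Fin n} (hc : P c = none)
    (hSc : S c = D.badSmoothing P c) : ¬ D.Linked S.toPartial z₀ (D.lowerEnd P z₀ c) :=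
  fun h => hP.not_linked_cut_lowerEnd z₀ hc (linked_cut_of_linked hS hSc h)

/-- If the circle above the crossing `c` is the circle below `c'`, then the part above `c'` is
contained in the part above `c`. -/
theorem IsLeaf.linked_cut_of_linked_upperEnd (hP : D.IsLeaf P) (hS : IsStateOf S P)
    {c c' : Fin n} (hc : P c = none) (hc' : P c' = none)
    (hcc : c ≠ c') (hSc' : S c' = D.badSmoothing P c')
    (h : D.Linked S.toPartial (D.upperEnd P z₀ c) (D.lowerEnd P z₀ c')) :
    ¬ D.Linked (D.cut P c') z₀ (D.upperEnd P z₀ c) ∧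
    ∀ z, D.Linked (D.cut P c') z₀ z → D.Linked (D.cut P c) z₀ z := by
  have h1 : ¬ D.Linked (D.cut P c') z₀ (D.upperEnd P z₀ c) := fun h0 =>
    hP.not_linked_cut_lowerEnd z₀ hc' (h0.trans (linked_cut_of_linked hS hSc' h))
  exact ⟨h1, fun z => linked_cut_of_linked_cut hc hc' hcc
    fun h0 => h1 (h0.trans (linked_ends_of_ne hc hcc))⟩

/-- Different crossings lie above different circles: otherwise each of the two crossings would lie
below the other one. -/
theorem IsLeaf.not_linked_lowerEnd (hP : D.IsLeaf P) (hS : IsStateOf S P)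
    {c c' : Fin n} (hc : P c = none) (hc' : P c' = none)
    (hcc : c ≠ c') (hSc : S c = D.badSmoothing P c) (hSc' : S c' = D.badSmoothing P c') :
    ¬ D.Linked S.toPartial (D.lowerEnd P z₀ c) (D.lowerEnd P z₀ c') := by
  intro h
  have h1 : ¬ D.Linked (D.cut P c') z₀ (D.lowerEnd P z₀ c) := fun h0 =>
    hP.not_linked_cut_lowerEnd z₀ hc' (h0.trans (linked_cut_of_linked hS hSc' h))
  have h2 : ¬ D.Linked (D.cut P c) z₀ (D.lowerEnd P z₀ c') := fun h0 =>
    hP.not_linked_cut_lowerEnd z₀ hc (h0.trans (linked_cut_of_linked hS hSc h.symm))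
  have h3 := linked_cut_of_linked_cut hc' hc hcc.symm h2 (hP.linked_cut_upperEnd z₀ c)
  exact h1 (h3.trans (linked_ends_of_ne hc hcc).symm)

theorem IsLeaf.merges (hP : D.IsLeaf P) (hS : IsStateOf S P)
    {S' : KauffmanState n} {c : Fin n} (hc : P c = none)
    (hSc : S c = D.badSmoothing P c) (hS'c : S' c = !S c) (hSS' : ∀ d, d ≠ c → S' d = S d) :
    D.Merges S S' c := merges_of_not_linked hS'c hSS' (hP.not_linked_ends hS hc hSc)

/-- A state without disconnecting smoothings consists of one circle. -/
theorem IsLeaf.connectedAt_of_forall_ne (hP : D.IsLeaf P) (hS : IsStateOf S P)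
    (h : ∀ c, P c = none → S c ≠ D.badSmoothing P c) :
    D.ConnectedAt S.toPartial := by
  classical
  -- Smoothing one crossing after the other keeps the diagram connected, since the opposite
  -- smoothing disconnects the leaf, and all the more the diagram with further smoothings.
  have key : ∀ s : Finset (Fin n), D.ConnectedAt fun c => if c ∈ s then some (S c) else P c := by
    intro s
    induction s using Finset.induction_on with
    | empty => simpa using hP.1
    | insert c s hcs ih =>
      rcases hc : P c with _ | b
      · have hb : S c = !D.badSmoothing P c := by
          have := h c hc
          cases h1 : S c <;> cases h2 : D.badSmoothing P c <;> simp_all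
        rw [connectedAt_iff] at ih ⊢
        refine ⟨?_, ih.2⟩
        have e : (fun d => if d ∈ insert c s then some (S d) else P d) =
            Function.update (fun d => if d ∈ s then some (S d) else P d) c
              (some !D.badSmoothing P c) := by
          funext d
          by_cases hd : d = c
          · subst hd; simp [hb]
          · simp [hd]
        have hcut : ¬ D.Linked (Function.update (fun d => if d ∈ s then some (S d) else P d) c
            (some (D.badSmoothing P c))) (.inl (c, 0)) (.inl (c, 2)) := by
          refine fun h0 => hP.not_linked_cut hc (h0.of_refines fun d => ?_)
          by_cases hd : d = c
          · subst hd; simp [cut]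
          · rw [cut_of_ne P hd, Function.update_of_ne hd]
            split_ifs
            · exact isStateOf_refines hS d
            · exact .inr rfl
        have hflip := linked_flip hcut
        rw [e]
        have hall : ∀ z, D.Linked (Function.update (fun d => if d ∈ s then some (S d) else P d) c
            (some !D.badSmoothing P c)) (.inl (c, 0)) z := fun z =>
          (linked_or_linked_of_connected ih.1 _ z).elim id hflip.trans
        exact fun z w => (hall z).symm.trans (hall w)
      · suffices e : (fun d => if d ∈ insert c s then some (S d) else P d) =
            fun d => if d ∈ s then some (S d) else P d by rw [e]; exact ih
        funext d
        by_cases hd : d = c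
        · subst hd
          simp [hcs, hc, hS d b hc]
        · simp [hd]
  have e : (fun c => if c ∈ Finset.univ then some (S c) else P c) = S.toPartial := by
    funext c
    simp [KauffmanState.toPartial]
  exact e ▸ key Finset.univ

/-- Every circle is the root or lies below a crossing with the disconnecting smoothing. -/
theorem IsLeaf.exists_linked (hP : D.IsLeaf P) (hS : IsStateOf S P) (z₀ z : D.Point) :
    D.Linked S.toPartial z z₀ ∨ ∃ c, P c = none ∧ S c = D.badSmoothing P c ∧
      D.Linked S.toPartial z (D.lowerEnd P z₀ c) := by
  classical
  obtain ⟨k, hk⟩ : ∃ k, (Finset.univ.filter fun c =>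
    P c = none ∧ S c = D.badSmoothing P c).card = k := ⟨_, rfl⟩
  induction k generalizing S z with
  | zero =>
    refine .inl ((connectedAt_iff.mp (hP.connectedAt_of_forall_ne hS fun c hc hSc => ?_)).1 _ _)
    rw [Finset.card_eq_zero] at hk
    have : c ∈ (∅ : Finset (Fin n)) := hk ▸ by simp [hc, hSc]
    simp at this
  | succ k ih =>
    obtain ⟨c, hc⟩ := Finset.card_pos.mp (by rw [hk]; exact Nat.succ_pos k)
    obtain ⟨hPc, hSc⟩ := (Finset.mem_filter.mp hc).2
    have hcard : (Finset.univ.filter fun d => P d = none ∧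
        Function.update S c (!S c) d = D.badSmoothing P d).card = k := by
      have : (Finset.univ.filter fun d => P d = none ∧
          Function.update S c (!S c) d = D.badSmoothing P d) =
          (Finset.univ.filter fun d => P d = none ∧ S d = D.badSmoothing P d).erase c := by
        ext d
        by_cases hd : d = c
        · subst hd
          simp [← hSc]
        · simp [hd]
      rw [this, Finset.card_erase_of_mem hc, hk]
      rfl
    have hm := hP.merges hS (S' := Function.update S c (!S c)) hPc hSc (by simp)
      fun d hd => Function.update_of_ne hd _ _
    -- Merging the circle below `c` with the one above leaves one disconnecting smoothing less.
    have main : ∀ w, D.Linked (KauffmanState.toPartial (Function.update S c (!S c))) z w →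
        ¬ D.Linked S.toPartial w (D.lowerEnd P z₀ c) →
        D.Linked S.toPartial z w ∨ D.Linked S.toPartial z (D.lowerEnd P z₀ c) := by
      intro w hzw hw
      rcases (hm.2 z w).mp hzw with h0 | h0 | h0
      · exact .inl h0
      · rcases ends_cases P z₀ c with h1 | h1
        · rw [h1.1]
          exact .inr h0.1
        · rw [h1.1] at hw
          exact absurd h0.2 hw
      · rcases ends_cases P z₀ c with h1 | h1
        · rw [h1.1] at hw
          exact absurd h0.2 hw
        · rw [h1.1]
          exact .inr h0.1
    rcases ih (isStateOf_update hS hPc _) z hcard with h0 | ⟨d, hd, hSd, h0⟩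
    · rcases main _ h0 (hP.not_linked_base hS z₀ hPc hSc) with h1 | h1
      · exact .inl h1
      · exact .inr ⟨c, hPc, hSc, h1⟩
    · have hdc : d ≠ c := by
        rintro rfl
        rw [Function.update_self, ← hSc] at hSd
        exact absurd hSd (by simp)
      rw [Function.update_of_ne hdc] at hSd
      rcases main _ h0 (hP.not_linked_lowerEnd hS hd hPc hdc hSd hSc) with h1 | h1
      · exact .inr ⟨d, hd, hSd, h1⟩
      · exact .inr ⟨c, hPc, hSc, h1⟩

end

end PDCode

/-! ### Coordinates on the states of a leaf -/

namespace PDCode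

variable {n : ℕ} {D : PDCode n} {P : PartialSmoothing n} {z₀ : D.Point}

variable (D) in
open Classical in
/-- The label carried by a crossing `c` of a leaf: the label of the circle below `c` if there is
one, that is, if the smoothing at `c` is disconnecting. Otherwise there is no such circle, and the
label is defined to be `!badSmoothing P c`. With this convention, all labels are kept when a circle
below `c` with the label `!badSmoothing P c` merges into the circle above, or splits off. -/
noncomputable def treeLabel (P : PartialSmoothing n) (z₀ : D.Point) (E : D.EnhancedState)
    (c : Fin n) : Bool :=
  if E.1 c = D.badSmoothing P c then label E.2 (D.lowerEnd P z₀ c) else !D.badSmoothing P c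

theorem treeLabel_of_eq {E : D.EnhancedState} {c : Fin n} (h : E.1 c = D.badSmoothing P c) :
    D.treeLabel P z₀ E c = label E.2 (D.lowerEnd P z₀ c) := if_pos h

theorem treeLabel_of_ne {E : D.EnhancedState} {c : Fin n} (h : E.1 c ≠ D.badSmoothing P c) :
    D.treeLabel P z₀ E c = !D.badSmoothing P c := if_neg h

/-- A state of a leaf is determined by its smoothings, the label of the root and the labels of the
crossings. -/
theorem IsLeaf.ext (hP : D.IsLeaf P) (z₀ : D.Point) {E E' : D.EnhancedState}
    (hE : IsStateOf E.1 P) (hS : E.1 = E'.1) (h0 : label E.2 z₀ = label E'.2 z₀)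
    (h : ∀ c, P c = none → D.treeLabel P z₀ E c = D.treeLabel P z₀ E' c) : E = E' := by
  obtain ⟨S, f⟩ := E
  obtain ⟨S', f'⟩ := E'
  obtain rfl : S = S' := hS
  congr 1
  refine label_ext fun z => ?_
  rcases hP.exists_linked hE z₀ z with hz | ⟨c, hc, hSc, hz⟩
  · rw [label_congr f hz, label_congr f' hz]
    exact h0
  · have := h c hc
    rw [treeLabel_of_eq (E := ⟨S, f⟩) hSc, treeLabel_of_eq (E := ⟨S, f'⟩) hSc] at this
    rw [label_congr f hz, label_congr f' hz]
    exact this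

/-- The label of the root and the labels of the crossings with the disconnecting smoothing can be
prescribed. -/
theorem IsLeaf.exists_labels (hP : D.IsLeaf P) (z₀ : D.Point) {S : KauffmanState n}
    (hS : IsStateOf S P) (r : Bool) (t : Fin n → Bool)
    (ht : ∀ c, P c = none → S c ≠ D.badSmoothing P c → t c = !D.badSmoothing P c) :
    ∃ f : D.Circle S → Bool, label f z₀ = r ∧
      ∀ c, P c = none → D.treeLabel P z₀ ⟨S, f⟩ c = t c := by
  classical
  let p : D.Circle S → Fin n → Prop := fun x c => P c = none ∧ S c = D.badSmoothing P c ∧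
    x = D.comp S.toPartial (D.lowerEnd P z₀ c)
  refine ⟨fun x => if x = D.comp S.toPartial z₀ then r else
    if h : ∃ c, p x c then t h.choose else false, ?_, fun c hc => ?_⟩
  · exact if_pos rfl
  · by_cases hSc : S c = D.badSmoothing P c
    · rw [treeLabel_of_eq hSc]
      have h1 : ∃ d, p (D.comp S.toPartial (D.lowerEnd P z₀ c)) d := ⟨c, hc, hSc, rfl⟩
      have h2 := h1.choose_spec
      have h3 : h1.choose = c := by
        by_contra hne
        exact hP.not_linked_lowerEnd hS h2.1 hc hne h2.2.1 hSc h2.2.2.symm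
      have h4 : D.comp S.toPartial (D.lowerEnd P z₀ c) ≠ D.comp S.toPartial z₀ := fun h0 =>
        hP.not_linked_base hS z₀ hc hSc h0.symm
      exact (if_neg h4).trans ((dif_pos h1).trans (congrArg t h3))
    · rw [treeLabel_of_ne hSc, ht c hc hSc]

section

variable {S S' : KauffmanState n} {c : Fin n} {f : D.Circle S → Bool} {f' : D.Circle S' → Bool}

theorem not_linked_ends_iff (P : PartialSmoothing n) (z₀ z : D.Point) (S : KauffmanState n)
    (c : Fin n) : (¬ D.Linked S.toPartial z (.inl (c, 0)) ∧
      ¬ D.Linked S.toPartial z (.inl (c, 2))) ↔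
    (¬ D.Linked S.toPartial z (D.lowerEnd P z₀ c) ∧
      ¬ D.Linked S.toPartial z (D.upperEnd P z₀ c)) := by
  rcases ends_cases P z₀ c with h | h <;> rw [h.1, h.2]
  exact and_comm

/-- When two circles merge at `c`, or one splits, the label of another crossing changes only if it
is the label of the circle above `c`. -/
theorem IsLeaf.treeLabel_eq_or (hP : D.IsLeaf P) (hS : IsStateOf S P) (hc : P c = none)
    (hSc : S c = D.badSmoothing P c) (hS'c : S' c = !S c) (hSS' : ∀ d, d ≠ c → S' d = S d)
    (hf : ∀ z, ¬ D.Linked S.toPartial z (.inl (c, 0)) → ¬ D.Linked S.toPartial z (.inl (c, 2)) →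
      label f' z = label f z) {d : Fin n} (hd : P d = none) (hdc : d ≠ c) :
    D.treeLabel P z₀ ⟨S', f'⟩ d = D.treeLabel P z₀ ⟨S, f⟩ d ∨
    S d = D.badSmoothing P d ∧
      D.Linked S.toPartial (D.upperEnd P z₀ c) (D.lowerEnd P z₀ d) ∧
      D.treeLabel P z₀ ⟨S, f⟩ d = label f (D.upperEnd P z₀ c) ∧
      D.treeLabel P z₀ ⟨S', f'⟩ d = label f' (D.upperEnd P z₀ c) := by
  by_cases hSd : S d = D.badSmoothing P d
  · have hS'd : S' d = D.badSmoothing P d := (hSS' d hdc).trans hSd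
    rw [treeLabel_of_eq (E := ⟨S, f⟩) hSd, treeLabel_of_eq (E := ⟨S', f'⟩) hS'd]
    by_cases h : D.Linked S.toPartial (D.upperEnd P z₀ c) (D.lowerEnd P z₀ d)
    · exact .inr ⟨hSd, h, label_congr f h.symm,
        label_congr f' ((hP.merges hS hc hSc hS'c hSS').mono h.symm)⟩
    · have := (not_linked_ends_iff P z₀ (D.lowerEnd P z₀ d) S c).mpr
        ⟨hP.not_linked_lowerEnd hS hd hc hdc hSd hSc, fun h0 => h h0.symm⟩
      exact .inl (hf _ this.1 this.2)
  · have hS'd : S' d ≠ D.badSmoothing P d := fun h => hSd ((hSS' d hdc).symm.trans h)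
    rw [treeLabel_of_ne (E := ⟨S, f⟩) hSd, treeLabel_of_ne (E := ⟨S', f'⟩) hS'd]
    exact .inl rfl

/-- The label of the root changes only if the root is the circle above `c`. -/
theorem IsLeaf.label_base_eq (hP : D.IsLeaf P) (hS : IsStateOf S P) (hc : P c = none)
    (hSc : S c = D.badSmoothing P c) (hS'c : S' c = !S c) (hSS' : ∀ d, d ≠ c → S' d = S d)
    (hf : ∀ z, ¬ D.Linked S.toPartial z (.inl (c, 0)) → ¬ D.Linked S.toPartial z (.inl (c, 2)) →
      label f' z = label f z)
    (h : label f' (D.upperEnd P z₀ c) = label f (D.upperEnd P z₀ c)) :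
    label f' z₀ = label f z₀ := by
  by_cases h0 : D.Linked S.toPartial z₀ (D.upperEnd P z₀ c)
  · rw [label_congr f h0, label_congr f' ((hP.merges hS hc hSc hS'c hSS').mono h0), h]
  · have := (not_linked_ends_iff P z₀ z₀ S c).mpr ⟨hP.not_linked_base hS z₀ hc hSc, h0⟩
    exact hf _ this.1 this.2

end

/-- If one label `v₋` moves away from `c`, either to a place of smaller weight or out of the sum,
then the total weight of the labels `v₋` decreases. -/
theorem sum_lt_sum_of_move {p : Fin n → Prop} [DecidablePred p] {w : Fin n → ℤ}
    {t t' : Fin n → Bool} {c : Fin n} (hc : p c) (hw : 0 < w c) (htc : t c = false)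
    (htc' : t' c = true)
    (h : ∀ d, p d → d ≠ c → t' d ≠ t d → t d = true ∧ t' d = false ∧ w d < w c)
    (huniq : ∀ d e, p d → p e → d ≠ c → e ≠ c → t' d ≠ t d → t' e ≠ t e → d = e) :
    ∑ d, (if p d ∧ t' d = false then w d else 0) < ∑ d, if p d ∧ t d = false then w d else 0 := by
  rw [← sub_pos, ← Finset.sum_sub_distrib]
  have hFc : (if p c ∧ t c = false then w c else 0) - (if p c ∧ t' c = false then w c else 0)
      = w c := by simp [hc, htc, htc']
  have hF : ∀ d, d ≠ c → ¬ (p d ∧ t' d ≠ t d) →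
      (if p d ∧ t d = false then w d else 0) - (if p d ∧ t' d = false then w d else 0) = 0 := by
    intro d _ hd
    by_cases hpd : p d
    · have : t' d = t d := by
        by_contra h0
        exact hd ⟨hpd, h0⟩
      rw [this, sub_self]
    · simp [hpd]
  by_cases hex : ∃ d, p d ∧ d ≠ c ∧ t' d ≠ t d
  · obtain ⟨d, hpd, hdc, hd⟩ := hex
    obtain ⟨h1, h2, h3⟩ := h d hpd hdc hd
    rw [Fintype.sum_eq_add c d hdc.symm, hFc]
    · simp [hpd, h1, h2, h3]
    · rintro e ⟨hec, hed⟩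
      exact hF e hec fun he => hed (huniq e d he.1 hpd hec hdc he.2 hd)
  · rw [Fintype.sum_eq_single c, hFc]
    · exact hw
    · exact fun d hdc => hF d hdc fun hd => hex ⟨d, hd.1, hdc, hd.2⟩

variable (D) in
/-- The size of the part of the diagram above the crossing `c`. -/
noncomputable def upperSize (P : PartialSmoothing n) (z₀ : D.Point) (c : Fin n) : ℤ :=
  Nat.card {z // D.Linked (D.cut P c) z₀ z}

variable (D) in
/-- How far the labels `v₋` are from the root: each of them counts with the size of the part of the
diagram above it. -/
noncomputable def height (P : PartialSmoothing n) (z₀ : D.Point) (E : D.EnhancedState) : ℤ :=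
  ∑ c, if P c = none ∧ D.treeLabel P z₀ E c = false then D.upperSize P z₀ c else 0

theorem upperSize_pos (P : PartialSmoothing n) (z₀ : D.Point) (c : Fin n) :
    0 < D.upperSize P z₀ c := by
  have : Nonempty {z // D.Linked (D.cut P c) z₀ z} := ⟨⟨z₀, rfl⟩⟩
  exact Nat.cast_pos.mpr Nat.card_pos

/-- If `c'` is the next crossing on the way from `c` to the root, then less lies above it. -/
theorem IsLeaf.upperSize_lt (hP : D.IsLeaf P) {S : KauffmanState n} (hS : IsStateOf S P)
    {c c' : Fin n} (hc : P c = none) (hc' : P c' = none) (hcc : c ≠ c')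
    (hSc' : S c' = D.badSmoothing P c')
    (h : D.Linked S.toPartial (D.upperEnd P z₀ c) (D.lowerEnd P z₀ c')) :
    D.upperSize P z₀ c' < D.upperSize P z₀ c := by
  obtain ⟨h1, h2⟩ := hP.linked_cut_of_linked_upperEnd hS hc hc' hcc hSc' h
  unfold upperSize
  rw [Nat.cast_lt]
  refine Set.ncard_lt_ncard (s := {z | D.Linked (D.cut P c') z₀ z})
    (t := {z | D.Linked (D.cut P c) z₀ z}) ?_ (Set.toFinite _)
  exact ⟨h2, fun h3 => h1 (h3 (hP.linked_cut_upperEnd z₀ c))⟩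

/-- A component of the differential within a leaf preserves the labels, or it moves a label `v₋`
from a crossing towards the root. -/
theorem IsLeaf.labels_eq_or_height_lt (hP : D.IsLeaf P) (z₀ : D.Point) {E E' : D.EnhancedState}
    (hE : IsStateOf E.1 P) {c : Fin n} (hc : P c = none) (hEc : E.1 c = false)
    (hE' : E'.1 = Function.update E.1 c true) (hne : D.edgeCoeff c E E' ≠ 0) :
    (label E'.2 z₀ = label E.2 z₀ ∧
      ∀ d, P d = none → D.treeLabel P z₀ E' d = D.treeLabel P z₀ E d) ∨
    D.height P z₀ E' < D.height P z₀ E := by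
  obtain ⟨S, f⟩ := E
  obtain ⟨S', f'⟩ := E'
  replace hE' : S' = Function.update S c true := hE'
  replace hEc : S c = false := hEc
  have hS' : IsStateOf S' P := hE' ▸ isStateOf_update hE hc true
  have hS'c : S' c = true := by rw [hE', Function.update_self]
  have hSS' : ∀ d, d ≠ c → S' d = S d := fun d hd => by rw [hE', Function.update_of_ne hd]
  cases hbad : D.badSmoothing P c
  -- Two circles merge, and the circle below `c` disappears.
  · have hSc : S c = D.badSmoothing P c := hEc.trans hbad.symm
    have hflip : S' c = !S c := by rw [hS'c, hEc]; rfl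
    have hm := hP.merges hE hc hSc hflip hSS'
    rw [edgeCoeff_of_merges hm] at hne
    split_ifs at hne with hf
    swap
    · exact absurd rfl hne
    have hx : D.Linked S'.toPartial (.inl (c, 0)) (D.upperEnd P z₀ c) := by
      rcases ends_cases P z₀ c with h | h <;> rw [h.2]
      · exact hm.linked
      · exact rfl
    rw [label_congr f' hx] at hne
    have tc : D.treeLabel P z₀ ⟨S, f⟩ c = label f (D.lowerEnd P z₀ c) := treeLabel_of_eq hSc
    have tc' : D.treeLabel P z₀ ⟨S', f'⟩ c = true := by
      rw [treeLabel_of_ne (by rw [hbad]; simp [hS'c]), hbad]; rfl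
    have hcases : (label f (D.lowerEnd P z₀ c) = true ∧
        label f' (D.upperEnd P z₀ c) = label f (D.upperEnd P z₀ c)) ∨
        (label f (D.lowerEnd P z₀ c) = false ∧ label f (D.upperEnd P z₀ c) = true ∧
          label f' (D.upperEnd P z₀ c) = false) := by
      generalize label f' (D.upperEnd P z₀ c) = x at hne ⊢
      rcases ends_cases P z₀ c with h | h <;> rw [h.1, h.2] <;> revert hne <;>
        generalize label f (.inl (c, 0)) = a <;> generalize label f (.inl (c, 2)) = b <;>
        revert a b x <;> decide
    rcases hcases with ⟨h1, h2⟩ | ⟨h1, h2, h3⟩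
    · refine .inl ⟨hP.label_base_eq hE hc hSc hflip hSS' hf h2, fun d hd => ?_⟩
      by_cases hdc : d = c
      · subst hdc
        rw [tc, tc', h1]
      · rcases hP.treeLabel_eq_or (z₀ := z₀) hE hc hSc hflip hSS' hf hd hdc with h | h
        · exact h
        · rw [h.2.2.1, h.2.2.2, h2]
    · right
      refine sum_lt_sum_of_move hc (upperSize_pos P z₀ c) (tc.trans h1) tc' ?_ ?_
      · intro d hd hdc hne
        have h := (hP.treeLabel_eq_or (z₀ := z₀) hE hc hSc hflip hSS' hf hd hdc).resolve_left hne
        exact ⟨h.2.2.1.trans h2, h.2.2.2.trans h3,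
          hP.upperSize_lt hE hc hd (Ne.symm hdc) h.1 h.2.1⟩
      · intro d e hd he hdc hec hned hnee
        have h := (hP.treeLabel_eq_or (z₀ := z₀) hE hc hSc hflip hSS' hf hd hdc).resolve_left hned
        have h' := (hP.treeLabel_eq_or (z₀ := z₀) hE hc hSc hflip hSS' hf he hec).resolve_left hnee
        by_contra hde
        exact hP.not_linked_lowerEnd hE hd he hde h.1 h'.1 (h.2.1.symm.trans h'.2.1)
  -- One circle splits, and the circle below `c` appears.
  · have hSc : S' c = D.badSmoothing P c := hS'c.trans hbad.symm
    have hflip : S c = !S' c := by rw [hS'c, hEc]; rfl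
    have hSS'' : ∀ d, d ≠ c → S d = S' d := fun d hd => (hSS' d hd).symm
    have hm := hP.merges hS' hc hSc hflip hSS''
    rw [edgeCoeff_of_splits hm] at hne
    split_ifs at hne with hf₀
    swap
    · exact absurd rfl hne
    have hf : ∀ z, ¬ D.Linked S'.toPartial z (.inl (c, 0)) →
        ¬ D.Linked S'.toPartial z (.inl (c, 2)) → label f z = label f' z := fun z h0 h2 =>
      (hf₀ z fun hz => ((hm.linked_left_iff z).mp hz).elim h0 h2).symm
    have hx : D.Linked S.toPartial (.inl (c, 0)) (D.upperEnd P z₀ c) := by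
      rcases ends_cases P z₀ c with h | h <;> rw [h.2]
      · exact hm.linked
      · exact rfl
    rw [label_congr f hx] at hne
    have tc' : D.treeLabel P z₀ ⟨S', f'⟩ c = label f' (D.lowerEnd P z₀ c) := treeLabel_of_eq hSc
    have tc : D.treeLabel P z₀ ⟨S, f⟩ c = false := by
      rw [treeLabel_of_ne (by rw [hbad]; simp [hEc]), hbad]; rfl
    have hcases : (label f' (D.lowerEnd P z₀ c) = false ∧
        label f (D.upperEnd P z₀ c) = label f' (D.upperEnd P z₀ c)) ∨
        (label f' (D.lowerEnd P z₀ c) = true ∧ label f (D.upperEnd P z₀ c) = true ∧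
          label f' (D.upperEnd P z₀ c) = false) := by
      generalize label f (D.upperEnd P z₀ c) = x at hne ⊢
      rcases ends_cases P z₀ c with h | h <;> rw [h.1, h.2] <;> revert hne <;>
        generalize label f' (.inl (c, 0)) = a <;> generalize label f' (.inl (c, 2)) = b <;>
        revert a b x <;> decide
    rcases hcases with ⟨h1, h2⟩ | ⟨h1, h2, h3⟩
    · refine .inl ⟨(hP.label_base_eq hS' hc hSc hflip hSS'' hf h2).symm, fun d hd => ?_⟩
      by_cases hdc : d = c
      · subst hdc
        rw [tc, tc', h1]
      · rcases hP.treeLabel_eq_or (z₀ := z₀) hS' hc hSc hflip hSS'' hf hd hdc with h | h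
        · exact h.symm
        · rw [h.2.2.1, h.2.2.2, h2]
    · right
      refine sum_lt_sum_of_move hc (upperSize_pos P z₀ c) tc (tc'.trans h1) ?_ ?_
      · intro d hd hdc hne
        have h := (hP.treeLabel_eq_or (z₀ := z₀) hS' hc hSc hflip hSS'' hf hd hdc).resolve_left
          (Ne.symm hne)
        exact ⟨h.2.2.2.trans h2, h.2.2.1.trans h3,
          hP.upperSize_lt hS' hc hd (Ne.symm hdc) h.1 h.2.1⟩
      · intro d e hd he hdc hec hned hnee
        have h := (hP.treeLabel_eq_or (z₀ := z₀) hS' hc hSc hflip hSS'' hf hd hdc).resolve_left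
          (Ne.symm hned)
        have h' := (hP.treeLabel_eq_or (z₀ := z₀) hS' hc hSc hflip hSS'' hf he hec).resolve_left
          (Ne.symm hnee)
        by_contra hde
        exact hP.not_linked_lowerEnd hS' hd he hde h.1 h'.1 (h.2.1.symm.trans h'.2.1)

/-- If the labels at the root and at the crossings agree, then all circles have the same labels,
    except
for the one below `c`. -/
theorem IsLeaf.label_eq_of_labels_eq (hP : D.IsLeaf P) {S S' : KauffmanState n}
    (hS : IsStateOf S P) {c : Fin n} (hc : P c = none) (hSc : S c = D.badSmoothing P c)
    (hS'c : S' c = !S c) (hSS' : ∀ d, d ≠ c → S' d = S d)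
    {f : D.Circle S → Bool} {f' : D.Circle S' → Bool} (h0 : label f' z₀ = label f z₀)
    (h : ∀ d, P d = none → D.treeLabel P z₀ ⟨S', f'⟩ d = D.treeLabel P z₀ ⟨S, f⟩ d)
    {z : D.Point} (hz : ¬ D.Linked S.toPartial z (D.lowerEnd P z₀ c)) :
    label f' z = label f z := by
  have hm := hP.merges hS hc hSc hS'c hSS'
  rcases hP.exists_linked hS z₀ z with h1 | ⟨d, hd, hSd, h1⟩
  · rw [label_congr f h1, label_congr f' (hm.mono h1), h0]
  · have hdc : d ≠ c := by
      rintro rfl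
      exact hz h1
    have h2 := h d hd
    rw [treeLabel_of_eq (E := ⟨S, f⟩) hSd,
      treeLabel_of_eq (E := ⟨S', f'⟩) ((hSS' d hdc).trans hSd)] at h2
    rw [label_congr f h1, label_congr f' (hm.mono h1)]
    exact h2

/-- If the labels agree,
    and the label of the changed crossing `c` is not the value of `badSmoothing`,
then the change has the coefficient `1`: a circle labelled `v₊` merges into the circle above `c`, or
a circle labelled `v₋` splits off, and the label of the circle above is kept. -/
theorem IsLeaf.edgeCoeff_eq_one (hP : D.IsLeaf P) {E E' : D.EnhancedState}
    (hE : IsStateOf E.1 P) {c : Fin n} (hc : P c = none) (hEc : E.1 c = false)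
    (hE' : E'.1 = Function.update E.1 c true) (h0 : label E'.2 z₀ = label E.2 z₀)
    (h : ∀ d, P d = none → D.treeLabel P z₀ E' d = D.treeLabel P z₀ E d)
    (htc : D.treeLabel P z₀ E c ≠ D.badSmoothing P c) : D.edgeCoeff c E E' = 1 := by
  obtain ⟨S, f⟩ := E
  obtain ⟨S', f'⟩ := E'
  replace hE' : S' = Function.update S c true := hE'
  replace hEc : S c = false := hEc
  have hS' : IsStateOf S' P := hE' ▸ isStateOf_update hE hc true
  have hS'c : S' c = true := by rw [hE', Function.update_self]
  have hSS' : ∀ d, d ≠ c → S' d = S d := fun d hd => by rw [hE', Function.update_of_ne hd]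
  have hup : ∀ {S : KauffmanState n}, ¬ D.Linked S.toPartial (.inl (c, 0)) (.inl (c, 2)) →
      ¬ D.Linked S.toPartial (D.upperEnd P z₀ c) (D.lowerEnd P z₀ c) := by
    intro S h1 h2
    rcases ends_cases P z₀ c with h3 | h3 <;> rw [h3.1, h3.2] at h2
    · exact h1 h2.symm
    · exact h1 h2
  cases hbad : D.badSmoothing P c
  -- A merge with a circle labelled `v₊`.
  · have hSc : S c = D.badSmoothing P c := hEc.trans hbad.symm
    have hflip : S' c = !S c := by rw [hS'c, hEc]; rfl
    have hm := hP.merges hE hc hSc hflip hSS'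
    have hsame := fun z => hP.label_eq_of_labels_eq (z := z) hE hc hSc hflip hSS' h0 h
    have hl : label f (D.lowerEnd P z₀ c) = true := by
      rw [treeLabel_of_eq hSc, hbad] at htc
      simpa using htc
    have hh := hsame _ (hup hm.1)
    rw [edgeCoeff_of_merges hm, if_pos]
    · have hx : D.Linked S'.toPartial (.inl (c, 0)) (D.upperEnd P z₀ c) := by
        rcases ends_cases P z₀ c with h | h <;> rw [h.2]
        · exact hm.linked
        · exact rfl
      rw [label_congr f' hx, hh]
      rcases ends_cases P z₀ c with h3 | h3 <;> rw [h3.1] at hl <;> rw [h3.2, hl]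
      · cases label f (.inl (c, 2)) <;> rfl
      · cases label f (.inl (c, 0)) <;> rfl
    · intro z hz0 hz2
      exact hsame z ((not_linked_ends_iff P z₀ z S c).mp ⟨hz0, hz2⟩).1
  -- A circle labelled `v₋` splits off.
  · have hSc : S' c = D.badSmoothing P c := hS'c.trans hbad.symm
    have hflip : S c = !S' c := by rw [hS'c, hEc]; rfl
    have hSS'' : ∀ d, d ≠ c → S d = S' d := fun d hd => (hSS' d hd).symm
    have hm := hP.merges hS' hc hSc hflip hSS''
    have hsame := fun z => hP.label_eq_of_labels_eq (z := z) hS' hc hSc hflip hSS'' h0.symm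
      fun d hd => (h d hd).symm
    have hl : label f' (D.lowerEnd P z₀ c) = false := by
      rw [← h c hc, treeLabel_of_eq hSc, hbad] at htc
      simpa using htc
    have hh := hsame _ (hup hm.1)
    rw [edgeCoeff_of_splits hm, if_pos]
    · have hx : D.Linked S.toPartial (.inl (c, 0)) (D.upperEnd P z₀ c) := by
        rcases ends_cases P z₀ c with h | h <;> rw [h.2]
        · exact hm.linked
        · exact rfl
      rw [label_congr f hx, hh]
      rcases ends_cases P z₀ c with h3 | h3 <;> rw [h3.1] at hl <;> rw [h3.2, hl]
      · cases label f' (.inl (c, 2)) <;> rfl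
      · cases label f' (.inl (c, 0)) <;> rfl
    · intro z hz
      rw [hm.linked_left_iff, not_or] at hz
      exact (hsame z ((not_linked_ends_iff P z₀ z S' c).mp hz).1).symm

end PDCode

/-! ### The matching -/

namespace PDCode

variable {n : ℕ} {D : PDCode n} {z₀ : D.Point}

variable (D) in
/-- The crossing `c` of the leaf of `E` can be used to match `E`: its label is not `badSmoothing`,
    so
that the change of its smoothing has the coefficient `±1` between states with the same labels. -/
def IsFree (z₀ : D.Point) (E : D.EnhancedState) (c : Fin n) : Prop :=
  D.leafOf E.1 c = none ∧ D.treeLabel (D.leafOf E.1) z₀ E c ≠ D.badSmoothing (D.leafOf E.1) c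

variable (D) in
/-- The first free crossing, at which `E` is matched. -/
def IsFirstFree (z₀ : D.Point) (E : D.EnhancedState) (c : Fin n) : Prop :=
  D.IsFree z₀ E c ∧ ∀ d, d < c → ¬ D.IsFree z₀ E d

variable (D) in
/-- The states that are not matched. -/
def IsCritical (z₀ : D.Point) (E : D.EnhancedState) : Prop := ∀ c, ¬ D.IsFree z₀ E c

variable (D) in
/-- The matched states with the `0`-smoothing (`b = false`, the sources), respectively with the
`1`-smoothing (`b = true`, the targets), at the first free crossing. -/
def IsMatched (z₀ : D.Point) (b : Bool) (E : D.EnhancedState) : Prop :=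
  ∃ c, D.IsFirstFree z₀ E c ∧ E.1 c = b

variable (D) in
/-- Two states of the same leaf with the same labels at the root and at the crossings. -/
def SameLabels (z₀ : D.Point) (E E' : D.EnhancedState) : Prop :=
  D.leafOf E'.1 = D.leafOf E.1 ∧ label E'.2 z₀ = label E.2 z₀ ∧
    ∀ d, D.leafOf E.1 d = none → D.treeLabel (D.leafOf E.1) z₀ E' d =
      D.treeLabel (D.leafOf E.1) z₀ E d

variable (D) in
/-- The matching: `E'` is obtained from `E` by the change of the first free crossing from the `0`-
to the `1`-smoothing, while all labels are kept. -/
def IsPartner (z₀ : D.Point) (E E' : D.EnhancedState) : Prop :=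
  D.SameLabels z₀ E E' ∧ ∃ c, D.IsFirstFree z₀ E c ∧ E.1 c = false ∧
    E'.1 = Function.update E.1 c true

variable (D) in
/-- A quantity that increases along the zigzags of the matching: the position of the leaf, and,
within a leaf, the closeness of the labels `v₋` to the root. -/
noncomputable def matchingKey (z₀ : D.Point) (E : D.EnhancedState) :
    Lex (Lex (Fin n → Bool) × ℤ) :=
  toLex (leafKey (D.leafOf E.1), -D.height (D.leafOf E.1) z₀ E)

theorem isCritical_or_isMatched (z₀ : D.Point) (E : D.EnhancedState) :
    D.IsCritical z₀ E ∨ ∃ b, D.IsMatched z₀ b E := by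
  by_cases h : D.IsCritical z₀ E
  · exact .inl h
  · simp only [IsCritical, not_forall, not_not] at h
    obtain ⟨c, hc, hmin⟩ := WellFounded.has_min wellFounded_lt {c | D.IsFree z₀ E c} h
    exact .inr ⟨_, c, ⟨hc, fun d hd hfree => hmin d hfree hd⟩, rfl⟩

theorem IsFirstFree.unique {E : D.EnhancedState} {c c' : Fin n} (h : D.IsFirstFree z₀ E c)
    (h' : D.IsFirstFree z₀ E c') : c = c' := by
  rcases lt_trichotomy c c' with hlt | heq | hlt
  · exact absurd h.1 (h'.2 c hlt)
  · exact heq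
  · exact absurd h'.1 (h.2 c' hlt)

theorem IsMatched.unique {E : D.EnhancedState} {b b' : Bool} (h : D.IsMatched z₀ b E)
    (h' : D.IsMatched z₀ b' E) : b = b' := by
  obtain ⟨c, hc, rfl⟩ := h
  obtain ⟨c', hc', rfl⟩ := h'
  rw [hc.unique hc']

theorem IsMatched.not_isCritical {E : D.EnhancedState} {b : Bool} (h : D.IsMatched z₀ b E) :
    ¬ D.IsCritical z₀ E := fun h' => h' _ h.choose_spec.1.1

namespace SameLabels

variable {E E' E'' : D.EnhancedState}

theorem symm (h : D.SameLabels z₀ E E') : D.SameLabels z₀ E' E :=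
  ⟨h.1.symm, h.2.1.symm, fun d hd => by rw [h.1] at hd ⊢; exact (h.2.2 d hd).symm⟩

theorem trans (h : D.SameLabels z₀ E E') (h' : D.SameLabels z₀ E' E'') :
    D.SameLabels z₀ E E'' := by
  obtain ⟨h1, h2, h3⟩ := h
  obtain ⟨h1', h2', h3'⟩ := h'
  rw [h1] at h1' h3'
  exact ⟨h1', h2'.trans h2, fun d hd => (h3' d hd).trans (h3 d hd)⟩

theorem isFree_iff (h : D.SameLabels z₀ E E') (c : Fin n) :
    D.IsFree z₀ E' c ↔ D.IsFree z₀ E c := by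
  unfold IsFree
  rw [h.1]
  exact and_congr_right fun hc => by rw [h.2.2 c hc]

theorem isFirstFree_iff (h : D.SameLabels z₀ E E') (c : Fin n) :
    D.IsFirstFree z₀ E' c ↔ D.IsFirstFree z₀ E c := by
  simp only [IsFirstFree, h.isFree_iff]

theorem matchingKey_eq (h : D.SameLabels z₀ E E') :
    D.matchingKey z₀ E' = D.matchingKey z₀ E := by
  unfold matchingKey
  rw [h.1]
  congr 3
  unfold height
  refine Finset.sum_congr rfl fun d _ => ?_
  by_cases hd : D.leafOf E.1 d = none
  · rw [h.2.2 d hd]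
  · rw [if_neg fun h0 => hd h0.1, if_neg fun h0 => hd h0.1]

theorem eq_of_fst_eq (hD : D.IsConnected) (h : D.SameLabels z₀ E E') (h1 : E.1 = E'.1) : E = E' :=
  (isLeaf_leafOf hD E.1).ext z₀ (isStateOf_leafOf E.1) h1 h.2.1.symm
    fun c hc => (h.2.2 c hc).symm

end SameLabels

theorem exists_sameLabels_update (hD : D.IsConnected) {E : D.EnhancedState} {c : Fin n}
    (hc : D.IsFree z₀ E c) (b : Bool) :
    ∃ E' : D.EnhancedState, E'.1 = Function.update E.1 c b ∧ D.SameLabels z₀ E E' := by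
  have hS := isStateOf_update (isStateOf_leafOf (D := D) E.1) hc.1 b
  obtain ⟨f, h0, h⟩ := (isLeaf_leafOf hD E.1).exists_labels z₀ hS (label E.2 z₀)
    (D.treeLabel (D.leafOf E.1) z₀ E) fun d hd hne => by
      by_cases hdc : d = c
      · subst hdc
        have := hc.2
        revert this
        cases D.treeLabel (D.leafOf E.1) z₀ E d <;>
          cases D.badSmoothing (D.leafOf E.1) d <;> simp
      · rw [Function.update_of_ne hdc] at hne
        exact treeLabel_of_ne hne
  exact ⟨⟨_, f⟩, rfl, leafOf_eq_of_isStateOf hS, h0, h⟩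

theorem IsMatched.exists_isPartner (hD : D.IsConnected) {E : D.EnhancedState}
    (h : D.IsMatched z₀ false E) : ∃ E', D.IsPartner z₀ E E' := by
  obtain ⟨c, hc, hEc⟩ := h
  obtain ⟨E', h1, h2⟩ := exists_sameLabels_update hD hc.1 true
  exact ⟨E', h2, c, hc, hEc, h1⟩

theorem IsMatched.exists_isPartner_left (hD : D.IsConnected) {E' : D.EnhancedState}
    (h : D.IsMatched z₀ true E') : ∃ E, D.IsPartner z₀ E E' := by
  obtain ⟨c, hc, hEc⟩ := h
  obtain ⟨E, h1, h2⟩ := exists_sameLabels_update hD hc.1 false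
  refine ⟨E, h2.symm, c, (h2.isFirstFree_iff c).mpr hc, by rw [h1, Function.update_self], ?_⟩
  rw [h1, Function.update_idem, ← hEc, Function.update_eq_self]

namespace IsPartner

variable {E E' E'' : D.EnhancedState}

theorem isMatched_left (h : D.IsPartner z₀ E E') : D.IsMatched z₀ false E := by
  obtain ⟨_, c, hc, hEc, _⟩ := h
  exact ⟨c, hc, hEc⟩

theorem isMatched_right (h : D.IsPartner z₀ E E') : D.IsMatched z₀ true E' := by
  obtain ⟨hs, c, hc, hEc, hE'⟩ := h
  exact ⟨c, (hs.isFirstFree_iff c).mpr hc, by rw [hE', Function.update_self]⟩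

theorem right_unique (hD : D.IsConnected) (h : D.IsPartner z₀ E E') (h' : D.IsPartner z₀ E E'') :
    E' = E'' := by
  obtain ⟨hs, c, hc, _, hE'⟩ := h
  obtain ⟨hs', c', hc', _, hE''⟩ := h'
  refine (hs.symm.trans hs').eq_of_fst_eq hD ?_
  rw [hE', hE'', hc.unique hc']

theorem left_unique (hD : D.IsConnected) (h : D.IsPartner z₀ E E'') (h' : D.IsPartner z₀ E' E'') :
    E = E' := by
  obtain ⟨hs, c, hc, hEc, hE⟩ := h
  obtain ⟨hs', c', hc', hEc', hE'⟩ := h'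
  obtain rfl := hc.unique (((hs.trans hs'.symm).isFirstFree_iff c').mp hc')
  refine (hs.trans hs'.symm).eq_of_fst_eq hD ?_
  have := hE.symm.trans hE'
  funext d
  by_cases hd : d = c
  · subst hd; rw [hEc, hEc']
  · have h0 := congrFun this d
    rwa [Function.update_of_ne hd, Function.update_of_ne hd] at h0

theorem isUnit_incidence (hD : D.IsConnected) (h : D.IsPartner z₀ E E') :
    IsUnit (D.incidence E E') := by
  obtain ⟨hs, c, hc, hEc, hE'⟩ := h
  rw [incidence_eq_of_update hEc hE', (isLeaf_leafOf hD E.1).edgeCoeff_eq_one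
    (isStateOf_leafOf E.1) hc.1.1 hEc hE' hs.2.1 hs.2.2 hc.1.2, mul_one]
  exact (IsUnit.neg isUnit_one).pow _

/-- The matching is acyclic: the differential from a source to the target matched with `F` vanishes
unless it starts from `F` itself or from a source of smaller key. -/
theorem eq_or_matchingKey_lt (hD : D.IsConnected) {F F' : D.EnhancedState}
    (h : D.IsPartner z₀ F F') (hE : D.IsMatched z₀ false E) (hne : D.incidence E F' ≠ 0) :
    E = F ∨ D.matchingKey z₀ E < D.matchingKey z₀ F := by
  obtain ⟨c, hEc, hF', hedge⟩ := exists_of_incidence_ne_zero hne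
  by_cases hleaf : D.leafOf F'.1 = D.leafOf E.1
  · have hc : D.leafOf E.1 c = none := by
      rcases h0 : D.leafOf E.1 c with _ | b
      · rfl
      · have h1 := isStateOf_leafOf (D := D) E.1 c b h0
        have h2 := isStateOf_leafOf (D := D) F'.1 c b (hleaf ▸ h0)
        rw [hF', Function.update_self] at h2
        rw [hEc, ← h2] at h1
        exact absurd h1 (by simp)
    rcases (isLeaf_leafOf hD E.1).labels_eq_or_height_lt z₀ (isStateOf_leafOf E.1) hc hEc hF' hedge
      with ⟨h0, h1⟩ | hlt
    · left
      have hs : D.SameLabels z₀ E F' := ⟨hleaf, h0, h1⟩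
      obtain ⟨d, hd, hEd⟩ := hE
      obtain ⟨e, he, hFe⟩ := h.isMatched_right
      obtain rfl := hd.unique ((hs.isFirstFree_iff e).mp he)
      have hdc : d = c := by
        by_contra hdc
        rw [hF', Function.update_of_ne hdc, hEd] at hFe
        exact absurd hFe (by simp)
      subst hdc
      exact left_unique hD ⟨hs, d, hd, hEd, hF'⟩ h
    · right
      rw [← h.1.matchingKey_eq]
      refine Prod.Lex.toLex_lt_toLex.mpr (.inr ⟨?_, ?_⟩)
      · rw [hleaf]
      · rw [hleaf]
        exact neg_lt_neg hlt
  · right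
    rw [← h.1.matchingKey_eq]
    refine Prod.Lex.toLex_lt_toLex.mpr (.inl ?_)
    change leafKey (D.leafOf E.1) < leafKey (D.leafOf F'.1)
    rw [hF'] at hleaf ⊢
    exact leafKey_lt hEc hleaf

end IsPartner

end PDCode

/-! ### Triangular matrices and Gaussian elimination -/

/-- A square matrix whose entries are units on the graph of a bijection, and vanish outside of it
unless a key increases, is invertible. -/
theorem exists_inverse_of_triangular {ι κ α : Type*} [Fintype ι] [Fintype κ] [DecidableEq ι]
    [DecidableEq κ] [LinearOrder α] (e : ι ≃ κ) (K : ι → κ → ℤ) (key : ι → α)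
    (hunit : ∀ a, IsUnit (K a (e a)))
    (htri : ∀ a b, K a (e b) ≠ 0 → a = b ∨ key a < key b) :
    ∃ L : κ → ι → ℤ, (∀ a a', ∑ b, K a b * L b a' = if a = a' then 1 else 0) ∧
      ∀ b b', ∑ a, L b a * K a b' = if b = b' then 1 else 0 := by
  classical
  let M : Matrix ι ι ℤ := Matrix.of fun a b => K a (e b)
  have hM : M.BlockTriangular key := by
    intro a b hab
    by_contra h0
    rcases htri a b h0 with h | h
    · exact absurd hab (by rw [h]; exact lt_irrefl _)
    · exact absurd hab (not_lt_of_gt h)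
  have hdet : IsUnit M.det := by
    rw [hM.det]
    refine IsUnit.prod_iff.mpr fun k _ => ?_
    have : M.toSquareBlock key k = Matrix.diagonal fun i => K i.1 (e i.1) := by
      ext i j
      by_cases hij : i = j
      · subst hij
        rw [Matrix.diagonal_apply_eq]
        rfl
      · rw [Matrix.diagonal_apply_ne _ hij]
        by_contra h0
        rcases htri i.1 j.1 h0 with h | h
        · exact hij (Subtype.ext h)
        · rw [i.2, j.2] at h
          exact lt_irrefl _ h
    rw [this, Matrix.det_diagonal]
    exact IsUnit.prod_iff.mpr fun i _ => hunit _
  refine ⟨fun b a => M⁻¹ (e.symm b) a, fun a a' => ?_, fun b b' => ?_⟩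
  · have := congrFun (congrFun (Matrix.mul_nonsing_inv M hdet) a) a'
    rw [Matrix.mul_apply, Matrix.one_apply] at this
    rw [← this, ← e.sum_comp]
    exact Finset.sum_congr rfl fun b _ =>
      congrArg (fun x => K a (e b) * M⁻¹ x a') (e.symm_apply_apply b)
  · have := congrFun (congrFun (Matrix.nonsing_inv_mul M hdet) (e.symm b)) (e.symm b')
    rw [Matrix.mul_apply, Matrix.one_apply] at this
    simp only [e.symm.injective.eq_iff] at this
    rw [← this]
    refine Finset.sum_congr rfl fun a _ => ?_
    change _ = _ * K a (e (e.symm b'))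
    rw [e.apply_symm_apply]

/-- A complex with a partial contraction `h`, which pairs off the part `pM` of each module with the
part `pN` of the next one, is the direct sum of a contractible complex and of a complex whose
modules are the remaining parts `R i`. -/
theorem exists_iso_biprod_of_contraction (C : CochainComplex (ModuleCat.{0} ℤ) ℤ)
    (h : ∀ i, C.X (i + 1) ⟶ C.X i) (pM pN : ∀ i, C.X i ⟶ C.X i) (R : ℤ → ModuleCat.{0} ℤ)
    (inc : ∀ i, R i ⟶ C.X i) (proj : ∀ i, C.X i ⟶ R i)
    (inc_proj : ∀ i, inc i ≫ proj i = 𝟙 _) (sum_eq : ∀ i, pM i + pN i + proj i ≫ inc i = 𝟙 _)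
    (hh : ∀ i, h (i + 1) ≫ h i = 0) (h_pM : ∀ i, h i ≫ pM i = h i) (h_pN : ∀ i, h i ≫ pN i = 0)
    (h_proj : ∀ i, h i ≫ proj i = 0) (pM_h : ∀ i, pM (i + 1) ≫ h i = 0)
    (inc_h : ∀ i, inc (i + 1) ≫ h i = 0)
    (pM_d_h : ∀ i, pM i ≫ C.d i (i + 1) ≫ h i = pM i)
    (h_d_pN : ∀ i, h i ≫ C.d i (i + 1) ≫ pN (i + 1) = pN (i + 1)) :
    ∃ A B : CochainComplex (ModuleCat.{0} ℤ) ℤ, Nonempty (C ≅ A ⊞ B) ∧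
      Nonempty (Homotopy (𝟙 B) 0) ∧ ∀ i, Nonempty (A.X i ≅ R i) := by
  have hdh : ∀ i, h i ≫ C.d i (i + 1) ≫ h i = h i := fun i => by
    calc h i ≫ C.d i (i + 1) ≫ h i = (h i ≫ pM i) ≫ C.d i (i + 1) ≫ h i := by rw [h_pM]
      _ = h i := by rw [Category.assoc, pM_d_h, h_pM]
  let e : C ⟶ C := Homotopy.nullHomotopicMap' fun i j (hij : j + 1 = i) =>
    eqToHom (by rw [hij]) ≫ h j
  have he : Homotopy e 0 := Homotopy.nullHomotopy' _
  have hef : ∀ i, e.f (i + 1) =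
      C.d (i + 1) (i + 1 + 1) ≫ h (i + 1) + h i ≫ C.d i (i + 1) := fun i => by
    have := Homotopy.nullHomotopicMap'_f (C := C) (D := C) (c := ComplexShape.up ℤ)
      (k₂ := i) (k₁ := i + 1) (k₀ := i + 1 + 1) rfl rfl
      fun i j (hij : j + 1 = i) => eqToHom (by rw [hij]) ≫ h j
    simpa using this
  have hidem : e ≫ e = e := by
    ext1 i
    obtain ⟨i, rfl⟩ : ∃ k, i = k + 1 := ⟨i - 1, by ring⟩
    rw [HomologicalComplex.comp_f, hef]
    simp only [Preadditive.add_comp, Preadditive.comp_add, Category.assoc]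
    rw [hdh (i + 1), reassoc_of% (hh i), reassoc_of% (C.d_comp_d i (i + 1) (i + 1 + 1)),
      reassoc_of% (hdh i)]
    simp
  have hidem' : (𝟙 C - e) ≫ (𝟙 C - e) = 𝟙 C - e := by
    simp [Preadditive.sub_comp, Preadditive.comp_sub, hidem]
  obtain ⟨B, iB, πB, hB1, hB2⟩ := IsIdempotentComplete.idempotents_split C e hidem
  obtain ⟨A, iA, πA, hA1, hA2⟩ := IsIdempotentComplete.idempotents_split C (𝟙 C - e) hidem'
  have eπB : e ≫ πB = πB := by rw [← hB2, Category.assoc, hB1, Category.comp_id]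
  have iBe : iB ≫ e = iB := by rw [← hB2, reassoc_of% hB1]
  have iAe : iA ≫ e = 0 := by
    have : iA ≫ (𝟙 C - e) = iA := by rw [← hA2, reassoc_of% hA1]
    rwa [Preadditive.comp_sub, Category.comp_id, sub_eq_self] at this
  have eπA : e ≫ πA = 0 := by
    have : (𝟙 C - e) ≫ πA = πA := by rw [← hA2, Category.assoc, hA1, Category.comp_id]
    rwa [Preadditive.sub_comp, Category.id_comp, sub_eq_self] at this
  have iAπB : iA ≫ πB = 0 := by rw [← eπB, reassoc_of% iAe, Limits.zero_comp]
  have iBπA : iB ≫ πA = 0 := by rw [← iBe, Category.assoc, eπA, Limits.comp_zero]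
  refine ⟨A, B, ⟨⟨Limits.biprod.lift πA πB, Limits.biprod.desc iA iB, ?_, ?_⟩⟩, ⟨?_⟩, fun i => ?_⟩
  · rw [Limits.biprod.lift_desc, hA2, hB2]
    simp
  · refine Limits.biprod.hom_ext' _ _ (Limits.biprod.hom_ext _ _ ?_ ?_)
      (Limits.biprod.hom_ext _ _ ?_ ?_) <;> simp [hA1, hB1, iAπB, iBπA]
  · refine (Homotopy.ofEq ?_).trans (((he.compRight πB).compLeft iB).trans (Homotopy.ofEq ?_))
    · rw [eπB, hB1]
    · simp
  · obtain ⟨i, rfl⟩ : ∃ k, i = k + 1 := ⟨i - 1, by ring⟩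
    have a1 : iA.f (i + 1) ≫ πA.f (i + 1) = 𝟙 _ := by
      rw [← HomologicalComplex.comp_f, hA1, HomologicalComplex.id_f]
    have a2 : πA.f (i + 1) ≫ iA.f (i + 1) = 𝟙 _ - e.f (i + 1) := by
      rw [← HomologicalComplex.comp_f, hA2, HomologicalComplex.sub_f_apply,
        HomologicalComplex.id_f]
    have a3 : iA.f (i + 1) ≫ e.f (i + 1) = 0 := by
      rw [← HomologicalComplex.comp_f, iAe, HomologicalComplex.zero_f]
    have a4 : e.f (i + 1) ≫ πA.f (i + 1) = 0 := by
      rw [← HomologicalComplex.comp_f, eπA, HomologicalComplex.zero_f]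
    have b1 : pM (i + 1) ≫ e.f (i + 1) = pM (i + 1) := by
      rw [hef, Preadditive.comp_add, pM_d_h, reassoc_of% (pM_h i)]
      simp
    have b2 : e.f (i + 1) ≫ pN (i + 1) = pN (i + 1) := by
      rw [hef, Preadditive.add_comp, Category.assoc, Category.assoc, h_d_pN, h_pN]
      simp
    have c1 : pM (i + 1) ≫ πA.f (i + 1) = 0 := by rw [← b1, Category.assoc, a4, Limits.comp_zero]
    have c2 : iA.f (i + 1) ≫ pN (i + 1) = 0 := by
      rw [← b2, reassoc_of% a3, Limits.zero_comp]
    refine ⟨⟨iA.f (i + 1) ≫ proj (i + 1), inc (i + 1) ≫ πA.f (i + 1), ?_, ?_⟩⟩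
    · have : proj (i + 1) ≫ inc (i + 1) = 𝟙 _ - pM (i + 1) - pN (i + 1) := by
        rw [← sum_eq (i + 1)]
        abel
      rw [Category.assoc, reassoc_of% this]
      simp only [Preadditive.sub_comp, Preadditive.comp_sub, Category.id_comp, c1, a1,
        reassoc_of% c2]
      simp
    · rw [Category.assoc, reassoc_of% a2, hef]
      simp only [Preadditive.sub_comp, Preadditive.comp_sub, Preadditive.add_comp,
        Preadditive.comp_add, Category.id_comp, Category.assoc, inc_proj, h_proj,
        reassoc_of% (inc_h i)]
      simp

/-! ### Complexes of free modules with a matching of the bases -/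

/-- The map of free modules with a given matrix, which acts on row vectors from the right. -/
noncomputable def matrixHom {X Y : Type} [Fintype Y] (m : Matrix X Y ℤ) :
    ModuleCat.of ℤ (X →₀ ℤ) ⟶ ModuleCat.of ℤ (Y →₀ ℤ) :=
  ModuleCat.ofHom (Finsupp.linearCombination ℤ fun x => ∑ y, Finsupp.single y (m x y))

section

variable {X Y Z : Type} [Fintype X] [Fintype Y] [Fintype Z]

theorem matrixHom_apply (m : Matrix X Y ℤ) (f : X →₀ ℤ) (y : Y) :
    ((matrixHom m).hom f : Y →₀ ℤ) y = ∑ x, f x * m x y := by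
  classical
  change (Finsupp.linearCombination ℤ (fun x => ∑ y, Finsupp.single y (m x y)) f) y = _
  rw [Finsupp.linearCombination_apply, Finsupp.sum_fintype _ _ (by simp), Finsupp.finsetSum_apply]
  refine Finset.sum_congr rfl fun x _ => ?_
  simp [Finsupp.single_apply]

theorem matrixHom_comp (m : Matrix X Y ℤ) (m' : Matrix Y Z ℤ) :
    matrixHom m ≫ matrixHom m' = matrixHom (m * m') := by
  refine ModuleCat.hom_ext (LinearMap.ext fun f => Finsupp.ext fun z => ?_)
  change ((matrixHom m').hom ((matrixHom m).hom f) : Z →₀ ℤ) z = _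
  rw [matrixHom_apply]
  refine ((Finset.sum_congr rfl fun y _ =>
    congrArg (· * m' y z) (matrixHom_apply m f y)).trans ?_).trans
    (matrixHom_apply (m * m') f z).symm
  simp only [Matrix.mul_apply, Finset.sum_mul, Finset.mul_sum, mul_assoc]
  exact Finset.sum_comm

theorem matrixHom_one [DecidableEq X] : matrixHom (1 : Matrix X X ℤ) = 𝟙 _ := by
  refine ModuleCat.hom_ext (LinearMap.ext fun f => Finsupp.ext fun z => ?_)
  refine (matrixHom_apply _ f z).trans ?_
  simp [Matrix.one_apply]

theorem matrixHom_add (m m' : Matrix X Y ℤ) :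
    matrixHom (m + m') = matrixHom m + matrixHom m' := by
  refine ModuleCat.hom_ext (LinearMap.ext fun f => Finsupp.ext fun z => ?_)
  refine (matrixHom_apply _ f z).trans ?_
  change _ = ((matrixHom m).hom f : Y →₀ ℤ) z + ((matrixHom m').hom f : Y →₀ ℤ) z
  rw [matrixHom_apply, matrixHom_apply, ← Finset.sum_add_distrib]
  simp only [Matrix.add_apply, mul_add]

theorem matrixHom_zero : matrixHom (0 : Matrix X Y ℤ) = 0 := by
  have := matrixHom_add (0 : Matrix X Y ℤ) 0
  rwa [add_zero, left_eq_add] at this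

end

open Classical in
/-- Algebraic discrete Morse theory: if the sources and the targets among the basis elements
correspond to each other so that the matrix of the differential between them is triangular with
units on the diagonal, then the complex is the direct sum of a contractible complex and of a complex
with the other basis elements as a basis. -/
theorem exists_iso_biprod_of_matching {ι : ℤ → Type} [∀ i, Fintype (ι i)]
    (m : ∀ i, Matrix (ι i) (ι (i + 1)) ℤ)
    (hd : ∀ i, matrixHom (m i) ≫ matrixHom (m (i + 1)) = 0)
    (src tgt crit : ∀ i, ι i → Prop) (hsrc : ∀ i a, src i a → ¬ tgt i a ∧ ¬ crit i a)
    (htgt : ∀ i a, tgt i a → ¬ crit i a) (hex : ∀ i a, src i a ∨ tgt i a ∨ crit i a)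
    (e : ∀ i, {a // src i a} ≃ {b // tgt (i + 1) b}) {α : Type*} [LinearOrder α]
    (key : ∀ i, ι i → α) (hunit : ∀ i a, IsUnit (m i a.1 (e i a).1))
    (htri : ∀ i (a b : {a // src i a}), m i a.1 (e i b).1 ≠ 0 →
      a = b ∨ key i a.1 < key i b.1) :
    ∃ A B : CochainComplex (ModuleCat.{0} ℤ) ℤ,
      Nonempty (CochainComplex.of (fun i => ModuleCat.of ℤ (ι i →₀ ℤ)) (fun i => matrixHom (m i)) hd
        ≅ A ⊞ B) ∧ Nonempty (Homotopy (𝟙 B) 0) ∧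
      ∀ i, Nonempty (A.X i ≅ ModuleCat.of ℤ ({a // crit i a} →₀ ℤ)) := by
  choose L hL1 hL2 using fun i => exists_inverse_of_triangular (e i)
    (fun a b => m i a.1 b.1) (fun a => key i a.1) (hunit i) (htri i)
  let H : ∀ i, Matrix (ι (i + 1)) (ι i) ℤ := fun i b a =>
    if hb : tgt (i + 1) b then if ha : src i a then L i ⟨b, hb⟩ ⟨a, ha⟩ else 0 else 0
  let δ : ∀ i, (ι i → Prop) → Matrix (ι i) (ι i) ℤ := fun i p =>
    Matrix.diagonal fun a => if p a then 1 else 0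
  have hδ : ∀ i p a a', δ i p a a' = if a = a' then (if p a then 1 else 0) else 0 :=
    fun i p a a' => Matrix.diagonal_apply _ _ _
  have hH : ∀ i b a, H i b a ≠ 0 → tgt (i + 1) b ∧ src i a := fun i b a h => by
    by_contra h0
    refine h ?_
    by_cases hb : tgt (i + 1) b
    · exact (dif_pos hb).trans (dif_neg fun ha => h0 ⟨hb, ha⟩)
    · exact dif_neg hb
  have hH0 : ∀ i b a, ¬ (tgt (i + 1) b ∧ src i a) → H i b a = 0 := fun i b a h => by
    by_contra h0
    exact h (hH i b a h0)
  have hmH : ∀ i a a', src i a → src i a' → ∑ b, m i a b * H i b a' = if a = a' then 1 else 0 := by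
    intro i a a' ha ha'
    have := hL1 i ⟨a, ha⟩ ⟨a', ha'⟩
    simp only [Subtype.mk.injEq] at this
    rw [← this, ← Finset.sum_filter_of_ne (p := tgt (i + 1)) fun b _ h =>
      (hH i b a' (right_ne_zero_of_mul h)).1, Finset.sum_subtype (p := tgt (i + 1)) _ (by simp)]
    exact Finset.sum_congr rfl fun b _ =>
      congrArg (m i a b.1 * ·) ((dif_pos b.2).trans (dif_pos ha'))
  have hHm : ∀ i b b', tgt (i + 1) b → tgt (i + 1) b' →
      ∑ a, H i b a * m i a b' = if b = b' then 1 else 0 := by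
    intro i b b' hb hb'
    have := hL2 i ⟨b, hb⟩ ⟨b', hb'⟩
    simp only [Subtype.mk.injEq] at this
    rw [← this, ← Finset.sum_filter_of_ne (p := src i) fun a _ h =>
      (hH i b a (left_ne_zero_of_mul h)).2, Finset.sum_subtype (p := src i) _ (by simp)]
    exact Finset.sum_congr rfl fun a _ =>
      congrArg (· * m i a.1 b') ((dif_pos hb).trans (dif_pos a.2))
  have h1 : ∀ i, H (i + 1) * H i = 0 := fun i => by
    ext c a
    rw [Matrix.mul_apply]
    refine Finset.sum_eq_zero fun b _ => ?_
    by_contra h0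
    exact (hsrc _ b (hH _ _ _ (left_ne_zero_of_mul h0)).2).1 (hH _ _ _ (right_ne_zero_of_mul h0)).1
  have h2 : ∀ i, H i * δ i (src i) = H i := fun i => by
    ext b a
    rw [Matrix.mul_diagonal]
    split_ifs with h
    · exact mul_one _
    · rw [hH0 i b a fun h' => h h'.2, zero_mul]
  have h3 : ∀ i, H i * δ i (tgt i) = 0 := fun i => by
    ext b a
    rw [Matrix.mul_diagonal]
    split_ifs with h
    · rw [hH0 i b a fun h' => (hsrc i a h'.2).1 h]
      rfl
    · exact mul_zero _
  have h4 : ∀ i, H i * (1 : Matrix (ι i) (ι i) ℤ).submatrix id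
      (Subtype.val : {a // crit i a} → ι i) = 0 := fun i => by
    ext b a
    simp only [Matrix.mul_apply, Matrix.submatrix_apply, Matrix.one_apply, id, mul_ite, mul_one,
      mul_zero, Finset.sum_ite_eq', Finset.mem_univ, if_true]
    exact hH0 i b a fun h' => (hsrc i a h'.2).2 a.2
  have h5 : ∀ i, δ (i + 1) (src (i + 1)) * H i = 0 := fun i => by
    ext b a
    rw [Matrix.diagonal_mul]
    split_ifs with h
    · rw [hH0 i b a fun h' => (hsrc _ b h).1 h'.1]
      rfl
    · exact zero_mul _
  have h6 : ∀ i, (1 : Matrix (ι (i + 1)) (ι (i + 1)) ℤ).submatrix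
      (Subtype.val : {a // crit (i + 1) a} → ι (i + 1)) id * H i = 0 := fun i => by
    ext b a
    simp only [Matrix.mul_apply, Matrix.submatrix_apply, Matrix.one_apply, id, ite_mul, one_mul,
      zero_mul, Finset.sum_ite_eq, Finset.mem_univ, if_true]
    exact hH0 i b a fun h' => htgt (i + 1) b h'.1 b.2
  have h7 : ∀ i, δ i (src i) * (m i * H i) = δ i (src i) := fun i => by
    ext a a'
    rw [Matrix.diagonal_mul, Matrix.mul_apply, hδ]
    by_cases ha : src i a
    · rw [if_pos ha, one_mul]
      by_cases ha' : src i a'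
      · exact hmH i a a' ha ha'
      · rw [Finset.sum_eq_zero fun b _ => by rw [hH0 i b a' fun h => ha' h.2, mul_zero],
          if_neg fun h : a = a' => ha' (h ▸ ha)]
    · rw [if_neg ha, zero_mul, ite_self]
  have h8 : ∀ i, H i * (m i * δ (i + 1) (tgt (i + 1))) = δ (i + 1) (tgt (i + 1)) := fun i => by
    ext b b'
    rw [← Matrix.mul_assoc, Matrix.mul_diagonal, Matrix.mul_apply, hδ]
    by_cases hb' : tgt (i + 1) b'
    · rw [if_pos hb', mul_one]
      by_cases hb : tgt (i + 1) b
      · rw [if_pos hb]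
        exact hHm i b b' hb hb'
      · rw [Finset.sum_eq_zero fun a _ => by rw [hH0 i b a fun h => hb h.1, zero_mul],
          if_neg hb, ite_self]
    · rw [if_neg hb', mul_zero]
      split_ifs with h h'
      · exact absurd (h ▸ h') hb'
      · rfl
      · rfl
  have h9 : ∀ i, (1 : Matrix (ι i) (ι i) ℤ).submatrix (Subtype.val : {a // crit i a} → ι i) id *
      (1 : Matrix (ι i) (ι i) ℤ).submatrix id (Subtype.val : {a // crit i a} → ι i) = 1 := by
    intro i
    ext a a'
    simp [Matrix.mul_apply, Matrix.one_apply, Subtype.ext_iff]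
  have h10 : ∀ i, δ i (src i) + δ i (tgt i) +
      (1 : Matrix (ι i) (ι i) ℤ).submatrix id (Subtype.val : {a // crit i a} → ι i) *
      (1 : Matrix (ι i) (ι i) ℤ).submatrix (Subtype.val : {a // crit i a} → ι i) id = 1 := by
    intro i
    have : (1 : Matrix (ι i) (ι i) ℤ).submatrix id (Subtype.val : {a // crit i a} → ι i) *
      (1 : Matrix (ι i) (ι i) ℤ).submatrix (Subtype.val : {a // crit i a} → ι i) id =
        δ i (crit i) := by
      ext a a'
      simp only [Matrix.mul_apply, Matrix.submatrix_apply, Matrix.one_apply, id, δ,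
        Matrix.diagonal_apply]
      by_cases ha : crit i a
      · rw [Finset.sum_eq_single_of_mem ⟨a, ha⟩ (Finset.mem_univ _)]
        · simp [ha]
        · rintro ⟨b, hb⟩ _ hne
          rw [if_neg fun h => hne (Subtype.ext h.symm), zero_mul]
      · rw [if_neg ha, ite_self]
        exact Finset.sum_eq_zero fun b _ => by
          rw [if_neg fun h : a = b.1 => ha (h ▸ b.2), zero_mul]
    rw [this]
    ext a a'
    rw [Matrix.add_apply, Matrix.add_apply, hδ, hδ, hδ, Matrix.one_apply]
    by_cases haa : a = a'
    · simp only [if_pos haa]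
      rcases hex i a with h | h | h
      · rw [if_pos h, if_neg (hsrc i a h).1, if_neg (hsrc i a h).2]
        rfl
      · rw [if_pos h, if_neg fun h' => (hsrc i a h').1 h, if_neg (htgt i a h)]
        rfl
      · rw [if_pos h, if_neg fun h' => (hsrc i a h').2 h, if_neg fun h' => htgt i a h' h]
        rfl
    · simp only [if_neg haa]
      rfl
  have hC : ∀ i, (CochainComplex.of (fun i => ModuleCat.of ℤ (ι i →₀ ℤ))
      (fun i => matrixHom (m i)) hd).d i (i + 1) = matrixHom (m i) := fun i =>
    CochainComplex.of_d (fun i => ModuleCat.of ℤ (ι i →₀ ℤ)) (fun i => matrixHom (m i)) i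
  refine exists_iso_biprod_of_contraction
    (CochainComplex.of (fun i => ModuleCat.of ℤ (ι i →₀ ℤ)) (fun i => matrixHom (m i)) hd)
    (fun i => matrixHom (H i)) (fun i => matrixHom (δ i (src i)))
    (fun i => matrixHom (δ i (tgt i))) (fun i => ModuleCat.of ℤ ({a // crit i a} →₀ ℤ))
    (fun i => matrixHom ((1 : Matrix (ι i) (ι i) ℤ).submatrix Subtype.val id))
    (fun i => matrixHom ((1 : Matrix (ι i) (ι i) ℤ).submatrix id Subtype.val))
    (fun i => ?_) (fun i => ?_) (fun i => ?_) (fun i => ?_) (fun i => ?_) (fun i => ?_)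
    (fun i => ?_) (fun i => ?_) (fun i => ?_) (fun i => ?_)
  · exact (matrixHom_comp _ _).trans ((congrArg matrixHom (h9 i)).trans matrixHom_one)
  · refine Eq.trans ?_ ((congrArg matrixHom (h10 i)).trans matrixHom_one)
    rw [matrixHom_add, matrixHom_add, ← matrixHom_comp]
  · exact (matrixHom_comp _ _).trans ((congrArg matrixHom (h1 i)).trans matrixHom_zero)
  · exact (matrixHom_comp _ _).trans (congrArg matrixHom (h2 i))
  · exact (matrixHom_comp _ _).trans ((congrArg matrixHom (h3 i)).trans matrixHom_zero)
  · exact (matrixHom_comp _ _).trans ((congrArg matrixHom (h4 i)).trans matrixHom_zero)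
  · exact (matrixHom_comp _ _).trans ((congrArg matrixHom (h5 i)).trans matrixHom_zero)
  · exact (matrixHom_comp _ _).trans ((congrArg matrixHom (h6 i)).trans matrixHom_zero)
  · rw [hC]
    refine Eq.trans ?_ (congrArg matrixHom (h7 i))
    rw [← matrixHom_comp, ← matrixHom_comp]
  · rw [hC]
    refine Eq.trans ?_ (congrArg matrixHom (h8 i))
    rw [← matrixHom_comp, ← matrixHom_comp]

/-! ### The decomposition of the Khovanov complex -/

namespace PDCode

variable {n : ℕ} {D : PDCode n} {z₀ : D.Point}

theorem IsPartner.degree_eq (hD : D.IsConnected) {s : StrandEnd n → Bool} (hs : D.IsAlternating s)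
    {E E' : D.EnhancedState} (h : D.IsPartner z₀ E E') :
    D.primaryDegree E' = D.primaryDegree E + 1 ∧ D.secondaryDegree E' = D.secondaryDegree E :=
  hs.degree_of_incidence_ne_zero (h.isUnit_incidence hD).ne_zero

/-- The matching in a fixed bidegree. -/
theorem exists_equiv_of_isPartner (hD : D.IsConnected) {s : StrandEnd n → Bool}
    (hs : D.IsAlternating s) (z₀ : D.Point) (i j : ℤ) :
    ∃ e : {E : D.BasisAt i j // D.IsMatched z₀ false E.1} ≃
        {E : D.BasisAt (i + 1) j // D.IsMatched z₀ true E.1},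
      ∀ E, D.IsPartner z₀ E.1.1 (e E).1.1 := by
  choose f hf using fun E : {E : D.BasisAt i j // D.IsMatched z₀ false E.1} =>
    E.2.exists_isPartner hD
  have hdeg := fun E => (hf E).degree_eq hD hs
  refine ⟨Equiv.ofBijective (fun E => ⟨⟨f E, ?_, ?_⟩, (hf E).isMatched_right⟩) ⟨?_, ?_⟩, hf⟩
  · rw [(hdeg E).1, E.1.2.1]
  · rw [(hdeg E).2, E.1.2.2]
  · intro E F h
    have h' : f E = f F := congrArg (fun x => x.1.1) h
    exact Subtype.ext (Subtype.ext ((hf E).left_unique hD (h' ▸ hf F)))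
  · intro F
    obtain ⟨E, hE⟩ := F.2.exists_isPartner_left hD
    have hd := hE.degree_eq hD hs
    rw [F.1.2.1, F.1.2.2] at hd
    refine ⟨⟨⟨E, by linarith [hd.1], hd.2.symm⟩, hE.isMatched_left⟩, ?_⟩
    exact Subtype.ext (Subtype.ext ((hf _).right_unique hD hE))

/-- The Khovanov complex is the direct sum of a contractible complex and of a complex with the
critical states as a basis. -/
theorem exists_khovanovComplex_iso (hD : D.IsConnected) {s : StrandEnd n → Bool}
    (hs : D.IsAlternating s) (z₀ : D.Point) (j : ℤ) :
    ∃ A B : CochainComplex (ModuleCat.{0} ℤ) ℤ,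
      Nonempty (D.khovanovComplex hs.khovanovD_comp j ≅ A ⊞ B) ∧ Nonempty (Homotopy (𝟙 B) 0) ∧
      ∀ i, Nonempty (A.X i ≅
        ModuleCat.of ℤ ({E : D.BasisAt i j // D.IsCritical z₀ E.1} →₀ ℤ)) := by
  choose e he using fun i => exists_equiv_of_isPartner hD hs z₀ i j
  refine exists_iso_biprod_of_matching (ι := fun i => D.BasisAt i j)
    (fun i => Matrix.of fun E E' => D.incidence E.1 E'.1) (fun i => hs.khovanovD_comp i j)
    (fun i E => D.IsMatched z₀ false E.1) (fun i E => D.IsMatched z₀ true E.1)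
    (fun i E => D.IsCritical z₀ E.1)
    (fun i E h => ⟨fun h' => absurd (h.unique h') (by simp), h.not_isCritical⟩)
    (fun i E h => h.not_isCritical) (fun i E => ?_) e (fun i E => D.matchingKey z₀ E.1)
    (fun i E => (he i E).isUnit_incidence hD) (fun i E F h => ?_)
  · rcases isCritical_or_isMatched z₀ E.1 with h | ⟨b, h⟩
    · exact .inr (.inr h)
    · cases b
      · exact .inl h
      · exact .inr (.inl h)
  · exact ((he i F).eq_or_matchingKey_lt hD E.2 h).imp (fun h => Subtype.ext (Subtype.ext h)) id

end PDCode

/-! ### The critical states -/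

namespace PDCode

variable {n : ℕ} {D : PDCode n} {P : PartialSmoothing n} {z₀ : D.Point}

/-- A nugatory crossing is negative if and only if its `1`-smoothing is the disconnecting one. -/
theorem IsLeaf.labelDegree_badSmoothing (hP : D.IsLeaf P) (o : D.Orientation P) {c : Fin n}
    (hc : P c = none) : labelDegree (D.badSmoothing P c) =
      if o.out (c, 0) ≠ o.out (c, 3) then 1 else -1 := by
  classical
  -- The part of the diagram on one side of `c` has exactly one ingoing and one outgoing end at `c`.
  have key := sum_ends_eq_zero (D := D) P c (fun x => if o.out x then 1 else -1)
    (fun x => by rw [o.out_glue]; cases o.out x <;> rfl)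
    (fun x _ => by rw [o.out_through]; cases o.out x <;> rfl)
    (fun x => D.Linked (D.cut P c) (.inl (c, 0)) (.inl x))
    (fun x hx => hx.trans (linked_glue _ _))
    (fun x hx hxc => by
      rw [← through_cut_of_ne (D := D) P hxc]
      exact hx.trans (linked_through _ _))
  have h02 := hP.not_linked_cut hc
  obtain ⟨a0, a2⟩ := linked_update_arc (D := D) P c (D.badSmoothing P c)
  have h3 := o.out_through (c, 1)
  simp only [PartialSmoothing.through, hc] at h3
  change o.out (c, 3) = _ at h3
  have h00 : D.Linked (D.cut P c) (.inl (c, 0)) (.inl (c, 0)) := rfl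
  rw [Fin.sum_univ_four, if_pos h00, if_neg h02] at key
  rcases hb : D.badSmoothing P c with _ | _ <;> rw [hb] at a0 a2
  · have h1 : D.Linked (D.cut P c) (.inl (c, 0)) (.inl (c, 1)) := by unfold cut; rw [hb]; exact a0
    have h23 : D.Linked (D.cut P c) (.inl (c, 2)) (.inl (c, 3)) := by unfold cut; rw [hb]; exact a2
    have h03 : ¬ D.Linked (D.cut P c) (.inl (c, 0)) (.inl (c, 3)) := fun h => h02 (h.trans h23.symm)
    rw [if_pos h1, if_neg h03] at key
    rw [h3]
    revert key
    cases o.out (c, 0) <;> cases o.out (c, 1) <;> simp [labelDegree]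
  · have h03 : D.Linked (D.cut P c) (.inl (c, 0)) (.inl (c, 3)) := by unfold cut; rw [hb]; exact a0
    have h21 : D.Linked (D.cut P c) (.inl (c, 2)) (.inl (c, 1)) := by unfold cut; rw [hb]; exact a2
    have h01 : ¬ D.Linked (D.cut P c) (.inl (c, 0)) (.inl (c, 1)) := fun h => h02 (h.trans h21.symm)
    rw [if_pos h03, if_neg h01] at key
    revert key
    cases o.out (c, 0) <;> cases o.out (c, 3) <;> simp [labelDegree]

theorem IsLeaf.w_eq (hP : D.IsLeaf P) (o : D.Orientation P) :
    o.w = ∑ c, if P c = none then labelDegree (D.badSmoothing P c) else 0 := by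
  unfold Orientation.w Orientation.numNeg Orientation.numPos
  rw [Finset.card_filter, Finset.card_filter, Nat.cast_sum, Nat.cast_sum, ← Finset.sum_sub_distrib]
  refine Finset.sum_congr rfl fun c _ => ?_
  by_cases hc : P c = none
  · rw [if_pos hc, hP.labelDegree_badSmoothing o hc]
    by_cases h : o.out (c, 0) = o.out (c, 3) <;> simp [hc, h]
  · simp [hc]

theorem numOne_toPartial (S : KauffmanState n) :
    (S.toPartial.numOne : ℤ) = ∑ c, if S c = true then 1 else 0 := by
  unfold PartialSmoothing.numOne
  rw [Finset.card_filter, Nat.cast_sum]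
  refine Finset.sum_congr rfl fun c _ => ?_
  by_cases h : S c = true <;> simp [KauffmanState.toPartial, h]

variable (D) in
/-- The state of the same leaf with the opposite smoothings at the crossings that are not smoothened
in the leaf. -/
noncomputable def flipOpen (S : KauffmanState n) : KauffmanState n :=
  fun c => if D.leafOf S c = none then !S c else S c

theorem flipOpen_of_eq {S : KauffmanState n} {c : Fin n} (hc : D.leafOf S c = none) :
    D.flipOpen S c = !S c := if_pos hc

theorem flipOpen_of_ne {S : KauffmanState n} {c : Fin n} (hc : D.leafOf S c ≠ none) :
    D.flipOpen S c = S c := if_neg hc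

theorem isStateOf_flipOpen (S : KauffmanState n) : IsStateOf (D.flipOpen S) (D.leafOf S) := by
  intro c b hb
  rw [flipOpen_of_ne (by simp [hb])]
  exact isStateOf_leafOf S c b hb

theorem leafOf_flipOpen (S : KauffmanState n) : D.leafOf (D.flipOpen S) = D.leafOf S :=
  leafOf_eq_of_isStateOf (isStateOf_flipOpen S)

theorem flipOpen_flipOpen (S : KauffmanState n) : D.flipOpen (D.flipOpen S) = S := by
  funext c
  by_cases hc : D.leafOf S c = none
  · rw [flipOpen_of_eq (by rwa [leafOf_flipOpen]), flipOpen_of_eq hc, Bool.not_not]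
  · rw [flipOpen_of_ne (by rwa [leafOf_flipOpen]), flipOpen_of_ne hc]

theorem isCritical_iff {E : D.EnhancedState} : D.IsCritical z₀ E ↔ ∀ c, D.leafOf E.1 c = none →
    E.1 c = D.badSmoothing (D.leafOf E.1) c ∧
      label E.2 (D.lowerEnd (D.leafOf E.1) z₀ c) = D.badSmoothing (D.leafOf E.1) c := by
  simp only [IsCritical, IsFree, not_and, not_not]
  refine forall₂_congr fun c hc => ⟨fun h => ?_, fun h => ?_⟩
  · by_cases hE : E.1 c = D.badSmoothing (D.leafOf E.1) c
    · rw [treeLabel_of_eq hE] at h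
      exact ⟨hE, h⟩
    · rw [treeLabel_of_ne hE] at h
      exact absurd h (by simp)
  · rw [treeLabel_of_eq h.1, h.2]

theorem IsCritical.eq_badSmoothing {E : D.EnhancedState} (h : D.IsCritical z₀ E) {c : Fin n}
    (hc : D.leafOf E.1 c = none) : E.1 c = D.badSmoothing (D.leafOf E.1) c :=
  (isCritical_iff.mp h c hc).1

theorem IsCritical.connectedAt_flipOpen (hD : D.IsConnected) {E : D.EnhancedState}
    (h : D.IsCritical z₀ E) : D.ConnectedAt (D.flipOpen E.1).toPartial :=
  (isLeaf_leafOf hD E.1).connectedAt_of_forall_ne (isStateOf_flipOpen E.1) fun c hc => by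
    rw [flipOpen_of_eq hc, h.eq_badSmoothing hc]
    simp

theorem flipOpen_eq_badSmoothing (hD : D.IsConnected) {S : KauffmanState n}
    (hS : D.ConnectedAt S.toPartial) {c : Fin n} (hc : D.leafOf S c = none) :
    D.flipOpen S c = D.badSmoothing (D.leafOf S) c := by
  have : S c ≠ D.badSmoothing (D.leafOf S) c := fun h =>
    (isLeaf_leafOf hD S).not_linked_ends (isStateOf_leafOf S) hc h
      ((connectedAt_iff.mp hS).1 _ _)
  rw [flipOpen_of_eq hc]
  revert this
  cases S c <;> cases D.badSmoothing (D.leafOf S) c <;> simp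

theorem IsCritical.ext (hD : D.IsConnected) {E E' : D.EnhancedState} (h : D.IsCritical z₀ E)
    (h' : D.IsCritical z₀ E') (hS : D.flipOpen E.1 = D.flipOpen E'.1)
    (h0 : label E.2 z₀ = label E'.2 z₀) : E = E' := by
  have hEE : E.1 = E'.1 := by rw [← flipOpen_flipOpen (D := D) E.1, hS, flipOpen_flipOpen]
  refine (isLeaf_leafOf hD E.1).ext z₀ (isStateOf_leafOf E.1) hEE h0 fun c hc => ?_
  have h1 := isCritical_iff.mp h c hc
  have hl : D.leafOf E'.1 = D.leafOf E.1 := by rw [hEE]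
  have h2 := isCritical_iff.mp h' c (by rwa [hl])
  rw [hl] at h2
  rw [treeLabel_of_eq h1.1, treeLabel_of_eq h2.1, h1.2, h2.2]

theorem exists_isCritical (hD : D.IsConnected) (z₀ : D.Point) {S : KauffmanState n}
    (hS : D.ConnectedAt S.toPartial) (ε : Bool) :
    ∃ E : D.EnhancedState, D.IsCritical z₀ E ∧ D.flipOpen E.1 = S ∧ label E.2 z₀ = ε := by
  obtain ⟨f, h0, h⟩ := (isLeaf_leafOf hD S).exists_labels z₀ (isStateOf_flipOpen S) ε
    (D.badSmoothing (D.leafOf S))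
    fun c hc hne => absurd (flipOpen_eq_badSmoothing hD hS hc) hne
  refine ⟨⟨D.flipOpen S, f⟩, isCritical_iff.mpr ?_, flipOpen_flipOpen S, h0⟩
  rw [leafOf_flipOpen]
  refine fun c hc => ⟨flipOpen_eq_badSmoothing hD hS hc, ?_⟩
  rw [← treeLabel_of_eq (flipOpen_eq_badSmoothing hD hS hc)]
  exact h c hc

section Degree

variable {E : D.EnhancedState}

theorem IsCritical.primaryDegree_eq (hD : D.IsConnected) (h : D.IsCritical z₀ E)
    (o : D.Orientation (D.leafOf (D.flipOpen E.1))) :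
    D.primaryDegree E = (D.flipOpen E.1).toPartial.numOne + o.w := by
  unfold primaryDegree
  rw [(isLeaf_leafOf hD _).w_eq o, numOne_toPartial, numOne_toPartial, ← Finset.sum_add_distrib,
    leafOf_flipOpen]
  refine Finset.sum_congr rfl fun c _ => ?_
  by_cases hc : D.leafOf E.1 c = none
  · rw [flipOpen_of_eq hc, if_pos hc, ← h.eq_badSmoothing hc]
    cases E.1 c <;> simp [labelDegree]
  · rw [flipOpen_of_ne hc, if_neg hc, add_zero]

/-- The circles of a critical state are the one through the base point, and the ones below the
crossings that are not smoothened in the leaf. -/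
theorem IsCritical.sum_labelDegree (hD : D.IsConnected) (h : D.IsCritical z₀ E) :
    ∑ x, labelDegree (E.2 x) = labelDegree (label E.2 z₀) +
      ∑ c, if D.leafOf E.1 c = none then labelDegree (D.badSmoothing (D.leafOf E.1) c) else 0 := by
  have hP := isLeaf_leafOf hD E.1
  have hS := isStateOf_leafOf (D := D) E.1
  have hc := isCritical_iff.mp h
  let F : Option {c // D.leafOf E.1 c = none} → D.Circle E.1 := fun x =>
    x.elim (D.comp E.1.toPartial z₀) fun c => D.comp E.1.toPartial (D.lowerEnd (D.leafOf E.1) z₀ c)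
  have hF : Function.Bijective F := by
    constructor
    · rintro (_ | ⟨c, hcP⟩) (_ | ⟨d, hdP⟩) hcd
      · rfl
      · exact absurd hcd (hP.not_linked_base hS z₀ hdP (hc d hdP).1)
      · exact absurd hcd.symm (hP.not_linked_base hS z₀ hcP (hc c hcP).1)
      · by_contra hne
        exact hP.not_linked_lowerEnd hS hcP hdP (fun h => hne (by subst h; rfl)) (hc c hcP).1
          (hc d hdP).1 hcd
    · intro x
      obtain ⟨z, rfl⟩ := D.comp_surjective E.1.toPartial x
      rcases hP.exists_linked hS z₀ z with hz | ⟨c, hcP, _, hz⟩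
      · exact ⟨none, Eq.symm hz⟩
      · exact ⟨some ⟨c, hcP⟩, Eq.symm hz⟩
  rw [← hF.sum_comp fun x => labelDegree (E.2 x), Fintype.sum_option, ← Finset.sum_filter,
    Finset.sum_subtype (p := fun c => D.leafOf E.1 c = none) _ (by simp)]
  congr 1
  exact Finset.sum_congr rfl fun c _ => congrArg labelDegree (hc c.1 c.2).2

theorem IsCritical.secondaryDegree_eq (hD : D.IsConnected) (h : D.IsCritical z₀ E)
    (o : D.Orientation (D.leafOf (D.flipOpen E.1))) :
    D.secondaryDegree E =
      (D.flipOpen E.1).toPartial.numOne + 2 * o.w + labelDegree (label E.2 z₀) := by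
  have h1 := h.primaryDegree_eq hD o
  have h2 := h.sum_labelDegree hD
  have h3 := (isLeaf_leafOf hD _).w_eq o
  simp only [leafOf_flipOpen] at h3
  rw [← h3] at h2
  unfold primaryDegree at h1
  rw [PDCode.secondaryDegree_eq, h1, h2]
  ring

end Degree

end PDCode

/-! ### Comparison of the bigraded modules -/

namespace PDCode

/-- The bases `v₊` and `v₋` of the homogeneous components of `𝒜`. -/
theorem nonempty_khovanovA_iso (q : ℤ × ℤ) :
    Nonempty (khovanovA q ≅ ModuleCat.of ℤ ({ε : Bool // q = (0, labelDegree ε)} →₀ ℤ)) := by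
  by_cases h : ∃ ε, q = (0, labelDegree ε)
  · obtain ⟨ε, hε⟩ := h
    have : khovanovA q = ModuleCat.of ℤ ℤ := if_pos (by
      cases ε
      · exact .inr hε
      · exact .inl hε)
    rw [this]
    have : Subsingleton {ε : Bool // q = (0, labelDegree ε)} := ⟨fun ⟨δ, hδ⟩ ⟨δ', hδ'⟩ => by
      have := hδ.symm.trans hδ'
      cases δ <;> cases δ' <;> simp [labelDegree] at this ⊢⟩
    exact ⟨(Finsupp.uniqueLinearEquiv ℤ ℤ ⟨ε, hε⟩).symm.toModuleIso⟩
  · have : khovanovA q = ModuleCat.of ℤ PUnit := if_neg fun h' =>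
      h (h'.elim (fun h' => ⟨true, h'⟩) fun h' => ⟨false, h'⟩)
    rw [this]
    have : IsEmpty {ε : Bool // q = (0, labelDegree ε)} := ⟨fun ε => h ⟨ε.1, ε.2⟩⟩
    exact ⟨(LinearEquiv.ofSubsingleton PUnit _).toModuleIso⟩

variable {n : ℕ} {D : PDCode n}

/-- The critical states of bidegree `(i, j)` correspond to the one-circle states with a label of
appropriate degree. -/
theorem nonempty_isCritical_equiv (hD : D.IsConnected) (z₀ : D.Point)
    (o : ∀ S : D.OneCircleState, D.Orientation (D.leafOf S.1)) (i j : ℤ) :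
    Nonempty ({E : D.BasisAt i j // D.IsCritical z₀ E.1} ≃ Σ S : D.OneCircleState,
      {ε : Bool // (i - S.1.toPartial.numOne - (o S).w, j - S.1.toPartial.numOne - 2 * (o S).w) =
        ((0 : ℤ), labelDegree ε)}) := by
  let S : {E : D.BasisAt i j // D.IsCritical z₀ E.1} → D.OneCircleState := fun E =>
    ⟨D.flipOpen E.1.1.1, E.2.connectedAt_flipOpen hD⟩
  refine ⟨Equiv.ofBijective (fun E => ⟨S E, label E.1.1.2 z₀, ?_⟩) ⟨?_, ?_⟩⟩
  · have h1 := E.2.primaryDegree_eq hD (o (S E))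
    have h2 := E.2.secondaryDegree_eq hD (o (S E))
    rw [E.1.2.1] at h1
    rw [E.1.2.2] at h2
    exact Prod.ext (by linarith) (by linarith)
  · intro E F h
    have h1 : S E = S F := congrArg Sigma.fst h
    have h2 : label E.1.1.2 z₀ = label F.1.1.2 z₀ := congrArg (fun x => x.2.1) h
    exact Subtype.ext (Subtype.ext (E.2.ext hD F.2 (congrArg Subtype.val h1) h2))
  · rintro ⟨⟨T, hT⟩, ε, hε⟩
    obtain ⟨E, hE, rfl, rfl⟩ := exists_isCritical hD z₀ hT ε
    have h1 := hE.primaryDegree_eq hD (o ⟨_, hT⟩)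
    have h2 := hE.secondaryDegree_eq hD (o ⟨_, hT⟩)
    have h3 := congrArg Prod.fst hε
    have h4 := congrArg Prod.snd hε
    simp only at h3 h4
    exact ⟨⟨⟨E, by linarith, by linarith⟩, hE⟩, rfl⟩

theorem nonempty_isCritical_iso (hD : D.IsConnected) (z₀ : D.Point)
    (o : ∀ S : D.OneCircleState, D.Orientation (D.leafOf S.1)) (p : ℤ × ℤ) :
    Nonempty (ModuleCat.of ℤ ({E : D.BasisAt p.1 p.2 // D.IsCritical z₀ E.1} →₀ ℤ) ≅
      BigradedModule.directSum (fun S : D.OneCircleState =>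
        (khovanovA.shift (o S).w (2 * (o S).w)).shift
          S.1.toPartial.numOne S.1.toPartial.numOne) p) := by
  obtain ⟨e⟩ := nonempty_isCritical_equiv hD z₀ o p.1 p.2
  have f := fun S : D.OneCircleState => (nonempty_khovanovA_iso
    (p.1 - S.1.toPartial.numOne - (o S).w, p.2 - S.1.toPartial.numOne - 2 * (o S).w)).some
  let g : ({E : D.BasisAt p.1 p.2 // D.IsCritical z₀ E.1} →₀ ℤ) ≃+ ⨁ S : D.OneCircleState,
      khovanovA (p.1 - S.1.toPartial.numOne - (o S).w, p.2 - S.1.toPartial.numOne - 2 * (o S).w) :=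
    (Finsupp.domCongr e).trans (sigmaFinsuppAddEquivDFinsupp.trans
      (DFinsupp.mapRange.addEquiv fun S => (f S).symm.toLinearEquiv.toAddEquiv))
  exact ⟨(g.toLinearEquiv fun r x => map_intCast_smul g ℤ ℤ r x).toModuleIso⟩

end PDCode

theorem theorem2p2 {n : ℕ} (D : LinkDiagram n) (hD : D.IsConnected)
    (o : ∀ S : D.OneCircleState, D.Orientation (D.leafOf S.1)) :
    ∃ h : ∀ i j, D.khovanovD i j ≫ D.khovanovD (i + 1) j = 0,
    ∃ A B : BigradedComplex,
      Nonempty (D.khovanovComplex h ≅ A.sum B) ∧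
      B.Contractible ∧
      Nonempty (A.toModule ≅ BigradedModule.directSum fun S : D.OneCircleState =>
        (khovanovA.shift (o S).w (2 * (o S).w)).shift
          S.1.toPartial.numOne S.1.toPartial.numOne) := by
  obtain ⟨s, hs⟩ := LinkDiagram.exists_isAlternating D hD
  obtain ⟨z₀⟩ := (PDCode.connectedAt_iff.mp hD).2
  choose A B e hB f using PDCode.exists_khovanovComplex_iso hD hs z₀
  refine ⟨hs.khovanovD_comp, A, B, ⟨Pi.isoMk fun j => (e j).some⟩, hB, ⟨Pi.isoMk fun p => ?_⟩⟩
  exact (f p.2 p.1).some ≪≫ (PDCode.nonempty_isCritical_iso hD z₀ o p).some
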